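/- **Setting.** There are $n$ applicants and $n$ positions. Each position $x$ has a fixed strict total order $\succ_x$ over the applicants; $q=\{\succ_x\}_x$ is a *set of priorities*. The type of an applicant is a strict total order over the positions, and any such order is possible. An outcome is a bijection $\mu$ between applicants and positions, and an applicant compares outcomes only by their own match. $\mu$ is *stable* if for all $a,p$ with $\mu(a)\neq p$ either $\mu(a)\succ_a p$ or $\mu^{-1}(p)\succ_p a$. The social choice function $\mathtt{DA}^q$ (applicant-proposing deferred acceptance) maps each profile of types to the stable matching that every applicant weakly prefers to every other stable matching. **OSP.** A *mechanism* is a finite rooted tree whose leaves are labelled by outcomes. At every other node $h$ one agent $i$ acts, and the set $\mathcal T_i(h)$ of types of $i$ that are consistent with $i$'s earlier actions is partitioned among the successors of $h$; at the root $\mathcal T_i$ consists of all types. The mechanism *implements* $f$ if, for every type profile, truthful play ends at a leaf labelled by the value of $f$. It is *OSP* if at each node $h$ with acting agent $i$, for each $t\in\mathcal T_i(h)$, if $h'$ is the successor of $h$ with $t\in\mathcal T_i(h')$, then agent $i$ with type $t$ weakly prefers every leaf $\ell$ below $h$ with $t\in\mathcal T_i(\ell)$ to every leaf that is below $h$ but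 not below $h'$. A social choice function is *OSP implementable* if some OSP mechanism implements it. **Limited cyclic.** Priorities of $\ell\ge 3$ positions over $k\ge 3$ applicants are *two-adjacent-alternating* if the applicants can be labelled $a_1,\dots,a_k$ such that there are two distinct positions $u,v$ with priority lists $$u:\ a_1\succ a_3\succ a_2\succ a_5\succ a_4\succ\cdots,\qquad v:\ a_2\succ a_1\succ a_4\succ a_3\succ a_6\succ a_5\succ\cdots$$ (adjacent pairs are swapped starting from $a_2,a_3$ for $u$ and from $a_1,a_2$ for $v$; an unpaired last applicant stays last), while every other position has the list $a_1\succ a_2\succ\cdots\succ a_k$. Priorities $q$ are *limited cyclic* if there is an ordered partition $S_1,\dots,S_L$ of the applicants such that every position ranks all of $S_i$ above all of $S_j$ whenever $i<j$, and for every $i$ with $|S_i|\ge3$ the restriction of $q$ to $S_i$ is two-adjacent-alternating. **The mechanisms 2Tr and 3Lu.** Below, "clinching" $p$ means being permanently matched to $p$. When an applicant is *asked over* a set $R$, they take the action belonging to their favorite position in $R$: clinching it or, where indicated, passing. An applicant passes exactly when that favorite lies in the indicated set. * $\mathtt{2Tr}^{U;V}_{a,b}$ is used when $a,b$ are the top two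 among the unmatched applicants at every unmatched position; $U$ (resp. $V$) is the set of unmatched positions that rank $a$ (resp. $b$) first. $a$ is asked over $U\cup V$: clinch in $U$, or pass if the favorite is in $V$. If $a$ clinches $w$, then $b$ clinches their favorite in $(U\cup V)\setminus\{w\}$. If $a$ passes, $b$ clinches their favorite $z$ in $U\cup V$ and then $a$ clinches their favorite in $(U\cup V)\setminus\{z\}$. As a degenerate case of $\mathtt{2Tr}$, a single applicant who is ranked first among the unmatched applicants by all unmatched positions clinches their favorite unmatched position. * $\mathtt{3Lu}^{X,u,v}$ is used when some $k\ge3$ unmatched applicants $a_1,\dots,a_k$ are ranked above all other unmatched applicants by all unmatched positions, and the priorities of the unmatched positions over them are two-adjacent-alternating with labels as above; $X\ne\emptyset$ is the set of unmatched positions other than $u,v$. 1. $a_1$ is asked over $X\cup\{u,v\}$: clinch in $X\cup\{u\}$ (then stop), or pass if the favorite is $v$. 2. If $a_1$ passed, $a_2$ is asked over $X\cup\{u,v\}$: clinch in $X\cup\{v\}$, or pass if the favorite is $u$. If $a_2$ clinches in $X$, then $a_1$ is matched to $v$ (stop). If $a_2$ clinches $v$, then $a_1$ clinches their favorite in $X\cup\{u\}$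 (stop). 3. If $a_2$ passed, $a_3$ is asked over $X\cup\{u\}$: clinch in $X$, or pass if the favorite is $u$. If $a_3$ clinches, then $a_1$ is matched to $v$ and $a_2$ to $u$ (stop). 4. If $a_3$ passed, $a_2$ clinches their favorite in $X\cup\{v\}$. If it is in $X$, then $a_1$ is matched to $v$ and $a_3$ to $u$ (stop). If it is $v$, then $a_1$ clinches their favorite in $X\cup\{u\}$; if that is $u$, then $a_3$ clinches their favorite in $X$, and otherwise $a_3$ is matched to $u$ (stop). A mechanism is a *composition of $\mathtt{2Tr}$ and $\mathtt{3Lu}$* if it starts with no applicant matched, repeatedly runs one of these on the currently unmatched applicants and positions (when its condition of use holds; the choice may depend on the matches determined so far), and ends when all applicants are matched, with that matching as the outcome. **Theorem.** For every set of priorities $q$ of $n$ positions over $n$ applicants, the following are equivalent: 1. $\mathtt{DA}^q$ is OSP implementable. 2. $q$ is limited cyclic. 3. Some composition of $\mathtt{2Tr}$ and $\mathtt{3Lu}$ is an OSP mechanism that implements $\mathtt{DA}^q$. 4. No restriction of $q$ to $m$ applicants and $m$ positions is equal, up to relabeling of applicants and of positions, to one of the following seven priority sets (each word is the priority list of one position,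 from the top down): * $m=3$: $\{abc,bca,cab\}$; $\{abc,abc,cab\}$; $\{abc,abc,cba\}$; $\{abc,abc,bca\}$; $\{abc,acb,cba\}$; $\{abc,bac,cba\}$; * $m=4$: $\{abcd,abdc,acbd,bacd\}$. -/

import Mathlib

universe u

/-! ### Mechanisms and obvious strategyproofness -/

/-- An ordinal environment with agents `N`: a set of outcomes, a set of types for each agent, and
for each type a weak order on outcomes.  `pref i t y z` means that agent `i` of type `t` weakly
prefers `y` to `z`. -/
structure OrdinalEnv (N : Type u) where
  Outcome : Type u
  Ty : N → Type u
  pref : ∀ i, Ty i → Outcome → Outcome → Prop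
  pref_refl : ∀ i t y, pref i t y y
  pref_trans : ∀ i t x y z, pref i t x y → pref i t y z → pref i t x z
  pref_total : ∀ i t x y, pref i t x y ∨ pref i t y x

/-- Finite rooted game trees, with leaves labelled by elements of `Y`.  At a node the agent `i`
acts and is asked a question `ask` about their type; the successors of the node are indexed by the
possible answers.  If `𝒯` is the type-set of agent `i` at the node, then the type-set of `i` at the
successor `c` is `𝒯 ∩ ask ⁻¹' {c}` (see `GameTree.succSets`), so the type-sets of `i` at the
successors partition `𝒯` (cells may be empty); the type-sets of all other agents are unchanged. -/
inductive GameTree (N : Type u) (T : N → Type u) (Y : Type u) : Type (u + 1)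
  | leaf (y : Y) : GameTree N T Y
  | node (i : N) (ι : Type u) [Finite ι] (ask : T i → ι) (next : ι → GameTree N T Y) :
      GameTree N T Y

namespace GameTree

variable {N : Type u} {T : N → Type u} {Y Y' : Type u}

/-- The outcome reached when agents of types `t` answer every question truthfully, that is, the
label of the leaf whose type-sets contain `t`. -/
def play : GameTree N T Y → (∀ i, T i) → Y
  | leaf y, _ => y
  | node i _ ask next, t => play (next (ask (t i))) t

/-- The set of labels of all the leaves of a tree. -/
def outcomes : GameTree N T Y → Set Y
  | leaf y => {y}
  | node _ _ _ next => {y | ∃ c, y ∈ outcomes (next c)}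

/-- The type-sets at the successor `c` of a node at which agent `i` acts and the type-sets
are `S`. -/
def succSets (S : ∀ i, Set (T i)) (i : N) {ι : Type u} (ask : T i → ι) (c : ι) :
    ∀ i, Set (T i) :=
  open Classical in Function.update S i (S i ∩ ask ⁻¹' {c})

/-- `HasLeaf G S L y`: if the type-sets at the root of `G` are `S`, then `G` has a leaf with
type-sets `L` and label `y`. -/
inductive HasLeaf : GameTree N T Y → (∀ i, Set (T i)) → (∀ i, Set (T i)) → Y → Prop
  | leaf (y : Y) (S : ∀ i, Set (T i)) : HasLeaf (.leaf y) S S y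
  | node (i : N) (ι : Type u) [Finite ι] (ask : T i → ι) (next : ι → GameTree N T Y)
      (S L : ∀ i, Set (T i)) (y : Y) (c : ι) (h : HasLeaf (next c) (succSets S i ask c) L y) :
      HasLeaf (.node i ι ask next) S L y

/-- Composition of game trees: each leaf `y` of the first tree is replaced by the tree `cont y`. -/
def bind : GameTree N T Y → (Y → GameTree N T Y') → GameTree N T Y'
  | leaf y, cont => cont y
  | @node _ _ _ i ι _ ask next, cont => .node i ι ask fun c => bind (next c) cont

end GameTree

/-- The (sub)mechanism `G`, the type-sets at whose root are `S`, is OSP at each of its nodes: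
whenever agent `i` acts at a node `h` and `t` lies in the type-set of `i` at `h`, every leaf below
`h` whose type-set for `i` contains `t` is weakly preferred by `t` to every leaf below `h` that is
not below the successor of `h` chosen by `t`. -/
def IsOSPFrom {N : Type u} (E : OrdinalEnv N) :
    GameTree N E.Ty E.Outcome → (∀ i, Set (E.Ty i)) → Prop
  | .leaf _, _ => True
  | @GameTree.node _ _ _ i ι _ ask next, S =>
      (∀ t ∈ S i, ∀ L y, GameTree.HasLeaf (.node i ι ask next) S L y → t ∈ L i →
        ∀ c, c ≠ ask t → ∀ y' ∈ (next c).outcomes, E.pref i t y y') ∧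
      ∀ c, IsOSPFrom E (next c) (GameTree.succSets S i ask c)

/-- A mechanism is OSP: the type-set of every agent at the root is the set of all their types. -/
def IsOSP {N : Type u} (E : OrdinalEnv N) (G : GameTree N E.Ty E.Outcome) : Prop :=
  IsOSPFrom E G fun _ => Set.univ

/-- The mechanism `G` implements the social choice function `f`. -/
def Implements {N : Type u} {E : OrdinalEnv N} (G : GameTree N E.Ty E.Outcome)
    (f : (∀ i, E.Ty i) → E.Outcome) : Prop :=
  ∀ t, G.play t = f t

/-- The social choice function `f` is OSP implementable. -/
def OSPImplementable {N : Type u} (E : OrdinalEnv N) (f : (∀ i, E.Ty i) → E.Outcome) : Prop :=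
  ∃ G : GameTree N E.Ty E.Outcome, IsOSP E G ∧ Implements G f

/-! ### Matching -/

/-- Strict total orders; `r.rel x y` means that `x` is ranked above `y`.  Preferences of
applicants are rankings of positions, priorities of positions are rankings of applicants. -/
structure Ranking (α : Type u) where
  rel : α → α → Prop
  irrefl : ∀ x, ¬ rel x x
  trans : ∀ x y z, rel x y → rel y z → rel x z
  total : ∀ x y, x ≠ y → rel x y ∨ rel y x

theorem Ranking.exists_top {α : Type u} [Finite α] (r : Ranking α) (R : Set α)
    (hR : R.Nonempty) : ∃ x ∈ R, ∀ y ∈ R, y ≠ x → r.rel x y := by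
  have : IsTrans α r.rel := ⟨r.trans⟩
  have : Std.Irrefl r.rel := ⟨r.irrefl⟩
  have hwf : WellFounded r.rel := Finite.wellFounded_of_trans_of_irrefl r.rel
  refine ⟨hwf.min R hR, hwf.min_mem R hR, fun y hy hne => ?_⟩
  rcases r.total _ _ hne with h | h
  · exact absurd h (hwf.not_lt_min R hy)
  · exact h

/-- The one-sided matching environment: outcomes are the bijections from applicants to positions,
types of an applicant are the strict rankings of positions, and each applicant only cares about
their own match. -/
def matchingEnv (A P : Type u) : OrdinalEnv A where
  Outcome := A ≃ P
  Ty _ := Ranking P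
  pref a t μ ν := μ a = ν a ∨ t.rel (μ a) (ν a)
  pref_refl _ _ _ := Or.inl rfl
  pref_trans a t x y z := by
    rintro (h | h) (h' | h')
    · exact Or.inl (h.trans h')
    · exact Or.inr (h ▸ h')
    · exact Or.inr (h' ▸ h)
    · exact Or.inr (t.trans _ _ _ h h')
  pref_total a t x y := by
    by_cases h : x a = y a
    · exact Or.inl (Or.inl h)
    · exact (t.total _ _ h).imp Or.inr Or.inr

/-- Stability of the matching `μ` for priorities `q` and preferences `t`. -/
def IsStable {A P : Type u} (q : P → Ranking A) (t : A → Ranking P) (μ : A ≃ P) : Prop :=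
  ∀ a p, μ a ≠ p → (t a).rel (μ a) p ∨ (q p).rel (μ.symm p) a

/-- `μ` is the applicant-optimal stable matching. -/
def IsApplicantOptimal {A P : Type u} (q : P → Ranking A) (t : A → Ranking P) (μ : A ≃ P) : Prop :=
  IsStable q t μ ∧ ∀ ν, IsStable q t ν → ∀ a, μ a = ν a ∨ (t a).rel (μ a) (ν a)

/-- The Gale–Shapley theorem: an applicant-optimal stable matching exists. -/
theorem exists_isApplicantOptimal {A P : Type u} [Fintype A] [Fintype P]
    (hcard : Fintype.card A = Fintype.card P) (q : P → Ranking A) (t : A → Ranking P) :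
    ∃ μ, IsApplicantOptimal q t μ := by
  classical
  -- `R` collects rejections; take a maximal set of justified rejections
  let Inv : Set (A × P) → Prop := fun R =>
    (∀ ν, IsStable q t ν → ∀ a, (a, ν a) ∉ R) ∧
    ∀ a p, (a, p) ∈ R → ∃ b, (q p).rel b a ∧ ∀ p', (t b).rel p' p → (b, p') ∈ R
  obtain ⟨R, hR⟩ := (Set.toFinite {R | Inv R}).exists_maximal ⟨∅, by simp [Inv]⟩
  have hInv : Inv R := hR.prop
  obtain ⟨h1, h2⟩ := hInv
  let Prp : P → Set A := fun p => {b | ∀ p', (t b).rel p' p → (b, p') ∈ R}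
  have hold : ∀ a p, (a, p) ∈ R → ∃ b, b ∈ Prp p ∧ (b, p) ∉ R ∧ (q p).rel b a := by
    intro a p hap
    obtain ⟨b, hba, hb⟩ := h2 a p hap
    obtain ⟨c, hc, hctop⟩ := (q p).exists_top (Prp p) ⟨b, hb⟩
    refine ⟨c, hc, fun hcR => ?_, ?_⟩
    · obtain ⟨d, hdc, hd⟩ := h2 c p hcR
      have hne : d ≠ c := by rintro rfl; exact (q p).irrefl _ hdc
      exact (q p).irrefl _ ((q p).trans _ _ _ hdc (hctop d hd hne))
    · by_cases hbc : b = c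
      · exact hbc ▸ hba
      · exact (q p).trans _ _ _ (hctop b hb hbc) hba
  -- two unrejected proposals by one applicant are at the same position
  have huniq : ∀ b p p', b ∈ Prp p → (b, p) ∉ R → b ∈ Prp p' → (b, p') ∉ R → p = p' := by
    intro b p p' hb hbR hb' hbR'
    by_contra hne
    rcases (t b).total p p' hne with h | h
    · exact hbR (hb' _ h)
    · exact hbR' (hb _ h)
  have hex : ∀ a, {p | (a, p) ∉ R}.Nonempty := by
    intro a
    by_contra hno
    have hall : ∀ p, (a, p) ∈ R := by
      intro p
      by_contra h
      exact hno ⟨p, h⟩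
    choose f hf hfR _ using fun p => hold a p (hall p)
    have hinj : Function.Injective f := by
      intro p p' h
      exact huniq (f p) p p' (hf p) (hfR p) (h ▸ hf p') (h ▸ hfR p')
    obtain ⟨p, hp⟩ := ((Fintype.bijective_iff_injective_and_card f).2 ⟨hinj, hcard.symm⟩).2 a
    exact hfR p (hp ▸ hall p)
  choose m hmR hmtop using fun a => (t a).exists_top _ (hex a)
  have hmP : ∀ a, a ∈ Prp (m a) := by
    intro a p' hp'
    by_contra h
    have hne : p' ≠ m a := by rintro e; exact (t a).irrefl _ (e ▸ hp')
    exact (t a).irrefl _ ((t a).trans _ _ _ hp' (hmtop a p' h hne))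
  have key : ∀ a b, (q (m a)).rel b a → m a ≠ m b := by
    intro a b hba heq
    have hnew : Inv (insert (a, m a) R) := by
      refine ⟨fun ν hν c hc => ?_, fun c p hcp => ?_⟩
      · rcases hc with hc | hc
        · obtain ⟨rfl, hνm⟩ := Prod.mk.inj hc
          have hab : b ≠ c := by rintro rfl; exact (q _).irrefl _ hba
          have hνb : ν b ≠ m c := by
            intro h
            exact hab (ν.injective (h.trans hνm.symm))
          rcases hν b (m c) hνb with h | h
          · exact h1 ν hν b (hmP b _ (heq ▸ h))
          · rw [← hνm, Equiv.symm_apply_apply, hνm] at h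
            exact (q _).irrefl _ ((q _).trans _ _ _ h hba)
        · exact h1 ν hν c hc
      · rcases hcp with hcp | hcp
        · obtain ⟨rfl, rfl⟩ := Prod.mk.inj hcp
          exact ⟨b, hba, fun p' hp' => Or.inr (hmP b p' (heq ▸ hp'))⟩
        · obtain ⟨d, hd, hd'⟩ := h2 c p hcp
          exact ⟨d, hd, fun p' hp' => Or.inr (hd' p' hp')⟩
    exact hmR a (hR.le_of_ge hnew (Set.subset_insert _ _) (Set.mem_insert _ _))
  have hinj : Function.Injective m := by
    intro a b heq
    by_contra hne
    rcases (q (m a)).total a b hne with h | h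
    · exact key b a (heq ▸ h) heq.symm
    · exact key a b h heq
  let μ : A ≃ P := Equiv.ofBijective m
    ((Fintype.bijective_iff_injective_and_card m).2 ⟨hinj, hcard⟩)
  have hμ : ∀ a, μ a = m a := fun _ => rfl
  refine ⟨μ, fun a p hne => ?_, fun ν hν a => ?_⟩
  · rcases (t a).total _ _ hne with h | h
    · exact Or.inl h
    · right
      obtain ⟨b, hb, hbR, hba⟩ := hold a p (hmP a p h)
      have : m b = p := huniq b _ _ (hmP b) (hmR b) hb hbR
      have hs : μ.symm p = b := by rw [Equiv.symm_apply_eq]; exact this.symm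
      rw [hs]
      exact hba
  · by_cases h : m a = ν a
    · exact Or.inl h
    · exact Or.inr (hmtop a _ (h1 ν hν a) (Ne.symm h))

/-- Applicant-proposing deferred acceptance with priorities `q`, as a social choice function: it
selects the applicant-optimal stable matching. -/
noncomputable def DA {A P : Type u} [Fintype A] [Fintype P]
    (hcard : Fintype.card A = Fintype.card P) (q : P → Ranking A) :
    (∀ a, (matchingEnv A P).Ty a) → (matchingEnv A P).Outcome :=
  fun t => Classical.choose (exists_isApplicantOptimal hcard q t)

/-! ### Limited cyclic priorities -/

/-- The order on indices `0, 1, 2, …` obtained from the usual one by swapping the adjacent indices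
`i` and `i + 1` for each `i` satisfying `s`; only used when `s` never holds at two consecutive
indices. -/
def FlipLt (s : ℕ → Prop) (i j : ℕ) : Prop :=
  (i < j ∧ ¬ (s i ∧ j = i + 1)) ∨ (s j ∧ i = j + 1)

/-- With `l` listing applicants (from index `0`), the priorities of the positions `R`, restricted
to the listed applicants, are
`u : l 0, (l 2, l 1), (l 4, l 3), …`, `v : (l 1, l 0), (l 3, l 2), …`, and
`x : l 0, l 1, l 2, l 3, …` for all other positions `x`. -/
def AlternatingWith {A P : Type u} (q : P → Ranking A) (R : Set P) {k : ℕ} (l : Fin k → A)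
    (u v : P) : Prop :=
  u ∈ R ∧ v ∈ R ∧ u ≠ v ∧
  (∀ i j : Fin k, (q u).rel (l i) (l j) ↔ FlipLt (fun m => Odd m) i j) ∧
  (∀ i j : Fin k, (q v).rel (l i) (l j) ↔ FlipLt (fun m => Even m) i j) ∧
  ∀ x ∈ R, x ≠ u → x ≠ v → ∀ i j : Fin k, (q x).rel (l i) (l j) ↔ i < j

/-- The restriction of `q` to the applicants `S` and the positions `R` is
two-adjacent-alternating. -/
def TwoAdjacentAlternating {A P : Type u} (q : P → Ranking A) (S : Set A) (R : Set P) : Prop :=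
  3 ≤ R.ncard ∧ ∃ k : ℕ, 3 ≤ k ∧ ∃ l : Fin k → A, Function.Injective l ∧ Set.range l = S ∧
    ∃ u v, AlternatingWith q R l u v

/-- `q` is limited cyclic; `s` assigns to each applicant the index of their block of the ordered
partition. -/
def LimitedCyclic {A P : Type u} (q : P → Ranking A) : Prop :=
  ∃ (L : ℕ) (s : A → Fin L), Function.Surjective s ∧
    (∀ a b, s a < s b → ∀ x, (q x).rel a b) ∧
    ∀ i, 3 ≤ {a | s a = i}.ncard → TwoAdjacentAlternating q {a | s a = i} Set.univ

/-! ### The mechanisms 2Tr and 3Lu, and their compositions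

A submechanism ends with a list of applicant-position pairs, the matches that it has determined. -/

/-- Game trees for applicants whose types are rankings of positions, with a list of matches at
each leaf. -/
abbrev SubMech (A P : Type u) : Type (u + 1) := GameTree A (fun _ => Ranking P) (List (A × P))

/-- The favorite position of `t` in the nonempty set `R`. -/
noncomputable def Ranking.fav {P : Type u} [Finite P] (t : Ranking P) (R : Set P)
    (hR : R.Nonempty) : P :=
  Classical.choose (t.exists_top R hR)

theorem Ranking.fav_mem {P : Type u} [Finite P] (t : Ranking P) (R : Set P)
    (hR : R.Nonempty) : t.fav R hR ∈ R :=
  (Classical.choose_spec (t.exists_top R hR)).1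

open Classical in
/-- Applicant `a` is asked for their favorite position in `R`, with one action for each element
of `R` (not used for empty `R`). -/
noncomputable def clinch {A P : Type u} [Finite P] (a : A) (R : Set P)
    (next : P → SubMech A P) : SubMech A P :=
  if h : R.Nonempty then
    .node a R (fun t => ⟨t.fav R h, t.fav_mem R h⟩) (fun p => next p)
  else .leaf []

open Classical in
/-- Applicant `a` takes the action "clinch `p`" if `p ∈ C` is their favorite position in `C ∪ D`,
and passes if their favorite position in `C ∪ D` is not in `C` (not used for empty `C ∪ D`). -/
noncomputable def clinchOrPass {A P : Type u} [Finite P] (a : A) (C D : Set P)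
    (next : P → SubMech A P) (pass : SubMech A P) : SubMech A P :=
  if h : (C ∪ D).Nonempty then
    .node a (Option C)
      (fun t => if hc : t.fav (C ∪ D) h ∈ C then some ⟨t.fav (C ∪ D) h, hc⟩ else none)
      (fun c => match c with
        | some p => next p
        | none => pass)
  else .leaf []

/-- The degenerate case of `twoTr` with a single applicant, who clinches any position in `R`. -/
noncomputable def oneTr {A P : Type u} [Finite P] (R : Set P) (a : A) : SubMech A P :=
  clinch a R fun p => .leaf [(a, p)]

/-- The mechanism 2Tr for applicants `a, b` and sets of positions `U, V`. -/
noncomputable def twoTr {A P : Type u} [Finite P] (U V : Set P) (a b : A) : SubMech A P :=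
  clinchOrPass a U V
    (fun w => clinch b ((U ∪ V) \ {w}) fun z => .leaf [(a, w), (b, z)])
    (clinch b (U ∪ V) fun z => clinch a ((U ∪ V) \ {z}) fun w => .leaf [(a, w), (b, z)])

open Classical in
/-- The mechanism 3Lu for applicants `a₁, a₂, a₃`, a set of positions `X` and positions `u, v`,
up to the points where it hands over to another mechanism for the applicants that are not yet
matched. -/
noncomputable def threeLu {A P : Type u} [Finite P] (X : Set P) (u v : P) (a₁ a₂ a₃ : A) :
    SubMech A P :=
  clinchOrPass a₁ (X ∪ {u}) {v} (fun p => .leaf [(a₁, p)]) <|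
  clinchOrPass a₂ (X ∪ {v}) {u}
    (fun p =>
      if p = v then clinch a₁ (X ∪ {u}) fun w => .leaf [(a₁, w), (a₂, v)]
      else .leaf [(a₁, v), (a₂, p)]) <|
  clinchOrPass a₃ X {u} (fun p => .leaf [(a₁, v), (a₂, u), (a₃, p)]) <|
  clinch a₂ (X ∪ {v}) fun p =>
    if p = v then
      clinch a₁ (X ∪ {u}) fun w =>
        if w = u then clinch a₃ X fun z => .leaf [(a₁, u), (a₂, v), (a₃, z)]
        else .leaf [(a₁, w), (a₂, v), (a₃, u)]
    else .leaf [(a₁, v), (a₂, p), (a₃, u)]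

/-- The applicants that are unmatched in the list `M` of matches. -/
def freeApplicants {A P : Type u} (M : List (A × P)) : Set A := {a | ∀ p, (a, p) ∉ M}

/-- The positions that are unmatched in the list `M` of matches. -/
def freePositions {A P : Type u} (M : List (A × P)) : Set P := {p | ∀ a, (a, p) ∉ M}

/-- `IsComposed q M G`: after the matches `M` have been determined, `G` matches the remaining
applicants and positions by a composition of 2Tr (or its one-applicant case) and 3Lu.  At each
stage one of them is run on all free positions and on a group of free applicants whose priorities
have the form for which that mechanism is made; its remainder may depend on the matches reached. -/
inductive IsComposed {A P : Type u} [Finite P] (q : P → Ranking A) :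
    List (A × P) → GameTree A (matchingEnv A P).Ty (matchingEnv A P).Outcome → Prop
  | done (M : List (A × P)) (μ : A ≃ P) (h : ∀ a p, (a, p) ∈ M ↔ μ a = p) :
      IsComposed q M (.leaf μ)
  | one (M : List (A × P)) (a : A) (ha : a ∈ freeApplicants M)
      (htop : ∀ p ∈ freePositions M, ∀ c ∈ freeApplicants M, c ≠ a → (q p).rel a c)
      (cont : List (A × P) → GameTree A (matchingEnv A P).Ty (matchingEnv A P).Outcome)
      (hcont : ∀ M' ∈ (oneTr (freePositions M) a).outcomes, IsComposed q (M' ++ M) (cont M')) :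
      IsComposed q M ((oneTr (freePositions M) a).bind cont)
  | two (M : List (A × P)) (a b : A) (ha : a ∈ freeApplicants M) (hb : b ∈ freeApplicants M)
      (hab : a ≠ b)
      (htop : ∀ p ∈ freePositions M, ∀ c ∈ freeApplicants M, c ≠ a → c ≠ b →
        (q p).rel a c ∧ (q p).rel b c)
      (U V : Set P) (hU : U = {p | p ∈ freePositions M ∧ (q p).rel a b})
      (hV : V = {p | p ∈ freePositions M ∧ (q p).rel b a})
      (cont : List (A × P) → GameTree A (matchingEnv A P).Ty (matchingEnv A P).Outcome)
      (hcont : ∀ M' ∈ (twoTr U V a b).outcomes, IsComposed q (M' ++ M) (cont M')) :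
      IsComposed q M ((twoTr U V a b).bind cont)
  | three (M : List (A × P)) (k : ℕ) (hk : 3 ≤ k) (l : Fin k → A) (hl : Function.Injective l)
      (hfree : ∀ i, l i ∈ freeApplicants M)
      (htop : ∀ p ∈ freePositions M, ∀ c ∈ freeApplicants M, c ∉ Set.range l →
        ∀ i, (q p).rel (l i) c)
      (X : Set P) (u v : P) (halt : AlternatingWith q (freePositions M) l u v)
      (hX : X = freePositions M \ {u, v}) (hXne : X.Nonempty)
      (cont : List (A × P) → GameTree A (matchingEnv A P).Ty (matchingEnv A P).Outcome)
      (hcont : ∀ M' ∈ (threeLu X u v (l ⟨0, by omega⟩) (l ⟨1, by omega⟩) (l ⟨2, by omega⟩)).outcomes,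
        IsComposed q (M' ++ M) (cont M')) :
      IsComposed q M
        ((threeLu X u v (l ⟨0, by omega⟩) (l ⟨1, by omega⟩) (l ⟨2, by omega⟩)).bind cont)

/-! ### Forbidden restrictions -/

/-- Some restriction of `q` to `m` applicants and `m` positions equals, up to relabeling, the
priority set `t` of `m` positions over `m` applicants; `t i r` is the applicant that position `i`
ranks in place `r`, counting from the top. -/
def HasRestriction {A P : Type u} (q : P → Ranking A) {m : ℕ} (t : Fin m → Fin m → Fin m) : Prop :=
  ∃ (S : Set A) (R : Set P) (e : Fin m ≃ S) (f : Fin m ≃ R),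
    ∀ i r s, r < s → (q (f i)).rel (e (t i r)) (e (t i s))

/-- The six forbidden priority sets of three positions over three applicants. -/
def forbiddenThree : List (Fin 3 → Fin 3 → Fin 3) :=
  [![![0, 1, 2], ![1, 2, 0], ![2, 0, 1]],
   ![![0, 1, 2], ![0, 1, 2], ![2, 0, 1]],
   ![![0, 1, 2], ![0, 1, 2], ![2, 1, 0]],
   ![![0, 1, 2], ![0, 1, 2], ![1, 2, 0]],
   ![![0, 1, 2], ![0, 2, 1], ![2, 1, 0]],
   ![![0, 1, 2], ![1, 0, 2], ![2, 1, 0]]]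

/-- The forbidden priority set of four positions over four applicants. -/
def forbiddenFour : Fin 4 → Fin 4 → Fin 4 :=
  ![![0, 1, 2, 3], ![0, 1, 3, 2], ![0, 2, 1, 3], ![1, 0, 2, 3]]

/-! ### Domains on which an OSP mechanism is constant -/

namespace GameTree

variable {N : Type u} {T : N → Type u} {Y : Type u}

/-! The cycle of implications is 1 → 4 → 2 → 3 → 1, the last step being immediate.

From OSP to the absence of forbidden patterns: fix a few types per applicant such that, whenever a
question splits the types of one applicant, two profiles of this small domain show that the truthful
outcome of one can be worse than the outcome of deviating to the other. Then no question that splits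
the domain can be asked, so the mechanism is constant on it (`IsOSPFrom.play_eq_of_inseparable`),
while `DA` is not. A pattern inside a large market is isolated by giving every outside applicant a
private favorite position outside the pattern (`IsApplicantOptimal.apply_eq_of_optimalInWords`), so
each of the seven patterns reduces to a finite certificate.

From the absence of patterns to limited cyclic priorities: join two applicants by an edge if
positions disagree about them. With at least three positions, the three-applicant patterns force two
edges `ab`, `bc` with a common end to look like one dissenting position for `ab` and another one for
`bc`, with `b` in the middle of the common order (`Conflict.soleDissenters`). Hence degrees are at
most two, and edges at a common applicant have different dissenters. The four-applicant pattern says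
that on a path of three edges the outer two have the same dissenter (`SoleDissenter.eq_of_path`). A
component of size at least three is therefore a path along which two dissenters alternate
(`twoAdjacentAlternating_component`), and different components are ordered unanimously.

From limited cyclic priorities to a mechanism: consider the first block that still has free
applicants, and its first free label. Either the labels from there on form a situation for 3Lu, or
the first two free applicants can play 2Tr, or one applicant is on top everywhere
(`LimitedCyclic.hasStage`). Each stage is obviously truthful because a passing applicant always
obtains something at least as good as everything they could have clinched. Each stage agrees with
the applicant-optimal stable matching: any other assignment either contradicts stability or admits
an improving exchange of two or three matches that creates no new envy
(`IsApplicantOptimal.eq_of_improvement`). After a stage no matched applicant wants a free position,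
so the argument repeats on the rest (`IsComposed.play_eq`). -/

theorem mem_succSets {S : ∀ i, Set (T i)} {i : N} {ι : Type u} {ask : T i → ι} {c : ι}
    {τ : ∀ i, T i} (hτ : ∀ k, τ k ∈ S k) (hc : ask (τ i) = c) (k : N) :
    τ k ∈ succSets S i ask c k := by
  classical
  unfold succSets
  by_cases hk : k = i
  · subst hk
    simp [hτ k, hc]
  · simpa [Function.update_of_ne hk] using hτ k

theorem exists_hasLeaf_play (G : GameTree N T Y) (S : ∀ i, Set (T i)) (τ : ∀ i, T i)
    (hτ : ∀ k, τ k ∈ S k) : ∃ L, HasLeaf G S L (G.play τ) ∧ ∀ k, τ k ∈ L k := by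
  induction G generalizing S with
  | leaf y => exact ⟨S, .leaf y S, hτ⟩
  | node i ι ask next ih =>
    obtain ⟨L, hL, hτL⟩ := ih (ask (τ i)) (succSets S i ask (ask (τ i))) (mem_succSets hτ rfl)
    exact ⟨L, .node i ι ask next S L _ _ hL, hτL⟩

theorem play_mem_outcomes (G : GameTree N T Y) (τ : ∀ i, T i) : G.play τ ∈ G.outcomes := by
  induction G with
  | leaf y => rfl
  | node i ι ask next ih => exact ⟨_, ih (ask (τ i))⟩

end GameTree

/-- If no agent can be separated within a product domain `D` without violating OSP, then an OSP
mechanism is constant on `D`. -/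
theorem IsOSPFrom.play_eq_of_inseparable {N : Type u} {E : OrdinalEnv N}
    {f : (∀ i, E.Ty i) → E.Outcome} {D : ∀ i, Set (E.Ty i)}
    (hD : ∀ i, ∀ (ι : Type u) (ask : E.Ty i → ι), (∃ t ∈ D i, ∃ t' ∈ D i, ask t ≠ ask t') →
      ∃ τ τ' : ∀ k, E.Ty k, (∀ k, τ k ∈ D k) ∧ (∀ k, τ' k ∈ D k) ∧ ask (τ i) ≠ ask (τ' i) ∧
        ¬ E.pref i (τ i) (f τ) (f τ'))
    {G : GameTree N E.Ty E.Outcome} {S : ∀ i, Set (E.Ty i)} (hG : IsOSPFrom E G S)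
    (hS : ∀ i, D i ⊆ S i) (hf : ∀ τ, (∀ k, τ k ∈ D k) → G.play τ = f τ)
    {τ τ' : ∀ k, E.Ty k} (hτ : ∀ k, τ k ∈ D k) (hτ' : ∀ k, τ' k ∈ D k) : f τ = f τ' := by
  classical
  induction G generalizing S with
  | leaf y => exact (hf τ hτ).symm.trans (hf τ' hτ')
  | node i ι ask next ih =>
    by_cases hask : ∃ t ∈ D i, ∃ t' ∈ D i, ask t ≠ ask t'
    -- The question splits `D i`: truthful play of `σ` ends at a leaf that its acting type likes
    -- less than the leaf reached by `σ'` after the other answer, which OSP forbids.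
    · obtain ⟨σ, σ', hσ, hσ', hne, hpref⟩ := hD i ι ask hask
      obtain ⟨L, hL, hσL⟩ := GameTree.exists_hasLeaf_play (.node i ι ask next) S σ
        fun k => hS k (hσ k)
      refine absurd (hG.1 (σ i) (hS i (hσ i)) L _ hL (hσL i) (ask (σ' i)) (Ne.symm hne) _
        (GameTree.play_mem_outcomes (next (ask (σ' i))) σ')) ?_
      have h := hf σ' hσ'
      rw [GameTree.play] at h
      rwa [hf σ hσ, h]
    · push Not at hask
      -- All types in `D i` give the same answer, so the whole domain survives into a single
      -- successor. That `t` survives in coordinate `k` is read off from the profile `τ` with that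
      -- coordinate replaced by `t`.
      refine ih (ask (τ i)) (hG.2 _) (fun k t ht => ?_) fun σ hσ => ?_
      · have := GameTree.mem_succSets (ask := ask) (τ := Function.update τ k t)
          (S := S) (c := ask (τ i)) (i := i) (fun j => ?_) (hask _ ?_ _ (hτ i)) k
        · simpa using this
        · by_cases hj : j = k
          · subst hj; simpa using hS j ht
          · simpa [Function.update_of_ne hj] using hS j (hτ j)
        · by_cases hj : i = k
          · subst hj; simpa using ht
          · simpa [Function.update_of_ne hj] using hτ i
      · have h := hf σ hσ
        rw [GameTree.play, hask _ (hσ i) _ (hτ i)] at h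
        exact h

/-! ### Small markets inside large ones -/

/-- The ranking of `α` by increasing value of an injective key. -/
def Ranking.ofKey {α : Type u} (k : α → ℕ) (hk : Function.Injective k) : Ranking α where
  rel x y := k x < k y
  irrefl _ := lt_irrefl _
  trans _ _ _ := lt_trans
  total _ _ h := lt_or_gt_of_ne fun e => h (hk e)

theorem Ranking.asymm {α : Type u} (r : Ranking α) {x y : α} (h : r.rel x y) : ¬ r.rel y x :=
  fun h' => r.irrefl _ (r.trans _ _ _ h h')

theorem Ranking.ne {α : Type u} (r : Ranking α) {x y : α} (h : r.rel x y) : x ≠ y := by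
  rintro rfl; exact r.irrefl _ h

theorem Ranking.not_rel {α : Type u} (r : Ranking α) {x y : α} (hne : x ≠ y) :
    ¬ r.rel x y ↔ r.rel y x :=
  ⟨fun h => (r.total x y hne).resolve_left h, fun h => r.asymm h⟩

/-- Stability in the market with priority words `t` (as in `HasRestriction`) in which applicant `a`
has preference ranks `c a`. -/
def StableInWords {m : ℕ} (t c : Fin m → Fin m → Fin m) (μ : Fin m → Fin m) : Prop :=
  ∀ a p, μ a = p ∨ c a (μ a) < c a p ∨
    ∃ b, μ b = p ∧ ∃ r s, r < s ∧ t p r = b ∧ t p s = a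

/-- Applicant-optimal stability in the market with priority words `t` in which applicant `a` has
preference ranks `c a`. -/
def OptimalInWords {m : ℕ} (t c : Fin m → Fin m → Fin m) (μ : Fin m → Fin m) : Prop :=
  Function.Injective μ ∧ StableInWords t c μ ∧
    ∀ ν : Fin m → Fin m, Function.Injective ν → StableInWords t c ν → ∀ a, c a (μ a) ≤ c a (ν a)

instance {m : ℕ} (t c : Fin m → Fin m → Fin m) (μ : Fin m → Fin m) :
    Decidable (StableInWords t c μ) :=
  inferInstanceAs (Decidable (∀ _, _))

/-- Decide a statement about all tuples one coordinate at a time. -/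
def decidableForallTuple {k : ℕ} : (m : ℕ) → (p : (Fin m → Fin k) → Prop) → [DecidablePred p] →
    Decidable (∀ ν, p ν)
  | 0, p, _ => decidable_of_iff (p Fin.elim0) (by rw [Fin.forall_fin_zero_pi]; rfl)
  | m + 1, p, _ =>
    have : ∀ a, Decidable (∀ v : Fin m → Fin k, p (Fin.cons a v)) := fun _ =>
      decidableForallTuple m _
    decidable_of_iff (∀ a, ∀ v : Fin m → Fin k, p (Fin.cons a v))
      ⟨fun h ν => by simpa using h (ν 0) (Fin.tail ν), fun h a v => h _⟩

instance {m : ℕ} (t c : Fin m → Fin m → Fin m) (μ : Fin m → Fin m) :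
    Decidable (OptimalInWords t c μ) :=
  have := decidableForallTuple m fun ν : Fin m → Fin m =>
    Function.Injective ν → StableInWords t c ν → ∀ a, c a (μ a) ≤ c a (ν a)
  inferInstanceAs (Decidable (_ ∧ _ ∧ _))

/-- If the applicants outside a small market have distinct favorites outside it, and those inside
prefer the positions inside, then the applicant-optimal stable matching restricts to that of the
small market. -/
theorem IsApplicantOptimal.apply_eq_of_optimalInWords {A P : Type u} {q : P → Ranking A} {m : ℕ}
    {t c : Fin m → Fin m → Fin m} {e : Fin m → A} {f : Fin m → P} (Φ : A ≃ P)
    (hΦ : ∀ i, Φ (e i) = f i) (he : Function.Injective e) (hf : Function.Injective f)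
    (ht : ∀ i, Function.Surjective (t i)) (hc : ∀ i, Function.Injective (c i))
    (hq : ∀ i r s, r < s → (q (f i)).rel (e (t i r)) (e (t i s)))
    {T : A → Ranking P} (hin : ∀ i j k, c i j < c i k → (T (e i)).rel (f j) (f k))
    (hinout : ∀ i j p, p ∉ Set.range f → (T (e i)).rel (f j) p)
    (hout : ∀ a ∉ Set.range e, ∀ p, p ≠ Φ a → (T a).rel (Φ a) p)
    {μ : Fin m → Fin m} (hμ : OptimalInWords t c μ) {M : A ≃ P} (hM : IsApplicantOptimal q T M)
    (i : Fin m) : M (e i) = f (μ i) := by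
  obtain ⟨hμi, hμs, hμo⟩ := hμ
  let e' : Fin m ↪ A := ⟨e, he⟩
  let σ : Equiv.Perm (Fin m) := Equiv.ofBijective μ (Finite.injective_iff_bijective.1 hμi)
  -- The stable matching of the small market, completed by the favorites `Φ` of the outside
  -- applicants.
  let ν : A ≃ P := (σ.viaEmbedding e').trans Φ
  have hνe : ∀ j, ν (e j) = f (μ j) := fun j => by
    have : σ.viaEmbedding e' (e j) = e (μ j) := σ.viaEmbedding_apply e' j
    simp only [ν, Equiv.trans_apply, this, hΦ]
  have hνo : ∀ a ∉ Set.range e, ν a = Φ a := fun a ha => by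
    have : σ.viaEmbedding e' a = a := σ.viaEmbedding_apply_of_notMem e' a ha
    simp only [ν, Equiv.trans_apply, this]
  have hν : IsStable q T ν := by
    intro a p hap
    by_cases ha : a ∈ Set.range e
    · obtain ⟨j, rfl⟩ := ha
      by_cases hp : p ∈ Set.range f
      · obtain ⟨k, rfl⟩ := hp
        rcases hμs j k with h | h | ⟨b, rfl, r, s, hrs, hr, hs⟩
        · exact absurd (by rw [hνe, h]) hap
        · rw [hνe]; exact Or.inl (hin _ _ _ h)
        · right
          rw [← hνe, Equiv.symm_apply_apply, hνe]
          have := hq (μ b) _ _ hrs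
          rwa [hr, hs] at this
      · rw [hνe]; exact Or.inl (hinout _ _ _ hp)
    · rw [hνo a ha] at hap ⊢
      exact Or.inl (hout a ha p hap.symm)
  -- By optimality outside applicants do at least as well under `M` as under the stable `ν`, where
  -- they already have their favorites. What is left for the inside applicants is exactly the inside
  -- positions.
  have hMo : ∀ a ∉ Set.range e, M a = Φ a := fun a ha => by
    by_contra h
    rcases hM.2 ν hν a with h' | h'
    · exact h (h'.trans (hνo a ha))
    · rw [hνo a ha] at h'
      exact (T a).asymm h' (hout a ha _ h)
  have hMr : ∀ j, ∃ k, M (e j) = f k := fun j => by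
    by_cases h : Φ.symm (M (e j)) ∈ Set.range e
    · obtain ⟨k, hk⟩ := h
      exact ⟨k, by rw [← hΦ, hk, Equiv.apply_symm_apply]⟩
    · have := hMo _ h
      rw [Equiv.apply_symm_apply, M.apply_eq_iff_eq] at this
      exact absurd ⟨j, this.symm⟩ h
  choose κ hκ using hMr
  have hκi : Function.Injective κ := fun j k h => he (M.injective (by rw [hκ, hκ, h]))
  have hκsurj := (Finite.injective_iff_bijective.1 hκi).2
  have hκs : StableInWords t c κ := by
    intro a p
    by_cases h : κ a = p
    · exact Or.inl h
    right
    rcases hM.1 (e a) (f p) (by rw [hκ]; exact fun h' => h (hf h')) with h' | h'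
    · left
      rw [hκ] at h'
      rcases lt_trichotomy (c a (κ a)) (c a p) with h'' | h'' | h''
      · exact h''
      · exact absurd (hc a h'') h
      · exact absurd (hin _ _ _ h'') ((T (e a)).asymm h')
    · right
      obtain ⟨b, rfl⟩ := hκsurj p
      rw [← hκ, Equiv.symm_apply_apply, hκ] at h'
      obtain ⟨r, hr⟩ := ht (κ b) b
      obtain ⟨s, hs⟩ := ht (κ b) a
      refine ⟨b, rfl, r, s, ?_, hr, hs⟩
      rcases lt_trichotomy r s with hrs | rfl | hrs
      · exact hrs
      · exact absurd (hr.symm.trans hs ▸ rfl) h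
      · have := hq (κ b) _ _ hrs
        rw [hr, hs] at this
        exact absurd this (Ranking.asymm _ h')
  -- Optimality is used in both directions: `μ` beats `κ` in the small market, and `M` beats `ν` in
  -- the large one.
  have h1 := hμo κ hκi hκs i
  rcases hM.2 ν hν (e i) with h | h
  · exact h.trans (hνe i)
  · rw [hκ, hνe] at h
    rcases h1.lt_or_eq with h1 | h1
    · exact absurd h (Ranking.asymm _ (hin _ _ _ h1))
    · rw [hκ, hc i h1]

/-- There is a ranking that ranks the values of `f` by increasing `c`, above everything else. -/
theorem Ranking.exists_extending {P : Type u} [Finite P] {m : ℕ} {f : Fin m → P}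
    (hf : Function.Injective f) {c : Fin m → Fin m} (hc : Function.Injective c) :
    ∃ r : Ranking P, (∀ j k, c j < c k → r.rel (f j) (f k)) ∧
      ∀ j, ∀ p ∉ Set.range f, r.rel (f j) p := by
  obtain ⟨n, ⟨idx⟩⟩ := Finite.exists_equiv_fin P
  -- The offset `m` puts all other positions below the listed ones, whose keys are less than `m`.
  let key : P → ℕ := Function.extend f (fun k => (c k : ℕ)) fun p => m + idx p
  have h1 : ∀ j, key (f j) = c j := fun j => hf.extend_apply _ _ j
  have h2 : ∀ p ∉ Set.range f, key p = m + idx p := fun p hp =>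
    Function.extend_apply' _ _ p (by simpa using hp)
  have hkey : Function.Injective key := by
    intro p p' h
    by_cases hp : p ∈ Set.range f <;> by_cases hp' : p' ∈ Set.range f
    · obtain ⟨j, rfl⟩ := hp
      obtain ⟨k, rfl⟩ := hp'
      rw [h1, h1] at h
      rw [hc (Fin.ext h)]
    · obtain ⟨j, rfl⟩ := hp
      rw [h1, h2 _ hp'] at h
      omega
    · obtain ⟨j, rfl⟩ := hp'
      rw [h1, h2 _ hp] at h
      omega
    · rw [h2 _ hp, h2 _ hp'] at h
      exact idx.injective (Fin.ext (by omega))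
  refine ⟨.ofKey key hkey, fun j k h => ?_, fun j p hp => ?_⟩
  · simpa [Ranking.ofKey, h1] using h
  · simp only [Ranking.ofKey, h1, h2 p hp]
    omega

theorem Ranking.exists_first {P : Type u} [Finite P] (p : P) :
    ∃ r : Ranking P, ∀ p', p' ≠ p → r.rel p p' := by
  obtain ⟨r, -, h⟩ := Ranking.exists_extending (f := fun _ : Fin 1 => p)
    (Function.injective_of_subsingleton _) (c := id) Function.injective_id
  exact ⟨r, fun p' hp' => h 0 p' (by simpa using hp')⟩

theorem DA_isApplicantOptimal {A P : Type u} [Fintype A] [Fintype P]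
    (hcard : Fintype.card A = Fintype.card P) (q : P → Ranking A) (t : A → Ranking P) :
    IsApplicantOptimal q t (DA hcard q t) :=
  Classical.choose_spec (exists_isApplicantOptimal hcard q t)

/-- A pair of profiles from the domain `d` that shows that applicant `v.1` cannot separate their
types in the two profiles: their match in the second one is better than in the first, for their
type in the first. -/
def SeparationViolation {m : ℕ} (t : Fin m → Fin m → Fin m) (d : Fin m → Fin 3 → Fin m → Fin m)
    (v : Fin m × (Fin m → Fin 3) × (Fin m → Fin 3) × (Fin m → Fin m) × (Fin m → Fin m)) : Prop :=
  OptimalInWords t (fun i => d i (v.2.1 i)) v.2.2.2.1 ∧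
  OptimalInWords t (fun i => d i (v.2.2.1 i)) v.2.2.2.2 ∧
  d v.1 (v.2.1 v.1) (v.2.2.2.2 v.1) < d v.1 (v.2.1 v.1) (v.2.2.2.1 v.1)

instance {m : ℕ} (t : Fin m → Fin m → Fin m) (d : Fin m → Fin 3 → Fin m → Fin m)
    (v : Fin m × (Fin m → Fin 3) × (Fin m → Fin 3) × (Fin m → Fin m) × (Fin m → Fin m)) :
    Decidable (SeparationViolation t d v) :=
  inferInstanceAs (Decidable (_ ∧ _ ∧ _))

/-- A criterion for deferred acceptance not to be OSP implementable: `d i` lists three types of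
each of the applicants `i` of a small market, and `V` lists violations showing that the types
`d i j` and `d i (j + 1)` cannot be separated unless they are equal. -/
theorem not_ospImplementable_of_violations {A P : Type u} [Fintype A] [Fintype P]
    (hcard : Fintype.card A = Fintype.card P) (q : P → Ranking A) {m : ℕ}
    {t : Fin m → Fin m → Fin m} (d : Fin m → Fin 3 → Fin m → Fin m)
    (V : List (Fin m × (Fin m → Fin 3) × (Fin m → Fin 3) × (Fin m → Fin m) × (Fin m → Fin m)))
    (ht : ∀ i, Function.Surjective (t i)) (hd : ∀ i j, Function.Injective (d i j))
    (hV : ∀ v ∈ V, SeparationViolation t d v) (hne : V ≠ [])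
    (hlink : ∀ i, ∀ j : Fin 2, d i j.castSucc = d i j.succ ∨ ∃ v ∈ V, v.1 = i ∧
      (v.2.1 i = j.castSucc ∧ v.2.2.1 i = j.succ ∨ v.2.1 i = j.succ ∧ v.2.2.1 i = j.castSucc))
    (hq : HasRestriction q t) : ¬ OSPImplementable (matchingEnv A P) (DA hcard q) := by
  classical
  rintro ⟨G, hG, himp⟩
  obtain ⟨S, R, e₀, f₀, hrel⟩ := hq
  let e : Fin m → A := fun i => e₀ i
  let f : Fin m → P := fun i => f₀ i
  have he : Function.Injective e := Subtype.val_injective.comp e₀.injective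
  have hf : Function.Injective f := Subtype.val_injective.comp f₀.injective
  obtain ⟨Φ, hΦ⟩ : ∃ Φ : A ≃ P, ∀ i, Φ (e i) = f i := by
    obtain ⟨g, hg⟩ := Set.MapsTo.exists_equiv_extend_of_card_eq (t := (Finset.univ : Finset P))
      (s := Set.range e) (f := Function.extend e f fun a => Fintype.equivOfCardEq hcard a)
      (by simpa using hcard) (fun _ _ => by simp) (by
        rintro _ ⟨i, rfl⟩ _ ⟨j, rfl⟩ h
        rw [he.extend_apply, he.extend_apply] at h
        rw [hf h])
    refine ⟨g.trans (Equiv.subtypeUnivEquiv (by simp)), fun i => ?_⟩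
    rw [← he.extend_apply f (fun a => Fintype.equivOfCardEq hcard a) i]
    exact hg _ ⟨i, rfl⟩
  choose r hr1 hr2 using fun (c : Fin m → Fin m) (hc : Function.Injective c) =>
    Ranking.exists_extending hf hc
  choose r' hr' using fun a => Ranking.exists_first (Φ a)
  let T : (Fin m → Fin 3) → A → Ranking P := fun σ =>
    Function.extend e (fun i => r _ (hd i (σ i))) r'
  have hTe : ∀ σ i, T σ (e i) = r _ (hd i (σ i)) := fun σ i => he.extend_apply _ _ i
  have hTo : ∀ σ, ∀ a ∉ Set.range e, T σ a = r' a := fun σ a ha =>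
    Function.extend_apply' _ _ a (by simpa using ha)
  let M : (Fin m → Fin 3) → A ≃ P := fun σ => DA hcard q (T σ)
  have hDA : ∀ σ μ, OptimalInWords t (fun i => d i (σ i)) μ →
      ∀ i, M σ (e i) = f (μ i) := fun σ μ hμ i => by
    refine (DA_isApplicantOptimal hcard q (T σ)).apply_eq_of_optimalInWords Φ hΦ he hf ht
      (fun i => hd i (σ i)) hrel ?_ ?_ ?_ hμ i
    · intro i j k; rw [hTe]; exact hr1 _ _ j k
    · intro i j p; rw [hTe]; exact hr2 _ _ j p
    · intro a ha; rw [hTo σ a ha]; exact hr' a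
  have hviol : ∀ v ∈ V, ¬ (matchingEnv A P).pref (e v.1) (T v.2.1 (e v.1)) (DA hcard q (T v.2.1))
      (DA hcard q (T v.2.2.1)) := by
    rintro v hv hpref
    obtain ⟨h1, h2, h3⟩ := hV v hv
    have h4 := hr1 _ (hd _ _) _ _ h3
    change M v.2.1 (e v.1) = M v.2.2.1 (e v.1) ∨
      (T v.2.1 (e v.1)).rel (M v.2.1 (e v.1)) (M v.2.2.1 (e v.1)) at hpref
    rw [hDA _ _ h1, hDA _ _ h2, hTe] at hpref
    rcases hpref with h | h
    · rw [h] at h4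
      exact Ranking.irrefl _ _ h4
    · exact Ranking.asymm _ h h4
  obtain ⟨v, hv⟩ := List.exists_mem_of_ne_nil V hne
  -- If the outcome is constant on the domain, the two matches in any one violation coincide, so it
  -- is not a violation.
  refine hviol v hv (Or.inl (congrArg (fun μ : A ≃ P => μ (e v.1)) ?_))
  refine IsOSPFrom.play_eq_of_inseparable (E := matchingEnv A P) (f := DA hcard q)
    (D := fun a => {x | ∃ σ, x = T σ a})
    ?_ hG (fun _ _ _ => Set.mem_univ _) (fun τ _ => himp τ) (fun k => ⟨_, rfl⟩) fun k => ⟨_, rfl⟩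
  rintro a ι ask ⟨_, ⟨σ, rfl⟩, _, ⟨σ', rfl⟩, hask⟩
  by_cases ha : a ∈ Set.range e
  swap
  · rw [hTo σ a ha, hTo σ' a ha] at hask
    exact absurd rfl hask
  obtain ⟨i, rfl⟩ := ha
  rw [hTe, hTe] at hask
  -- A question that is not constant on the three listed types differs at two consecutive ones. This
  -- is why violations are needed only for consecutive entries.
  obtain ⟨j, hj⟩ : ∃ j : Fin 2, ask (r _ (hd i j.castSucc)) ≠ ask (r _ (hd i j.succ)) := by
    by_contra! hall
    have : ∀ j, ask (r _ (hd i j)) = ask (r _ (hd i 0)) := by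
      intro j
      fin_cases j
      · rfl
      · exact (hall 0).symm
      · exact ((hall 0).trans (hall 1)).symm
    exact hask ((this _).trans (this _).symm)
  rcases hlink i j with h | ⟨w, hw, rfl, h⟩
  · simp only [h, ne_eq, not_true_eq_false] at hj
  · refine ⟨T w.2.1, T w.2.2.1, fun k => ⟨_, rfl⟩, fun k => ⟨_, rfl⟩, ?_, hviol w hw⟩
    rw [hTe, hTe]
    rcases h with ⟨h1, h2⟩ | ⟨h1, h2⟩
    · simpa only [h1, h2] using hj
    · simpa only [h1, h2] using hj.symm

/-- Each pattern is refuted by an explicit certificate. The vectors in `d` give the rank of every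
position, with `0` for the favorite; an entry of `V` consists of an applicant, two profiles of type
indices, and the optimal matchings for them. Two types per applicant suffice, the second being
listed twice, except for the last applicant in the second pattern, who needs three. -/
theorem OSPImplementable.not_hasRestriction_three {A P : Type u} [Fintype A] [Fintype P]
    {hcard : Fintype.card A = Fintype.card P} {q : P → Ranking A}
    (h : OSPImplementable (matchingEnv A P) (DA hcard q)) :
    ∀ t ∈ forbiddenThree, ¬ HasRestriction q t := by
  intro t ht hq
  simp only [forbiddenThree, List.mem_cons, List.not_mem_nil, or_false] at ht
  rcases ht with rfl | rfl | rfl | rfl | rfl | rfl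
  · exact not_ospImplementable_of_violations hcard q
      (d := ![![![1, 0, 2], ![2, 0, 1], ![2, 0, 1]],
        ![![0, 1, 2], ![1, 2, 0], ![1, 2, 0]],
        ![![0, 1, 2], ![1, 0, 2], ![1, 0, 2]]])
      (V := [(0, ![0, 0, 0], ![1, 1, 0], ![0, 1, 2], ![1, 2, 0]),
        (1, ![0, 0, 0], ![1, 1, 1], ![0, 1, 2], ![2, 0, 1]),
        (2, ![0, 0, 0], ![0, 1, 1], ![0, 1, 2], ![0, 2, 1])])
      (by decide) (by decide)
      (by simp only [List.forall_mem_cons, List.not_mem_nil, false_imp_iff, implies_true, and_true]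
          decide +kernel)
      (by decide) (by decide +kernel) hq h
  · exact not_ospImplementable_of_violations hcard q
      (d := ![![![1, 2, 0], ![2, 1, 0], ![2, 1, 0]],
        ![![0, 1, 2], ![1, 0, 2], ![1, 0, 2]],
        ![![0, 2, 1], ![0, 1, 2], ![2, 0, 1]]])
      (V := [(0, ![0, 0, 0], ![1, 0, 1], ![0, 1, 2], ![2, 0, 1]),
        (1, ![0, 0, 0], ![1, 1, 2], ![0, 1, 2], ![1, 0, 2]),
        (2, ![0, 0, 0], ![0, 1, 1], ![0, 1, 2], ![2, 1, 0]),
        (2, ![0, 1, 2], ![0, 0, 1], ![0, 1, 2], ![2, 0, 1])])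
      (by decide) (by decide)
      (by simp only [List.forall_mem_cons, List.not_mem_nil, false_imp_iff, implies_true, and_true]
          decide +kernel)
      (by decide) (by decide +kernel) hq h
  · exact not_ospImplementable_of_violations hcard q
      (d := ![![![1, 2, 0], ![2, 1, 0], ![2, 1, 0]],
        ![![0, 1, 2], ![1, 2, 0], ![1, 2, 0]],
        ![![0, 1, 2], ![0, 2, 1], ![0, 2, 1]]])
      (V := [(0, ![0, 0, 1], ![1, 0, 0], ![0, 1, 2], ![2, 0, 1]),
        (1, ![0, 1, 1], ![0, 0, 0], ![0, 1, 2], ![2, 0, 1]),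
        (2, ![0, 0, 0], ![1, 1, 1], ![2, 0, 1], ![1, 2, 0])])
      (by decide) (by decide)
      (by simp only [List.forall_mem_cons, List.not_mem_nil, false_imp_iff, implies_true, and_true]
          decide +kernel)
      (by decide) (by decide +kernel) hq h
  · exact not_ospImplementable_of_violations hcard q
      (d := ![![![1, 2, 0], ![2, 1, 0], ![2, 1, 0]],
        ![![0, 1, 2], ![2, 0, 1], ![2, 0, 1]],
        ![![0, 1, 2], ![1, 2, 0], ![1, 2, 0]]])
      (V := [(0, ![0, 0, 1], ![1, 0, 0], ![0, 1, 2], ![2, 0, 1]),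
        (1, ![1, 1, 1], ![0, 0, 1], ![1, 2, 0], ![0, 1, 2]),
        (2, ![0, 0, 0], ![1, 1, 1], ![2, 0, 1], ![1, 2, 0])])
      (by decide) (by decide)
      (by simp only [List.forall_mem_cons, List.not_mem_nil, false_imp_iff, implies_true, and_true]
          decide +kernel)
      (by decide) (by decide +kernel) hq h
  · exact not_ospImplementable_of_violations hcard q
      (d := ![![![1, 2, 0], ![2, 1, 0], ![2, 1, 0]],
        ![![0, 1, 2], ![2, 0, 1], ![2, 0, 1]],
        ![![0, 2, 1], ![1, 0, 2], ![1, 0, 2]]])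
      (V := [(0, ![0, 0, 0], ![1, 0, 1], ![0, 1, 2], ![2, 0, 1]),
        (1, ![0, 1, 1], ![0, 0, 0], ![0, 2, 1], ![0, 1, 2]),
        (2, ![0, 0, 0], ![1, 1, 1], ![0, 1, 2], ![1, 2, 0])])
      (by decide) (by decide)
      (by simp only [List.forall_mem_cons, List.not_mem_nil, false_imp_iff, implies_true, and_true]
          decide +kernel)
      (by decide) (by decide +kernel) hq h
  · exact not_ospImplementable_of_violations hcard q
      (d := ![![![1, 2, 0], ![2, 1, 0], ![2, 1, 0]],
        ![![0, 1, 2], ![1, 2, 0], ![1, 2, 0]],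
        ![![0, 1, 2], ![0, 2, 1], ![0, 2, 1]]])
      (V := [(0, ![0, 0, 1], ![1, 0, 0], ![0, 1, 2], ![2, 0, 1]),
        (1, ![0, 1, 1], ![0, 0, 0], ![0, 1, 2], ![2, 0, 1]),
        (2, ![0, 0, 0], ![1, 1, 1], ![2, 0, 1], ![1, 2, 0])])
      (by decide) (by decide)
      (by simp only [List.forall_mem_cons, List.not_mem_nil, false_imp_iff, implies_true, and_true]
          decide +kernel)
      (by decide) (by decide +kernel) hq h

/-- Here the first applicant has one fixed type, so nothing can be asked of them; the other three
applicants have two types each. -/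
theorem OSPImplementable.not_hasRestriction_four {A P : Type u} [Fintype A] [Fintype P]
    {hcard : Fintype.card A = Fintype.card P} {q : P → Ranking A}
    (h : OSPImplementable (matchingEnv A P) (DA hcard q)) :
    ¬ HasRestriction q forbiddenFour := fun hq =>
  not_ospImplementable_of_violations hcard q
    (d := ![![![3, 2, 1, 0], ![3, 2, 1, 0], ![3, 2, 1, 0]],
      ![![2, 1, 0, 3], ![3, 2, 0, 1], ![3, 2, 0, 1]],
      ![![3, 0, 2, 1], ![2, 3, 0, 1], ![2, 3, 0, 1]],
      ![![1, 0, 2, 3], ![1, 2, 3, 0], ![1, 2, 3, 0]]])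
    (V := [(1, ![0, 0, 0, 0], ![0, 1, 0, 1], ![3, 1, 2, 0], ![3, 2, 1, 0]),
      (2, ![0, 1, 0, 0], ![0, 0, 1, 0], ![2, 3, 0, 1], ![3, 1, 2, 0]),
      (3, ![0, 0, 0, 0], ![0, 1, 1, 1], ![3, 1, 2, 0], ![2, 3, 0, 1])])
    (by decide) (by decide)
    (by simp only [List.forall_mem_cons, List.not_mem_nil, false_imp_iff, implies_true, and_true]
        decide +kernel)
    (by decide) (by decide +kernel) hq h

/-! ### Priorities without forbidden restrictions are limited cyclic -/

theorem hasRestriction_of_injective {A P : Type u} {q : P → Ranking A} {m : ℕ}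
    {t : Fin m → Fin m → Fin m} {e : Fin m → A} {f : Fin m → P} (he : Function.Injective e)
    (hf : Function.Injective f) (h : ∀ i r s, r < s → (q (f i)).rel (e (t i r)) (e (t i s))) :
    HasRestriction q t :=
  ⟨Set.range e, Set.range f, Equiv.ofInjective e he, Equiv.ofInjective f hf, h⟩

/-- `r` ranks `a` above `b` above `c`. -/
def Ranking.Chain {α : Type u} (r : Ranking α) (a b c : α) : Prop := r.rel a b ∧ r.rel b c

theorem Ranking.Chain.rel {α : Type u} {r : Ranking α} {a b c : α} (h : r.Chain a b c) :
    r.rel a c := r.trans _ _ _ h.1 h.2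

theorem Ranking.chain_cases {α : Type u} (r : Ranking α) {a b c : α} (hab : a ≠ b) (hbc : b ≠ c)
    (hac : a ≠ c) : r.Chain a b c ∨ r.Chain a c b ∨ r.Chain b a c ∨ r.Chain b c a ∨
      r.Chain c a b ∨ r.Chain c b a := by
  unfold Ranking.Chain
  have := r.total a b hab
  have := r.total b c hbc
  have := r.total a c hac
  tauto

/-- Serves to exclude a configuration by naming the forbidden word set and the labeling under which
it occurs. -/
theorem not_chains_of_not_hasRestriction {A P : Type u} {q : P → Ranking A}
    (hq : ∀ t ∈ forbiddenThree, ¬ HasRestriction q t) (t : Fin 3 → Fin 3 → Fin 3)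
    (ht : t ∈ forbiddenThree) {a b c : A} {p r s : P} (hpr : p ≠ r) (hps : p ≠ s) (hrs : r ≠ s)
    (hp : (q p).Chain (![a, b, c] (t 0 0)) (![a, b, c] (t 0 1)) (![a, b, c] (t 0 2)))
    (hr : (q r).Chain (![a, b, c] (t 1 0)) (![a, b, c] (t 1 1)) (![a, b, c] (t 1 2)))
    (hs : (q s).Chain (![a, b, c] (t 2 0)) (![a, b, c] (t 2 1)) (![a, b, c] (t 2 2)))
    (hab : a ≠ b) (hbc : b ≠ c) (hac : a ≠ c) : False := by
  refine hq t ht (hasRestriction_of_injective (e := ![a, b, c]) (f := ![p, r, s]) ?_ ?_ ?_)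
  · intro i j h
    fin_cases i <;> fin_cases j <;> simp_all
  · intro i j h
    fin_cases i <;> fin_cases j <;> simp_all
  · intro i k l hkl
    have key : ∀ x : P, (q x).Chain (![a, b, c] (t i 0)) (![a, b, c] (t i 1))
        (![a, b, c] (t i 2)) → (q x).rel (![a, b, c] (t i k)) (![a, b, c] (t i l)) := by
      intro x hx
      fin_cases k <;> fin_cases l
      all_goals first
        | exact hx.1
        | exact hx.2
        | exact hx.rel
        | exact absurd hkl (by decide)
    fin_cases i
    · exact key p hp
    · exact key r hr
    · exact key s hs

theorem exists_notMem_of_card_lt {P : Type u} [Fintype P] (s : Finset P)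
    (h : s.card < Fintype.card P) : ∃ x, x ∉ s := by
  by_contra! hall
  exact absurd (Finset.card_le_card fun x _ => hall x) (by rw [Finset.card_univ]; omega)

theorem exists_ne_ne {P : Type u} [Fintype P] (h : 3 ≤ Fintype.card P) (p r : P) :
    ∃ s, s ≠ p ∧ s ≠ r := by
  classical
  obtain ⟨s, hs⟩ := exists_notMem_of_card_lt {p, r} (lt_of_le_of_lt Finset.card_le_two h)
  exact ⟨s, by simpa using hs⟩

/-- Whatever order a third position has, it completes the two opposite orders to one of the three
patterns that contain `abc` and `cba`, possibly after exchanging the roles of these two. -/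
theorem not_chain_reverse {A P : Type u} [Fintype P] {q : P → Ranking A}
    (hq : ∀ t ∈ forbiddenThree, ¬ HasRestriction q t) (hP : 3 ≤ Fintype.card P)
    {a b c : A} {p r : P} (hp : (q p).Chain a b c) (hr : (q r).Chain c b a) : False := by
  have hab := (q p).ne hp.1
  have hbc := (q p).ne hp.2
  have hac := (q p).ne hp.rel
  have hpr : p ≠ r := by rintro rfl; exact (q p).asymm hp.1 hr.2
  obtain ⟨s, hsp, hsr⟩ := exists_ne_ne hP p r
  rcases (q s).chain_cases hab hbc hac with hs | hs | hs | hs | hs | hs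
  · exact not_chains_of_not_hasRestriction hq ![![0, 1, 2], ![0, 1, 2], ![2, 1, 0]]
      (by simp [forbiddenThree]) hsp.symm hpr hsr hp hs hr hab hbc hac
  · exact not_chains_of_not_hasRestriction hq ![![0, 1, 2], ![0, 2, 1], ![2, 1, 0]]
      (by simp [forbiddenThree]) hsp.symm hpr hsr hp hs hr hab hbc hac
  · exact not_chains_of_not_hasRestriction hq ![![0, 1, 2], ![1, 0, 2], ![2, 1, 0]]
      (by simp [forbiddenThree]) hsp.symm hpr hsr hp hs hr hab hbc hac
  · exact not_chains_of_not_hasRestriction hq ![![0, 1, 2], ![1, 0, 2], ![2, 1, 0]]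
      (by simp [forbiddenThree]) hsr.symm hpr.symm hsp hr hs hp hbc.symm hab.symm hac.symm
  · exact not_chains_of_not_hasRestriction hq ![![0, 1, 2], ![0, 2, 1], ![2, 1, 0]]
      (by simp [forbiddenThree]) hsr.symm hpr.symm hsp hr hs hp hbc.symm hab.symm hac.symm
  · exact not_chains_of_not_hasRestriction hq ![![0, 1, 2], ![0, 1, 2], ![2, 1, 0]]
      (by simp [forbiddenThree]) hsr.symm hpr.symm hsp hr hs hp hbc.symm hab.symm hac.symm

/-- Of the six orders, two are reverses of given ones and three complete a forbidden pattern. The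
remaining one differs from each of the two given orders by one adjacent swap, so it is the common
order from which they deviate. -/
theorem chain_of_rotation {A P : Type u} [Fintype P] {q : P → Ranking A}
    (hq : ∀ t ∈ forbiddenThree, ¬ HasRestriction q t) (hP : 3 ≤ Fintype.card P)
    {a b c : A} {p r : P} (hp : (q p).Chain a b c) (hr : (q r).Chain c a b) {s : P} (hsp : s ≠ p)
    (hsr : s ≠ r) : (q s).Chain a c b := by
  have hab := (q p).ne hp.1
  have hbc := (q p).ne hp.2
  have hac := (q p).ne hp.rel
  have hpr : p ≠ r := by rintro rfl; exact (q p).asymm hp.rel hr.1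
  rcases (q s).chain_cases hab hbc hac with hs | hs | hs | hs | hs | hs
  · exact (not_chains_of_not_hasRestriction hq ![![0, 1, 2], ![0, 1, 2], ![2, 0, 1]]
      (by simp [forbiddenThree]) hsp.symm hpr hsr hp hs hr hab hbc hac).elim
  · exact hs
  · exact (not_chain_reverse hq hP hs hr).elim
  · exact (not_chains_of_not_hasRestriction hq ![![0, 1, 2], ![1, 2, 0], ![2, 0, 1]]
      (by simp [forbiddenThree]) hsp.symm hpr hsr hp hs hr hab hbc hac).elim
  · exact (not_chains_of_not_hasRestriction hq ![![0, 1, 2], ![0, 1, 2], ![1, 2, 0]]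
      (by simp [forbiddenThree]) hsr hsp hpr.symm hs hr hp hac.symm hab hbc.symm).elim
  · exact (not_chain_reverse hq hP hp hs).elim

/-! ### The conflict graph and its dissenting positions. -/

/-- The positions disagree on the applicants `a` and `b`. -/
def Conflict {A P : Type u} (q : P → Ranking A) (a b : A) : Prop :=
  (∃ p, (q p).rel a b) ∧ ∃ p, (q p).rel b a

/-- All positions except `w` rank `a` above `b`. -/
def SoleDissenter {A P : Type u} (q : P → Ranking A) (a b : A) (w : P) : Prop :=
  (q w).rel b a ∧ ∀ s, s ≠ w → (q s).rel a b

theorem Conflict.symm {A P : Type u} {q : P → Ranking A} {a b : A} (h : Conflict q a b) :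
    Conflict q b a := ⟨h.2, h.1⟩

theorem Conflict.ne {A P : Type u} {q : P → Ranking A} {a b : A} (h : Conflict q a b) : a ≠ b :=
  let ⟨⟨_, hp⟩, _⟩ := h
  Ranking.ne _ hp

theorem forall_rel_of_not_conflict {A P : Type u} {q : P → Ranking A} {a b : A}
    (h : ¬ Conflict q a b) {p : P} (hp : (q p).rel a b) (r : P) : (q r).rel a b := by
  rcases (q r).total a b ((q p).ne hp) with h' | h'
  · exact h'
  · exact absurd ⟨⟨p, hp⟩, ⟨r, h'⟩⟩ h

namespace SoleDissenter

variable {A P : Type u} {q : P → Ranking A} {a b c d : A} {u v w : P}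

theorem unique (h : SoleDissenter q a b v) (h' : SoleDissenter q a b w) : v = w := by
  by_contra hne
  exact (q v).asymm h.1 (h'.2 v hne)

variable [Fintype P]

theorem not_swap (hP : 3 ≤ Fintype.card P) (h : SoleDissenter q a b v)
    (h' : SoleDissenter q b a w) : False := by
  obtain ⟨s, hsv, hsw⟩ := exists_ne_ne hP v w
  exact (q s).asymm (h.2 s hsv) (h'.2 s hsw)

theorem conflict (hP : 3 ≤ Fintype.card P) (h : SoleDissenter q a b v) : Conflict q a b := by
  obtain ⟨s, hsv, -⟩ := exists_ne_ne hP v v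
  exact ⟨⟨s, h.2 s hsv⟩, ⟨v, h.1⟩⟩

end SoleDissenter

/-- The orders `acb` and `bac` are rotations of each other, so `chain_of_rotation` gives every other
position the order `abc`; the claims are then read off. -/
theorem soleDissenters_of_chains {A P : Type u} [Fintype P] {q : P → Ranking A}
    (hq : ∀ t ∈ forbiddenThree, ¬ HasRestriction q t) (hP : 3 ≤ Fintype.card P)
    {a b c : A} {u v : P} (hu : (q u).Chain a c b) (hv : (q v).Chain b a c) :
    u ≠ v ∧ SoleDissenter q a b v ∧ SoleDissenter q b c u ∧ ∀ p, (q p).rel a c := by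
  have huv : u ≠ v := by rintro rfl; exact (q u).asymm hu.rel hv.1
  have hs : ∀ s, s ≠ u → s ≠ v → (q s).Chain a b c := fun s h h' =>
    chain_of_rotation hq hP hu hv h h'
  refine ⟨huv, ⟨hv.1, fun s h => ?_⟩, ⟨hu.2, fun s h => ?_⟩, fun s => ?_⟩
  · by_cases hsu : s = u
    · exact hsu ▸ hu.rel
    · exact (hs s hsu h).1
  · by_cases hsv : s = v
    · exact hsv ▸ hv.rel
    · exact (hs s h hsv).2
  · by_cases hsu : s = u
    · exact hsu ▸ hu.1
    · by_cases hsv : s = v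
      · exact hsv ▸ hv.2
      · exact (hs s hsu hsv).rel

/-- The local structure theorem: two conflicts sharing `b` have single and different dissenters, and
`b` is the middle one in the order of the others. It suffices to find two positions that disagree on
both pairs; as full reversals are excluded, one of them has `b` last, the other has `b` first, and
they agree on `a` and `c`. -/
theorem Conflict.soleDissenters {A P : Type u} [Fintype P] {q : P → Ranking A}
    (hq : ∀ t ∈ forbiddenThree, ¬ HasRestriction q t) (hP : 3 ≤ Fintype.card P)
    {a b c : A} (hab : Conflict q a b) (hbc : Conflict q b c) (hac : a ≠ c) :
    ∃ u v, u ≠ v ∧ ((SoleDissenter q a b v ∧ SoleDissenter q b c u ∧ ∀ p, (q p).rel a c) ∨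
      (SoleDissenter q c b v ∧ SoleDissenter q b a u ∧ ∀ p, (q p).rel c a)) := by
  have main : ∀ p r, (q p).rel a b → (q p).rel c b → (q r).rel b a → (q r).rel b c →
      ∃ u v, u ≠ v ∧ ((SoleDissenter q a b v ∧ SoleDissenter q b c u ∧ ∀ p, (q p).rel a c) ∨
      (SoleDissenter q c b v ∧ SoleDissenter q b a u ∧ ∀ p, (q p).rel c a)) := by
    intro p r h1 h2 h3 h4
    rcases (q p).total a c hac with h | h <;> rcases (q r).total a c hac with h' | h'
    · exact ⟨p, r, (soleDissenters_of_chains hq hP ⟨h, h2⟩ ⟨h3, h'⟩).imp_right Or.inl⟩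
    · exact (not_chain_reverse hq hP (a := a) (b := c) (c := b) ⟨h, h2⟩ ⟨h4, h'⟩).elim
    · exact (not_chain_reverse hq hP (a := c) (b := a) (c := b) ⟨h, h1⟩ ⟨h3, h'⟩).elim
    · exact ⟨p, r, (soleDissenters_of_chains hq hP ⟨h, h1⟩ ⟨h4, h'⟩).imp_right Or.inr⟩
  have main' : ∀ p r, (q p).rel a b → (q r).rel b a → ((q p).rel b c ↔ (q r).rel c b) →
      ∃ u v, u ≠ v ∧ ((SoleDissenter q a b v ∧ SoleDissenter q b c u ∧ ∀ p, (q p).rel a c) ∨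
      (SoleDissenter q c b v ∧ SoleDissenter q b a u ∧ ∀ p, (q p).rel c a)) := by
    intro p r h1 h2 h3
    by_cases h : (q p).rel b c
    · exact (not_chain_reverse hq hP (a := a) (b := b) (c := c) ⟨h1, h⟩ ⟨h3.1 h, h2⟩).elim
    · exact main p r h1 (((q p).not_rel hbc.ne).1 h) h2
        (((q r).not_rel hbc.ne.symm).1 fun h' => h (h3.2 h'))
  obtain ⟨⟨p, hp⟩, r, hr⟩ := hab
  obtain ⟨⟨s, hs⟩, s', hs'⟩ := hbc
  have tot : ∀ x : P, (q x).rel b c ∨ (q x).rel c b := fun x => (q x).total b c ((q s).ne hs)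
  have tot' : ∀ x : P, (q x).rel a b ∨ (q x).rel b a := fun x => (q x).total a b ((q p).ne hp)
  have asy : ∀ x : P, ¬ ((q x).rel b c ∧ (q x).rel c b) := fun x h => (q x).asymm h.1 h.2
  by_cases h : (q p).rel b c ↔ (q r).rel c b
  · exact main' p r hp hr h
  have h1 := tot p; have h2 := tot r; have h3 := asy p; have h4 := asy r
  have h5 := asy s; have h6 := asy s'
  -- Here `p` and `r` disagree on `a, b` but agree on `b, c`. A position with the opposite view of
  -- `b, c` disagrees with one of them on `a, b` as well, and replaces the other one.
  by_cases hpc : (q p).rel b c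
  · rcases tot' s' with h' | h'
    · exact main' s' r h' hr (by tauto)
    · exact main' p s' hp h' (by tauto)
  · rcases tot' s with h' | h'
    · exact main' s r h' hr (by tauto)
    · exact main' p s hp h' (by tauto)

/-- The orientation of one conflict selects one of the two alternatives in
`Conflict.soleDissenters`; so the majority order continues in the same direction along a path of
conflicts. -/
theorem SoleDissenter.next {A P : Type u} [Fintype P] {q : P → Ranking A}
    (hq : ∀ t ∈ forbiddenThree, ¬ HasRestriction q t) (hP : 3 ≤ Fintype.card P) {a b c : A} {v : P}
    (h : SoleDissenter q a b v) (hbc : Conflict q b c) (hac : a ≠ c) :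
    ∃ u, u ≠ v ∧ SoleDissenter q b c u ∧ ∀ p, (q p).rel a c := by
  obtain ⟨u, v', huv, ⟨h1, h2, h3⟩ | ⟨h1, h2, h3⟩⟩ := (h.conflict hP).soleDissenters hq hP hbc hac
  · exact ⟨u, h.unique h1 ▸ huv, h2, h3⟩
  · exact (h.not_swap hP h2).elim

theorem SoleDissenter.prev {A P : Type u} [Fintype P] {q : P → Ranking A}
    (hq : ∀ t ∈ forbiddenThree, ¬ HasRestriction q t) (hP : 3 ≤ Fintype.card P) {a b c : A} {u : P}
    (h : SoleDissenter q b c u) (hab : Conflict q a b) (hac : a ≠ c) :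
    ∃ v, v ≠ u ∧ SoleDissenter q a b v ∧ ∀ p, (q p).rel a c := by
  obtain ⟨u', v, huv, ⟨h1, h2, h3⟩ | ⟨h1, h2, h3⟩⟩ := hab.soleDissenters hq hP (h.conflict hP) hac
  · exact ⟨v, h.unique h2 ▸ huv.symm, h1, h3⟩
  · exact (h.not_swap hP h1).elim

/-- If the outer dissenters differed, then `v`, `u`, `w` would be three positions with one adjacent
swap of `abcd` each, at the three different places. The four applicants guarantee a fourth position,
which has the order `abcd` itself, and these make up the four-applicant pattern. -/
theorem SoleDissenter.eq_of_path {A P : Type u} [Fintype A] [Fintype P]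
    (hcard : Fintype.card A = Fintype.card P) {q : P → Ranking A}
    (hq : ∀ t ∈ forbiddenThree, ¬ HasRestriction q t) (hq4 : ¬ HasRestriction q forbiddenFour)
    (hP : 3 ≤ Fintype.card P) {a b c d : A} {u v w : P} (hab : SoleDissenter q a b v)
    (hbc : SoleDissenter q b c u) (hcd : SoleDissenter q c d w) (hac : a ≠ c) (hbd : b ≠ d) :
    v = w := by
  classical
  by_contra hvw
  obtain ⟨u', hu', hbc', hac'⟩ := hab.next hq hP (hbc.conflict hP) hac
  obtain ⟨w', hw', hcd', hbd'⟩ := hbc.next hq hP (hcd.conflict hP) hbd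
  obtain rfl := hbc.unique hbc'
  obtain rfl := hcd.unique hcd'
  have hab' := (hab.conflict hP).ne
  have hbc'' := (hbc.conflict hP).ne
  have hcd'' := (hcd.conflict hP).ne
  -- The ends of the path cannot coincide: `v` ranks `a` above `c`, and also `c` above `d` since the
  -- dissenter there is `w ≠ v`.
  have had : a ≠ d := by
    rintro rfl
    exact (q v).asymm (hac' v) (hcd.2 v hvw)
  obtain ⟨x, hx⟩ : ∃ x, x ∉ ({v, u, w} : Finset P) := by
    apply exists_notMem_of_card_lt
    have h4 : ({a, b, c, d} : Finset A).card = 4 := by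
      rw [Finset.card_insert_of_notMem, Finset.card_insert_of_notMem, Finset.card_pair hcd''] <;>
        simp [*]
    have := Finset.card_le_univ ({a, b, c, d} : Finset A)
    have := Finset.card_le_three (a := v) (b := u) (c := w)
    omega
  simp only [Finset.mem_insert, Finset.mem_singleton, not_or] at hx
  obtain ⟨hxv, hxu, hxw⟩ := hx
  have key : ∀ p : P, ∀ x₀ x₁ x₂ x₃ : A, (q p).rel x₀ x₁ → (q p).rel x₁ x₂ → (q p).rel x₂ x₃ →
      ∀ r s : Fin 4, r < s → (q p).rel (![x₀, x₁, x₂, x₃] r) (![x₀, x₁, x₂, x₃] s) := by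
    intro p x₀ x₁ x₂ x₃ h1 h2 h3 r s hrs
    have h12 := (q p).trans _ _ _ h1 h2
    have h23 := (q p).trans _ _ _ h2 h3
    have h13 := (q p).trans _ _ _ h1 h23
    fin_cases r <;> fin_cases s
    all_goals first | assumption | exact absurd hrs (by decide)
  refine hq4 (hasRestriction_of_injective (e := ![a, b, c, d]) (f := ![x, w, u, v]) ?_ ?_ ?_)
  · intro i j h
    fin_cases i <;> fin_cases j <;> simp_all
  · intro i j h
    fin_cases i <;> fin_cases j <;> simp_all
  · intro i r s hrs
    have hword : ∀ p x₀ x₁ x₂ x₃, (q p).rel x₀ x₁ → (q p).rel x₁ x₂ → (q p).rel x₂ x₃ →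
        (∀ r, ![a, b, c, d] (forbiddenFour i r) = ![x₀, x₁, x₂, x₃] r) →
        (q p).rel (![a, b, c, d] (forbiddenFour i r)) (![a, b, c, d] (forbiddenFour i s)) := by
      intro p x₀ x₁ x₂ x₃ h1 h2 h3 h
      rw [h, h]
      exact key p x₀ x₁ x₂ x₃ h1 h2 h3 r s hrs
    fin_cases i
    · exact hword x a b c d (hab.2 x hxv) (hbc.2 x hxu) (hcd.2 x hxw)
        fun r => by fin_cases r <;> rfl
    · exact hword w a b d c (hab.2 w (Ne.symm hvw)) (hbd' w) hcd.1 fun r => by fin_cases r <;> rfl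
    · exact hword u a c b d (hac' u) hbc.1 (hbd' u) fun r => by fin_cases r <;> rfl
    · exact hword v b a c d hab.1 (hac' v) (hcd.2 v hvw) fun r => by fin_cases r <;> rfl

/-- `w` is the only position that disagrees with the others on `a` and `b`. -/
def Dissenter {A P : Type u} (q : P → Ranking A) (a b : A) (w : P) : Prop :=
  SoleDissenter q a b w ∨ SoleDissenter q b a w

namespace Dissenter

theorem symm {A P : Type u} {q : P → Ranking A} {a b : A} {w : P} (h : Dissenter q a b w) :
    Dissenter q b a w := Or.symm h

theorem conflict {A P : Type u} [Fintype P] {q : P → Ranking A} (hP : 3 ≤ Fintype.card P)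
    {a b : A} {w : P} (h : Dissenter q a b w) : Conflict q a b :=
  h.elim (fun h => h.conflict hP) fun h => (h.conflict hP).symm

theorem unique {A P : Type u} [Fintype P] {q : P → Ranking A} (hP : 3 ≤ Fintype.card P)
    {a b : A} {v w : P} (h : Dissenter q a b v) (h' : Dissenter q a b w) : v = w := by
  rcases h with h | h <;> rcases h' with h' | h'
  · exact h.unique h'
  · exact (h.not_swap hP h').elim
  · exact (h'.not_swap hP h).elim
  · exact h.unique h'

theorem next {A P : Type u} [Fintype P] {q : P → Ranking A}
    (hq : ∀ t ∈ forbiddenThree, ¬ HasRestriction q t) (hP : 3 ≤ Fintype.card P) {a b c : A} {v : P}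
    (h : Dissenter q a b v) (hbc : Conflict q b c) (hac : a ≠ c) :
    ∃ u, u ≠ v ∧ Dissenter q b c u := by
  rcases h with h | h
  · obtain ⟨u, hu, h', -⟩ := h.next hq hP hbc hac
    exact ⟨u, hu, Or.inl h'⟩
  · obtain ⟨u, hu, h', -⟩ := h.prev hq hP hbc.symm hac.symm
    exact ⟨u, hu, Or.inr h'⟩

theorem ne {A P : Type u} [Fintype P] {q : P → Ranking A}
    (hq : ∀ t ∈ forbiddenThree, ¬ HasRestriction q t) (hP : 3 ≤ Fintype.card P) {a b c : A}
    {u v : P} (h : Dissenter q a b v) (h' : Dissenter q b c u) (hac : a ≠ c) : u ≠ v := by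
  obtain ⟨u', hu', h''⟩ := h.next hq hP (h'.conflict hP) hac
  rwa [h'.unique hP h'']

/-- The orientation of the middle conflict fixes that of both neighbors, so the oriented version
applies to the path or to its reverse. -/
theorem eq_of_path {A P : Type u} [Fintype A] [Fintype P]
    (hcard : Fintype.card A = Fintype.card P) {q : P → Ranking A}
    (hq : ∀ t ∈ forbiddenThree, ¬ HasRestriction q t) (hq4 : ¬ HasRestriction q forbiddenFour)
    (hP : 3 ≤ Fintype.card P) {a b c d : A} {u v w : P} (hab : Dissenter q a b v)
    (hbc : Dissenter q b c u) (hcd : Dissenter q c d w) (hac : a ≠ c) (hbd : b ≠ d) : v = w := by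
  rcases hbc with hbc | hbc
  · obtain ⟨v', -, h1, -⟩ := hbc.prev hq hP (hab.conflict hP) hac
    obtain ⟨w', -, h2, -⟩ := hbc.next hq hP (hcd.conflict hP) hbd
    rw [hab.unique hP (Or.inl h1), hcd.unique hP (Or.inl h2)]
    exact h1.eq_of_path hcard hq hq4 hP hbc h2 hac hbd
  · obtain ⟨v', -, h1, -⟩ := hbc.next hq hP (hab.conflict hP).symm hac.symm
    obtain ⟨w', -, h2, -⟩ := hbc.prev hq hP (hcd.conflict hP).symm hbd.symm
    rw [hab.unique hP (Or.inr h1), hcd.unique hP (Or.inr h2)]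
    exact (h2.eq_of_path hcard hq hq4 hP hbc h1 hbd.symm hac.symm).symm

end Dissenter

/-- Of two conflict partners of `b`, the majority has one above `b` and one below. Continuing from
the upper one, a third partner would lie below `b`; continuing from the lower one, above `b`. -/
theorem Conflict.degree_le_two {A P : Type u} [Fintype P] {q : P → Ranking A}
    (hq : ∀ t ∈ forbiddenThree, ¬ HasRestriction q t) (hP : 3 ≤ Fintype.card P) {a b c d : A}
    (ha : Conflict q b a) (hc : Conflict q b c) (hd : Conflict q b d) (hac : a ≠ c) (hda : d ≠ a) :
    d = c := by
  by_contra hdc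
  have main : ∀ x y, x ≠ y → d ≠ x → d ≠ y → (∃ w, SoleDissenter q x b w) →
      (∃ w, SoleDissenter q b y w) → False := by
    rintro x y hxy hdx hdy ⟨w, hw⟩ ⟨w', hw'⟩
    obtain ⟨_, -, h, -⟩ := hw.next hq hP hd (Ne.symm hdx)
    obtain ⟨_, -, h', -⟩ := hw'.prev hq hP hd.symm hdy
    exact h.not_swap hP h'
  obtain ⟨u, v, -, ⟨h1, h2, -⟩ | ⟨h1, h2, -⟩⟩ := ha.symm.soleDissenters hq hP hc hac
  · exact main a c hac hda hdc ⟨_, h1⟩ ⟨_, h2⟩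
  · exact main c a hac.symm hdc hda ⟨_, h1⟩ ⟨_, h2⟩

/-- `a` is an interior applicant of a conflict path, at whose conflicts `u` and `v` dissent. -/
def TwoDissenters {A P : Type u} (q : P → Ranking A) (u v : P) (a : A) : Prop :=
  (∃ b, Dissenter q a b u) ∧ ∃ b, Dissenter q a b v

theorem TwoDissenters.dissenter {A P : Type u} [Fintype P] {q : P → Ranking A}
    (hq : ∀ t ∈ forbiddenThree, ¬ HasRestriction q t) (hP : 3 ≤ Fintype.card P) {u v : P}
    (huv : u ≠ v) {a b : A} (h : TwoDissenters q u v a) (hab : Conflict q a b) :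
    Dissenter q a b u ∨ Dissenter q a b v := by
  obtain ⟨⟨c, hc⟩, d, hd⟩ := h
  have hcd : c ≠ d := by rintro rfl; exact huv (hc.unique hP hd)
  by_cases hbc : b = c
  · exact Or.inl (hbc ▸ hc)
  · have := (hc.conflict hP).degree_le_two hq hP (hd.conflict hP) hab hcd hbc
    exact Or.inr (this ▸ hd)

theorem TwoDissenters.swap {A P : Type u} {q : P → Ranking A} {u v : P} {a : A}
    (h : TwoDissenters q u v a) : TwoDissenters q v u a := ⟨h.2, h.1⟩

/-- If `u` dissents on `ab`, let `d` be the partner of `a` at which `v` dissents. On the path `d, a,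
b, c` the outer dissenters agree, so `v` dissents on `bc` too. -/
theorem TwoDissenters.of_conflict {A P : Type u} [Fintype A] [Fintype P]
    (hcard : Fintype.card A = Fintype.card P) {q : P → Ranking A}
    (hq : ∀ t ∈ forbiddenThree, ¬ HasRestriction q t) (hq4 : ¬ HasRestriction q forbiddenFour)
    (hP : 3 ≤ Fintype.card P) {u v : P} (huv : u ≠ v) {a b c : A} (h : TwoDissenters q u v a)
    (hab : Conflict q a b) (hbc : Conflict q b c) (hac : a ≠ c) : TwoDissenters q u v b := by
  have main : ∀ u v : P, u ≠ v → TwoDissenters q u v a → Dissenter q a b u →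
      TwoDissenters q u v b := by
    rintro u v huv ⟨-, d, hd⟩ hab
    obtain ⟨w, -, hw⟩ := hab.next hq hP hbc hac
    have hdb : d ≠ b := by rintro rfl; exact huv (hab.unique hP hd)
    have := hd.symm.eq_of_path hcard hq hq4 hP hab hw hdb hac
    exact ⟨⟨a, hab.symm⟩, c, this ▸ hw⟩
  rcases h.dissenter hq hP huv hab with h' | h'
  · exact main u v huv h h'
  · exact (main v u huv.symm h.swap h').swap

/-- All dissenters of the conflicts in a component that has an interior applicant are the two
dissenters at that applicant. -/
theorem TwoDissenters.dissenter_of_reflTransGen {A P : Type u} [Fintype A] [Fintype P]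
    (hcard : Fintype.card A = Fintype.card P) {q : P → Ranking A}
    (hq : ∀ t ∈ forbiddenThree, ¬ HasRestriction q t) (hq4 : ¬ HasRestriction q forbiddenFour)
    (hP : 3 ≤ Fintype.card P) {u v : P} (huv : u ≠ v) {a b c : A} (h : TwoDissenters q u v a)
    (hab : Relation.ReflTransGen (Conflict q) a b) (hbc : Conflict q b c) :
    Dissenter q b c u ∨ Dissenter q b c v := by
  -- Invariant along the path: the applicant reached is interior with the same two dissenters, or is
  -- an end of the path whose only partner is interior.
  have key : TwoDissenters q u v b ∨ ((∃ z, Conflict q b z ∧ TwoDissenters q u v z) ∧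
      ∀ y y', Conflict q b y → Conflict q b y' → y = y') := by
    clear hbc
    induction hab with
    | refl => exact Or.inl h
    | @tail z w _ hzw ih =>
      rcases ih with ih | ⟨⟨y, hy, ih⟩, hz⟩
      · by_cases hw : ∀ y y', Conflict q w y → Conflict q w y' → y = y'
        · exact Or.inr ⟨⟨z, hzw.symm, ih⟩, hw⟩
        · push Not at hw
          obtain ⟨y, y', hy, hy', hne⟩ := hw
          left
          by_cases hzy : z = y
          · exact ih.of_conflict hcard hq hq4 hP huv hzw hy' fun e => hne (hzy ▸ e)
          · exact ih.of_conflict hcard hq hq4 hP huv hzw hy hzy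
      · rw [hz w y hzw hy]
        exact Or.inl ih
  rcases key with h | ⟨⟨z, hz, h⟩, hb⟩
  · exact h.dissenter hq hP huv hbc
  · rw [hb c z hbc hz]
    exact (h.dissenter hq hP huv hz.symm).imp Dissenter.symm Dissenter.symm

/-! ### Listing the applicants of a conflict component. -/

/-- The linear order given by a ranking, with the applicants ranked highest least. -/
noncomputable abbrev Ranking.linearOrder {α : Type u} (r : Ranking α) : LinearOrder α :=
  open Classical in
  { le := fun x y => x = y ∨ r.rel x y
    lt := r.rel
    le_refl := fun _ => Or.inl rfl
    le_trans := by
      rintro x y z (rfl | h) (rfl | h')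
      · exact Or.inl rfl
      · exact Or.inr h'
      · exact Or.inr h
      · exact Or.inr (r.trans _ _ _ h h')
    le_antisymm := by
      rintro x y (rfl | h) (h' | h')
      · rfl
      · rfl
      · exact h'.symm
      · exact absurd h' (r.asymm h)
    le_total := fun x y => by
      by_cases h : x = y
      · exact Or.inl (Or.inl h)
      · exact (r.total x y h).imp Or.inr Or.inr
    lt_iff_le_not_ge := fun x y => by
      refine ⟨fun h => ⟨Or.inr h, ?_⟩, ?_⟩
      · rintro (rfl | h')
        · exact r.irrefl _ h
        · exact r.asymm h h'
      · rintro ⟨rfl | h, h'⟩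
        · exact absurd (Or.inl rfl) h'
        · exact h
    toDecidableLE := Classical.decRel _ }

/-- Finitely many elements can be listed from the highest to the lowest ranked. -/
theorem Ranking.exists_listing {α : Type u} (r : Ranking α) {S : Set α} (hS : S.Finite) :
    ∃ l : Fin S.ncard → α, Set.range l = S ∧ ∀ i j, i < j ↔ r.rel (l i) (l j) := by
  let := r.linearOrder
  refine ⟨hS.toFinset.orderEmbOfFin (Set.ncard_eq_toFinset_card S hS).symm, ?_, fun i j => ?_⟩
  · rw [Finset.range_orderEmbOfFin, hS.coe_toFinset]
  · exact (hS.toFinset.orderEmbOfFin (Set.ncard_eq_toFinset_card S hS).symm).lt_iff_lt.symm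

theorem flipLt_iff_of_lt {s : ℕ → Prop} {i j : ℕ} (h : i < j) :
    (FlipLt s i j ↔ ¬ (s i ∧ j = i + 1)) ∧ (FlipLt s j i ↔ s i ∧ j = i + 1) := by
  unfold FlipLt
  constructor
  · constructor
    · rintro (h' | h')
      · exact h'.2
      · omega
    · exact fun h' => Or.inl ⟨h, h'⟩
  · constructor
    · rintro (h' | h')
      · omega
      · exact h'
    · exact fun h' => Or.inr h'

theorem flipLt_irrefl (s : ℕ → Prop) (i : ℕ) : ¬ FlipLt s i i := by
  unfold FlipLt
  omega

theorem Ranking.rel_iff_flipLt {α : Type u} (r : Ranking α) {s : ℕ → Prop} {k : ℕ} {l : Fin k → α}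
    (h : ∀ i j : Fin k, i < j → ¬ (s i ∧ (j : ℕ) = i + 1) → r.rel (l i) (l j))
    (h' : ∀ i j : Fin k, s i → (j : ℕ) = i + 1 → r.rel (l j) (l i)) (i j : Fin k) :
    r.rel (l i) (l j) ↔ FlipLt s i j := by
  rcases lt_trichotomy i j with hij | rfl | hij
  · rw [(flipLt_iff_of_lt hij).1]
    by_cases hs : s i ∧ (j : ℕ) = i + 1
    · simp only [hs, and_self, not_true_eq_false, iff_false]
      exact r.asymm (h' i j hs.1 hs.2)
    · simp only [hs, not_false_iff, iff_true]
      exact h i j hij hs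
  · simp [r.irrefl, flipLt_irrefl]
  · rw [(flipLt_iff_of_lt hij).2]
    by_cases hs : s j ∧ (i : ℕ) = j + 1
    · simp only [hs, and_self, iff_true]
      exact h' j i hs.1 hs.2
    · simp only [hs, iff_false]
      exact r.asymm (h j i hij hs)

theorem reflTransGen_conflict_symm {A P : Type u} {q : P → Ranking A} {a b : A}
    (h : Relation.ReflTransGen (Conflict q) a b) : Relation.ReflTransGen (Conflict q) b a := by
  induction h with
  | refl => exact .refl
  | tail _ h ih => exact .head h.symm ih

/-- If nobody in the component had two partners, it would consist of `c` and at most one partner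
`d`. -/
theorem exists_two_conflicts {A P : Type u} [Finite A] {q : P → Ranking A} {c : A}
    (h3 : 3 ≤ {a | Relation.ReflTransGen (Conflict q) c a}.ncard) :
    ∃ a b d, Relation.ReflTransGen (Conflict q) c a ∧ Conflict q a b ∧ Conflict q a d ∧ b ≠ d := by
  by_contra! hno
  obtain ⟨y, hy, hyc⟩ : ∃ y, Relation.ReflTransGen (Conflict q) c y ∧ y ≠ c := by
    by_contra! hall
    have : {a | Relation.ReflTransGen (Conflict q) c a} ⊆ {c} := hall
    have := Set.ncard_le_ncard this
    rw [Set.ncard_singleton] at this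
    omega
  obtain ⟨d, hd, -⟩ := (Relation.ReflTransGen.cases_head hy).resolve_left (Ne.symm hyc)
  have : {a | Relation.ReflTransGen (Conflict q) c a} ⊆ {c, d} := by
    intro a ha
    induction ha with
    | refl => simp
    | @tail z w hz hzw ih =>
      rcases ih with rfl | rfl
      · exact Or.inr (hno _ _ _ hz hzw hd)
      · exact Or.inl (hno _ _ _ hz hzw hd.symm)
  have := Set.ncard_le_ncard this
  have : ({c, d} : Set A).ncard ≤ 2 := (Set.ncard_insert_le c {d}).trans (by simp)
  omega

/-- An interior applicant supplies the two dissenters `u` and `v` of the whole component. A third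
position `x` never dissents, so its order serves as the labeling. Conflicts occur only between
neighbors in this order, connectedness makes all neighbors conflict, and dissenters alternate since
conflicts at a common applicant have different ones. -/
theorem twoAdjacentAlternating_component {A P : Type u} [Fintype A] [Fintype P]
    (hcard : Fintype.card A = Fintype.card P) {q : P → Ranking A}
    (hq : ∀ t ∈ forbiddenThree, ¬ HasRestriction q t) (hq4 : ¬ HasRestriction q forbiddenFour)
    {c : A} (h3 : 3 ≤ {a | Relation.ReflTransGen (Conflict q) c a}.ncard) :
    TwoAdjacentAlternating q {a | Relation.ReflTransGen (Conflict q) c a} Set.univ := by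
  have hP : 3 ≤ Fintype.card P := by
    rw [← hcard, ← Nat.card_eq_fintype_card, ← Set.ncard_univ]
    exact h3.trans (Set.ncard_le_ncard (Set.subset_univ _))
  have hsymm : ∀ {a b}, Relation.ReflTransGen (Conflict q) a b →
      Relation.ReflTransGen (Conflict q) b a :=
    reflTransGen_conflict_symm
  set S : Set A := {a | Relation.ReflTransGen (Conflict q) c a} with hS
  -- the two dissenters
  obtain ⟨u, v, huv, hdis⟩ : ∃ u v, u ≠ v ∧ ∀ a ∈ S, ∀ b, Conflict q a b →
      Dissenter q a b u ∨ Dissenter q a b v := by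
    obtain ⟨z, x, y, hz, hx, hy, hxy⟩ := exists_two_conflicts h3
    obtain ⟨u, v, huv, ⟨h1, h2, -⟩ | ⟨h1, h2, -⟩⟩ := hx.symm.soleDissenters hq hP hy hxy
    · exact ⟨u, v, huv, fun a ha b hab => TwoDissenters.dissenter_of_reflTransGen hcard hq hq4 hP
        huv (a := z) ⟨⟨y, Or.inl h2⟩, x, Or.inr h1⟩ ((hsymm hz).trans ha) hab⟩
    · exact ⟨u, v, huv, fun a ha b hab => TwoDissenters.dissenter_of_reflTransGen hcard hq hq4 hP
        huv (a := z) ⟨⟨x, Or.inl h2⟩, y, Or.inr h1⟩ ((hsymm hz).trans ha) hab⟩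
  obtain ⟨x, hxu, hxv⟩ := exists_ne_ne hP u v
  have hsole : ∀ a ∈ S, ∀ b, (q x).rel a b → Conflict q a b →
      SoleDissenter q a b u ∨ SoleDissenter q a b v := by
    intro a ha b hx hab
    rcases hdis a ha b hab with (h | h) | (h | h)
    · exact Or.inl h
    · exact absurd hx ((q x).asymm (h.2 x hxu))
    · exact Or.inr h
    · exact absurd hx ((q x).asymm (h.2 x hxv))
  -- conflicts are between applicants that are adjacent in the priority list of `x`
  have hbetween : ∀ a ∈ S, ∀ m b, (q x).rel a m → (q x).rel m b → ¬ Conflict q a b := by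
    intro a ha m b ham hmb hab
    -- If `w` reverses `a` and `b` while `m` lies between them for `x`, then by transitivity `w`
    -- also reverses `a, m` or `m, b`. It would then be the dissenter of two conflicts with a common
    -- applicant.
    have main : ∀ w, SoleDissenter q a b w → False := by
      intro w hw
      have hb : b ∈ S := Relation.ReflTransGen.tail ha hab
      have hw' : ∀ y ∈ S, ∀ z, (q x).rel y z → (q w).rel z y → SoleDissenter q y z w := by
        intro y hy z hyz hzy
        rcases hsole y hy z hyz ⟨⟨x, hyz⟩, w, hzy⟩ with h | h
        all_goals
          refine (?_ : _ = w) ▸ h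
          by_contra hne
          exact (q w).asymm hzy (h.2 w (Ne.symm hne))
      rcases (q w).total a m ((q x).ne ham) with h1 | h1
      · rcases (q w).total m b ((q x).ne hmb) with h2 | h2
        · exact (q w).asymm hw.1 ((q w).trans _ _ _ h1 h2)
        · have hm : m ∈ S := Relation.ReflTransGen.tail hb ⟨⟨w, h2⟩, x, hmb⟩
          have hd : Dissenter q a b w := Or.inl hw
          exact hd.ne hq hP (Or.inr (hw' m hm b hmb h2)) ((q x).ne ham) rfl
      · have hd : Dissenter q b a w := Or.inr hw
        exact hd.ne hq hP (Or.inl (hw' a ha m ham h1)) ((q x).ne hmb).symm rfl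
    rcases hsole a ha b ((q x).trans _ _ _ ham hmb) hab with h | h
    · exact main u h
    · exact main v h
  obtain ⟨l, hlS, hlt⟩ := (q x).exists_listing S.toFinite
  have hmem : ∀ i, l i ∈ S := fun i => hlS ▸ Set.mem_range_self i
  have hinj : Function.Injective l := by
    intro i j hij
    rcases lt_trichotomy i j with h | h | h
    · exact absurd hij ((q x).ne ((hlt _ _).1 h))
    · exact h
    · exact absurd hij.symm ((q x).ne ((hlt _ _).1 h))
  have hcons : ∀ i j : Fin S.ncard, (j : ℕ) = i + 1 → Conflict q (l i) (l j) := by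
    intro i j hij
    by_contra hno
    -- Without a conflict between the labels `i` and `i + 1`, no conflict path could cross from the
    -- labels up to `i` to later ones, as conflicts never skip a label.
    have hdown : ∀ z, Relation.ReflTransGen (Conflict q) (l i) z → ∃ k ≤ i, z = l k := by
      intro z hz
      induction hz with
      | refl => exact ⟨i, le_rfl, rfl⟩
      | @tail z w hz hzw ih =>
        obtain ⟨k, hk, rfl⟩ := ih
        have hw : w ∈ S := Relation.ReflTransGen.tail (hmem k) hzw
        rw [← hlS] at hw
        obtain ⟨k', rfl⟩ := hw
        by_contra! hk'
        have hik' : i < k' := lt_of_not_ge fun h => hk' k' h rfl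
        rcases hk.lt_or_eq with hki | rfl
        · exact hbetween _ (hmem k) (l i) _ ((hlt _ _).1 hki) ((hlt _ _).1 hik') hzw
        · have hjk' : j ≤ k' := by rw [Fin.le_def]; rw [Fin.lt_def] at hik'; omega
          rcases hjk'.lt_or_eq with hjk' | rfl
          · exact hbetween _ (hmem k) (l j) _
              ((hlt _ _).1 (by rw [Fin.lt_def]; omega)) ((hlt _ _).1 hjk') hzw
          · exact hno hzw
    obtain ⟨k, hk, hjk⟩ := hdown (l j) ((hsymm (hmem i)).trans (hmem j))
    have := hinj hjk
    subst this
    rw [Fin.le_def] at hk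
    omega
  -- The dissenter of the first pair is named `v'`, to match the convention that `v` swaps at even
  -- indices.
  obtain ⟨u', v', huv', hdis', h0⟩ : ∃ u' v', u' ≠ v' ∧
      (∀ i j, i < j → Conflict q (l i) (l j) →
        SoleDissenter q (l i) (l j) u' ∨ SoleDissenter q (l i) (l j) v') ∧
      SoleDissenter q (l ⟨0, by omega⟩) (l ⟨1, by omega⟩) v' := by
    have h : ∀ i j, i < j → Conflict q (l i) (l j) →
        SoleDissenter q (l i) (l j) u ∨ SoleDissenter q (l i) (l j) v := fun i j hij hc =>
      hsole _ (hmem i) _ ((hlt _ _).1 hij) hc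
    rcases h ⟨0, by omega⟩ ⟨1, by omega⟩ (by simp [Fin.lt_def]) (hcons _ _ rfl) with h0 | h0
    · exact ⟨v, u, huv.symm, fun i j hij hc => (h i j hij hc).symm, h0⟩
    · exact ⟨u, v, huv, h, h0⟩
  have halt : ∀ n (hn : n + 1 < S.ncard),
      (Even n → SoleDissenter q (l ⟨n, by omega⟩) (l ⟨n + 1, hn⟩) v') ∧
      (Odd n → SoleDissenter q (l ⟨n, by omega⟩) (l ⟨n + 1, hn⟩) u') := by
    intro n
    induction n with
    | zero => exact fun _ => ⟨fun _ => h0, fun h => absurd h (by decide)⟩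
    | succ n ih =>
      intro hn
      obtain ⟨ih1, ih2⟩ := ih (by omega)
      have hne : l ⟨n, by omega⟩ ≠ l ⟨n + 1 + 1, hn⟩ := fun h => by
        have := Fin.val_eq_of_eq (hinj h)
        simp only at this
        omega
      have hc := hcons ⟨n + 1, by omega⟩ ⟨n + 1 + 1, hn⟩ rfl
      rw [Nat.even_add_one, Nat.odd_add_one, Nat.not_even_iff_odd, Nat.not_odd_iff_even]
      have hd := hdis' _ _ (by simp [Fin.lt_def]) hc
      refine ⟨fun h => hd.resolve_left fun h' => ?_, fun h => hd.resolve_right fun h' => ?_⟩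
      · obtain ⟨w, hw, h'', -⟩ := (ih2 h).next hq hP hc hne
        exact hw (h''.unique h')
      · obtain ⟨w, hw, h'', -⟩ := (ih1 h).next hq hP hc hne
        exact hw (h''.unique h')
  have hpos : ∀ p, ∀ i j : Fin S.ncard, i < j → (q p).rel (l i) (l j) ∨
      (j : ℕ) = i + 1 ∧ (Even (i : ℕ) ∧ p = v' ∨ Odd (i : ℕ) ∧ p = u') := by
    intro p i j hij
    by_cases hc : Conflict q (l i) (l j)
    · have hj : (j : ℕ) = i + 1 := by
        by_contra hne
        have hi : (i : ℕ) + 1 < j := by rw [Fin.lt_def] at hij; omega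
        exact hbetween _ (hmem i) (l ⟨i + 1, by omega⟩) _ ((hlt _ _).1 (by simp [Fin.lt_def]))
          ((hlt _ _).1 (by simpa [Fin.lt_def] using hi)) hc
      obtain ⟨h1, h2⟩ := halt i (hj ▸ j.2)
      have hj' : (⟨i + 1, hj ▸ j.2⟩ : Fin S.ncard) = j := Fin.ext hj.symm
      rw [hj'] at h1 h2
      rcases Nat.even_or_odd (i : ℕ) with he | ho
      · by_cases hp : p = v'
        · exact Or.inr ⟨hj, Or.inl ⟨he, hp⟩⟩
        · exact Or.inl ((h1 he).2 p hp)
      · by_cases hp : p = u'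
        · exact Or.inr ⟨hj, Or.inr ⟨ho, hp⟩⟩
        · exact Or.inl ((h2 ho).2 p hp)
    · exact Or.inl (forall_rel_of_not_conflict hc ((hlt _ _).1 hij) p)
  have hflip : ∀ i j : Fin S.ncard, (j : ℕ) = i + 1 →
      (Even (i : ℕ) → (q v').rel (l j) (l i)) ∧ (Odd (i : ℕ) → (q u').rel (l j) (l i)) := by
    intro i j hj
    obtain ⟨j, hjk⟩ := j
    dsimp only at hj
    subst hj
    exact ⟨fun h => ((halt i _).1 h).1, fun h => ((halt i _).2 h).1⟩
  refine ⟨by rwa [Set.ncard_univ, Nat.card_eq_fintype_card], S.ncard, h3, l, hinj, hlS, u', v',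
    Set.mem_univ _, Set.mem_univ _, huv', ?_, ?_, ?_⟩
  · refine Ranking.rel_iff_flipLt _ (fun i j hij h => ?_) fun i j hi hj => (hflip i j hj).2 hi
    rcases hpos u' i j hij with h' | ⟨hj, ⟨-, h'⟩ | ⟨ho, -⟩⟩
    · exact h'
    · exact absurd h' huv'
    · exact absurd ⟨ho, hj⟩ h
  · refine Ranking.rel_iff_flipLt _ (fun i j hij h => ?_) fun i j hi hj => (hflip i j hj).1 hi
    rcases hpos v' i j hij with h' | ⟨hj, ⟨he, -⟩ | ⟨-, h'⟩⟩
    · exact h'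
    · exact absurd ⟨he, hj⟩ h
    · exact absurd h'.symm huv'
  · rintro p - hpu hpv i j
    have hp : ∀ i j, i < j → (q p).rel (l i) (l j) := fun i j hij =>
      (hpos p i j hij).resolve_right fun h => h.2.elim (fun h => hpv h.2) fun h => hpu h.2
    refine ⟨fun h => ?_, hp i j⟩
    rcases lt_trichotomy i j with hij | rfl | hij
    · exact hij
    · exact absurd h ((q p).irrefl _)
    · exact absurd h ((q p).asymm (hp _ _ hij))

/-- Unanimity spreads along conflicts: if all rank `a` above `y`, and some position ranks `y` above
`z`, then that position ranks `a` above `z`, and so do all, as `a` and `z` are in different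
components. The same works on the other side. -/
theorem forall_rel_of_not_reflTransGen {A P : Type u} {q : P → Ranking A} {a a' b b' : A}
    (hab : ¬ Relation.ReflTransGen (Conflict q) a b) {p : P} (hp : (q p).rel a b)
    (ha : Relation.ReflTransGen (Conflict q) a a') (hb : Relation.ReflTransGen (Conflict q) b b')
    (r : P) : (q r).rel a' b' := by
  have hsymm : ∀ {a b}, Relation.ReflTransGen (Conflict q) a b →
      Relation.ReflTransGen (Conflict q) b a :=
    reflTransGen_conflict_symm
  have hno : ∀ {x y}, Relation.ReflTransGen (Conflict q) a x →
      Relation.ReflTransGen (Conflict q) b y → ¬ Conflict q x y := fun hx hy h =>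
    hab ((hx.tail h).trans (hsymm hy))
  have h1 : ∀ r, (q r).rel a b' := by
    induction hb with
    | refl => exact forall_rel_of_not_conflict (hno .refl .refl) hp
    | @tail y z hy hyz ih =>
      obtain ⟨s, hs⟩ := hyz.1
      exact forall_rel_of_not_conflict (hno .refl (hy.tail hyz)) ((q s).trans _ _ _ (ih s) hs)
  induction ha generalizing r with
  | refl => exact h1 r
  | @tail y z hy hyz ih =>
    obtain ⟨s, hs⟩ := hyz.2
    exact forall_rel_of_not_conflict (hno (hy.tail hyz) hb) ((q s).trans _ _ _ hs (ih s)) r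

/-- The blocks are the conflict components. An arbitrary position `x` orders them through their
highest-ranked members, which serve as canonical representatives; any other position orders them in
the same way. -/
theorem LimitedCyclic.of_not_hasRestriction {A P : Type u} [Fintype A] [Fintype P]
    (hcard : Fintype.card A = Fintype.card P) {q : P → Ranking A}
    (hq : ∀ t ∈ forbiddenThree, ¬ HasRestriction q t) (hq4 : ¬ HasRestriction q forbiddenFour) :
    LimitedCyclic q := by
  rcases isEmpty_or_nonempty A with hA | hA
  · exact ⟨0, isEmptyElim, fun i => i.elim0, fun a => isEmptyElim a, fun i => i.elim0⟩
  obtain ⟨x⟩ : Nonempty P := by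
    rw [← Fintype.card_pos_iff, ← hcard, Fintype.card_pos_iff]
    exact hA
  have hsymm : ∀ {a b}, Relation.ReflTransGen (Conflict q) a b →
      Relation.ReflTransGen (Conflict q) b a :=
    reflTransGen_conflict_symm
  let rep : A → A := fun a =>
    (q x).fav {b | Relation.ReflTransGen (Conflict q) a b} ⟨a, .refl⟩
  have hrep : ∀ a, Relation.ReflTransGen (Conflict q) a (rep a) := fun a => (q x).fav_mem _ _
  have hrep' : ∀ a b, rep a = rep b ↔ Relation.ReflTransGen (Conflict q) a b := by
    refine fun a b => ⟨fun h => ?_, fun h => ?_⟩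
    · exact ((hrep a).trans (h ▸ .refl)).trans (hsymm (hrep b))
    · have : {c | Relation.ReflTransGen (Conflict q) a c} =
          {c | Relation.ReflTransGen (Conflict q) b c} :=
        Set.ext fun c => ⟨fun hc => (hsymm h).trans hc, fun hc => h.trans hc⟩
      simp only [rep, this]
  let := (q x).linearOrder
  let F : Finset A := Finset.univ.image rep
  let e : Fin F.card ≃o F := F.orderIsoOfFin rfl
  let s : A → Fin F.card := fun a => e.symm ⟨rep a, Finset.mem_image_of_mem _ (Finset.mem_univ a)⟩
  have hs : ∀ a b, s a = s b ↔ Relation.ReflTransGen (Conflict q) a b := fun a b => by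
    rw [← hrep']
    simp [s]
  refine ⟨F.card, s, fun i => ?_, fun a b hab r => ?_, fun i hi => ?_⟩
  · obtain ⟨a, -, ha⟩ := Finset.mem_image.1 (e i).2
    exact ⟨a, by simp [s, ha]⟩
  · have h1 : (q x).rel (rep a) (rep b) := by
      have := e.symm.lt_iff_lt.1 hab
      exact this
    refine forall_rel_of_not_reflTransGen (fun h => ?_) h1 (hsymm (hrep a)) (hsymm (hrep b)) r
    exact hab.ne ((hs a b).2 (((hrep a).trans h).trans (hsymm (hrep b))))
  · obtain ⟨c, hc⟩ : {a | s a = i}.Nonempty := Set.nonempty_of_ncard_ne_zero (by omega)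
    have : {a | s a = i} = {a | Relation.ReflTransGen (Conflict q) c a} :=
      Set.ext fun a => by
        obtain rfl : s c = i := hc
        exact eq_comm.trans (hs c a)
    rw [this] at hi ⊢
    exact twoAdjacentAlternating_component hcard hq hq4 hi

/-! ### Compositions of 2Tr and 3Lu are OSP -/

namespace GameTree

variable {N : Type u} {T : N → Type u} {Y Y' : Type u}

/-- The labels of the leaves that agent `i` of type `t` may reach by truthful play. -/
def consistent : GameTree N T Y → (i : N) → T i → Set Y
  | leaf y, _, _ => {y}
  | node j _ ask next, i, t =>
      {y | ∃ c, (∀ h : i = j, ask (h ▸ t) = c) ∧ y ∈ consistent (next c) i t}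

theorem consistent_subset_outcomes (G : GameTree N T Y) (i : N) (t : T i) :
    G.consistent i t ⊆ G.outcomes := by
  induction G with
  | leaf y => exact subset_rfl
  | node j ι ask next ih =>
    rintro y ⟨c, -, hy⟩
    exact ⟨c, ih c hy⟩

theorem HasLeaf.subset {G : GameTree N T Y} {S L : ∀ i, Set (T i)} {y : Y} (h : HasLeaf G S L y)
    (i : N) : L i ⊆ S i := by
  classical
  induction h with
  | leaf y S => exact subset_rfl
  | node j ι ask next S L y c h ih =>
    refine ih.trans ?_
    unfold succSets
    by_cases hij : i = j
    · subst hij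
      simp
    · simp [Function.update_of_ne hij]

theorem HasLeaf.mem_consistent {G : GameTree N T Y} {S L : ∀ i, Set (T i)} {y : Y}
    (h : HasLeaf G S L y) {i : N} {t : T i} (ht : t ∈ L i) : y ∈ G.consistent i t := by
  classical
  induction h with
  | leaf y S => rfl
  | node j ι ask next S L y c h ih =>
    refine ⟨c, ?_, ih ht⟩
    rintro rfl
    have := h.subset i ht
    simp only [succSets, Function.update_self] at this
    exact this.2

theorem mem_outcomes_bind (G : GameTree N T Y) (k : Y → GameTree N T Y') (y : Y') :
    y ∈ (G.bind k).outcomes ↔ ∃ x ∈ G.outcomes, y ∈ (k x).outcomes := by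
  induction G with
  | leaf x => exact ⟨fun h => ⟨x, rfl, h⟩, fun ⟨_, hx, h⟩ => (show _ = x from hx) ▸ h⟩
  | node j ι ask next ih =>
    constructor
    · rintro ⟨c, hc⟩
      obtain ⟨x, hx, h⟩ := (ih c).1 hc
      exact ⟨x, ⟨c, hx⟩, h⟩
    · rintro ⟨x, ⟨c, hx⟩, h⟩
      exact ⟨c, (ih c).2 ⟨x, hx, h⟩⟩

theorem exists_of_mem_consistent_bind {G : GameTree N T Y} {k : Y → GameTree N T Y'} {i : N}
    {t : T i} {y : Y'} (h : y ∈ (G.bind k).consistent i t) :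
    ∃ x ∈ G.consistent i t, y ∈ (k x).consistent i t := by
  induction G with
  | leaf x => exact ⟨x, rfl, h⟩
  | node j ι ask next ih =>
    obtain ⟨c, hc, h⟩ := h
    obtain ⟨x, hx, h⟩ := ih c h
    exact ⟨x, ⟨c, hc, hx⟩, h⟩

theorem play_bind (G : GameTree N T Y) (k : Y → GameTree N T Y') (t : ∀ i, T i) :
    (G.bind k).play t = (k (G.play t)).play t := by
  induction G with
  | leaf x => rfl
  | node j ι ask next ih => exact ih (ask (t j))

end GameTree

/-! ### Obvious truthfulness without type-sets. -/

/-- A condition that implies that a mechanism is OSP from any type-sets at the root: whenever an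
agent acts, every outcome consistent with truthful play is weakly preferred to every outcome after
a deviation. -/
def ObviouslyTruthful {N : Type u} (E : OrdinalEnv N) : GameTree N E.Ty E.Outcome → Prop
  | .leaf _ => True
  | @GameTree.node _ _ _ i _ _ ask next =>
      (∀ t, ∀ y ∈ (next (ask t)).consistent i t, ∀ c, c ≠ ask t → ∀ y' ∈ (next c).outcomes,
        E.pref i t y y') ∧ ∀ c, ObviouslyTruthful E (next c)

theorem ObviouslyTruthful.isOSPFrom {N : Type u} {E : OrdinalEnv N}
    {G : GameTree N E.Ty E.Outcome} (hG : ObviouslyTruthful E G) (S : ∀ i, Set (E.Ty i)) :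
    IsOSPFrom E G S := by
  induction G generalizing S with
  | leaf y => trivial
  | node i ι ask next ih =>
    refine ⟨fun t _ L y hL ht c hc y' hy' => ?_, fun c => ih c (hG.2 c) _⟩
    obtain ⟨c', hc', hy⟩ := hL.mem_consistent ht
    obtain rfl := hc' rfl
    exact hG.1 t y hy c hc y' hy'

/-- The analogue of `ObviouslyTruthful` for submechanisms: whenever an applicant acts, their match
is determined at all leaves below. -/
def ObviouslyTruthfulSub {A P : Type u} : SubMech A P → Prop
  | .leaf _ => True
  | @GameTree.node _ _ _ a _ _ ask next =>
      (∀ t, ∀ M ∈ (next (ask t)).consistent a t, ∀ c, c ≠ ask t → ∀ M' ∈ (next c).outcomes,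
        ∃ p p', (a, p) ∈ M ∧ (a, p') ∈ M' ∧ (p = p' ∨ t.rel p p')) ∧
      ∀ c, ObviouslyTruthfulSub (next c)

/-- Whoever acts in a submechanism is matched by its end, and continuations never revise matches. So
all comparisons at its nodes carry over to final outcomes. -/
theorem ObviouslyTruthfulSub.bind {A P : Type u} {G : SubMech A P} (hG : ObviouslyTruthfulSub G)
    {cont : List (A × P) → GameTree A (matchingEnv A P).Ty (matchingEnv A P).Outcome}
    (hcont : ∀ M ∈ G.outcomes, ObviouslyTruthful (matchingEnv A P) (cont M) ∧
      ∀ μ : A ≃ P, μ ∈ (cont M).outcomes → ∀ a p, (a, p) ∈ M → μ a = p) :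
    ObviouslyTruthful (matchingEnv A P) (G.bind cont) := by
  induction G with
  | leaf M => exact (hcont M rfl).1
  | node a ι ask next ih =>
    refine ⟨fun t y hy c hc y' hy' => ?_, fun c => ih c (hG.2 c) fun M hM => hcont M ⟨c, hM⟩⟩
    obtain ⟨M, hM, hyM⟩ := GameTree.exists_of_mem_consistent_bind hy
    obtain ⟨M', hM', hyM'⟩ := (GameTree.mem_outcomes_bind _ _ _).1 hy'
    obtain ⟨p, p', hp, hp', h⟩ := hG.1 t M hM c hc M' hM'
    have h1 := (hcont M ⟨_, GameTree.consistent_subset_outcomes _ _ _ hM⟩).2 y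
      (GameTree.consistent_subset_outcomes _ _ _ hyM) a p hp
    have h2 := (hcont M' ⟨_, hM'⟩).2 y' hyM' a p' hp'
    subst h1 h2
    exact h

/-- `p` is the favorite position of `t` in `R`. -/
def Ranking.IsTop {P : Type u} (t : Ranking P) (R : Set P) (p : P) : Prop :=
  p ∈ R ∧ ∀ p' ∈ R, p' ≠ p → t.rel p p'

theorem Ranking.fav_isTop {P : Type u} [Finite P] (t : Ranking P) (R : Set P) (hR : R.Nonempty) :
    t.IsTop R (t.fav R hR) := Classical.choose_spec (t.exists_top R hR)

theorem Ranking.IsTop.eq_or_rel {P : Type u} {t : Ranking P} {R : Set P} {p p' : P}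
    (h : t.IsTop R p) (hp' : p' ∈ R) : p = p' ∨ t.rel p p' := by
  by_cases hne : p' = p
  · exact Or.inl hne.symm
  · exact Or.inr (h.2 p' hp' hne)

/-! ### Nodes at which an applicant clinches or passes. -/

section Clinch

variable {A P : Type u} [Finite P] {a i : A} {R C D : Set P} {next : P → SubMech A P}
  {pass : SubMech A P} {M : List (A × P)} {t : Ranking P}

theorem exists_of_mem_outcomes_clinch (hR : R.Nonempty) (h : M ∈ (clinch a R next).outcomes) :
    ∃ p ∈ R, M ∈ (next p).outcomes := by
  unfold clinch at h
  rw [dif_pos hR] at h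
  obtain ⟨p, hp⟩ := h
  exact ⟨p, p.2, hp⟩

theorem exists_of_mem_consistent_clinch (hR : R.Nonempty)
    (h : M ∈ (clinch a R next).consistent i t) :
    ∃ p ∈ R, (i = a → t.IsTop R p) ∧ M ∈ (next p).consistent i t := by
  unfold clinch at h
  rw [dif_pos hR] at h
  obtain ⟨p, hp, h⟩ := h
  refine ⟨p, p.2, ?_, h⟩
  rintro rfl
  rw [← hp rfl]
  exact t.fav_isTop R hR

theorem exists_play_clinch (a : A) (next : P → SubMech A P) (hR : R.Nonempty) (t : A → Ranking P) :
    ∃ p, (t a).IsTop R p ∧ (clinch a R next).play t = (next p).play t := by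
  unfold clinch
  rw [dif_pos hR]
  exact ⟨_, (t a).fav_isTop R hR, rfl⟩

theorem ObviouslyTruthfulSub.clinch (h : ∀ p ∈ R, ∀ M ∈ (next p).outcomes, (a, p) ∈ M)
    (hnext : ∀ p ∈ R, ObviouslyTruthfulSub (next p)) :
    ObviouslyTruthfulSub (clinch a R next) := by
  unfold _root_.clinch
  split_ifs with hR
  · refine ⟨fun t M hM c _ M' hM' => ?_, fun c => hnext c c.2⟩
    have hM := GameTree.consistent_subset_outcomes _ _ _ hM
    exact ⟨_, _, h _ (t.fav_mem R hR) M hM, h c c.2 M' hM', (t.fav_isTop R hR).eq_or_rel c.2⟩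
  · trivial

theorem exists_of_mem_outcomes_clinchOrPass (hCD : (C ∪ D).Nonempty)
    (h : M ∈ (clinchOrPass a C D next pass).outcomes) :
    (∃ p ∈ C, M ∈ (next p).outcomes) ∨ M ∈ pass.outcomes := by
  unfold clinchOrPass at h
  rw [dif_pos hCD] at h
  obtain ⟨_ | p, hp⟩ := h
  · exact Or.inr hp
  · exact Or.inl ⟨p, p.2, hp⟩

theorem exists_of_mem_consistent_clinchOrPass (hCD : (C ∪ D).Nonempty)
    (h : M ∈ (clinchOrPass a C D next pass).consistent i t) :
    (∃ p ∈ C, M ∈ (next p).consistent i t) ∨ M ∈ pass.consistent i t := by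
  unfold clinchOrPass at h
  rw [dif_pos hCD] at h
  obtain ⟨_ | p, -, hp⟩ := h
  · exact Or.inr hp
  · exact Or.inl ⟨p, p.2, hp⟩

theorem exists_play_clinchOrPass (a : A) (next : P → SubMech A P) (pass : SubMech A P)
    (hCD : (C ∪ D).Nonempty) (t : A → Ranking P) :
    (∃ p ∈ C, (t a).IsTop (C ∪ D) p ∧ (clinchOrPass a C D next pass).play t = (next p).play t) ∨
    ∃ p ∈ D, (t a).IsTop (C ∪ D) p ∧ (clinchOrPass a C D next pass).play t = pass.play t := by
  have htop := (t a).fav_isTop (C ∪ D) hCD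
  unfold clinchOrPass
  rw [dif_pos hCD, GameTree.play]
  by_cases hC : (t a).fav (C ∪ D) hCD ∈ C
  · exact Or.inl ⟨_, hC, htop, by rw [dif_pos hC]⟩
  · exact Or.inr ⟨_, htop.1.resolve_left hC, htop, by rw [dif_neg hC]⟩

/-- Two deviations must be unprofitable. A clincher has the favorite in `C ∪ D`, so it suffices that
passing never leads outside this set (`hpass`); a passer must be sure of doing as well as with any
position that could be clinched now (`hpass'`). -/
theorem ObviouslyTruthfulSub.clinchOrPass (h : ∀ p ∈ C, ∀ M ∈ (next p).outcomes, (a, p) ∈ M)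
    (hnext : ∀ p ∈ C, ObviouslyTruthfulSub (next p))
    (hpass : ∀ M ∈ pass.outcomes, ∃ p ∈ C ∪ D, (a, p) ∈ M)
    (hpass' : ∀ t d, d ∈ D → d ∉ C → t.IsTop (C ∪ D) d → ∀ M ∈ pass.consistent a t,
      ∃ p, (a, p) ∈ M ∧ ∀ p' ∈ C, p = p' ∨ t.rel p p')
    (hpass'' : ObviouslyTruthfulSub pass) :
    ObviouslyTruthfulSub (clinchOrPass a C D next pass) := by
  unfold _root_.clinchOrPass
  split_ifs with hCD
  · refine ⟨fun t M hM c hc M' hM' => ?_, fun c => ?_⟩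
    · have htop := t.fav_isTop (C ∪ D) hCD
      beta_reduce at hM hc
      by_cases hC : t.fav (C ∪ D) hCD ∈ C
      · rw [dif_pos hC] at hM
        have hM := h _ hC M (GameTree.consistent_subset_outcomes _ _ _ hM)
        rcases c with _ | p
        · obtain ⟨p, hp, hp'⟩ := hpass M' hM'
          exact ⟨_, p, hM, hp', htop.eq_or_rel hp⟩
        · exact ⟨_, p, hM, h p p.2 M' hM', htop.eq_or_rel (Or.inl p.2)⟩
      · rw [dif_neg hC] at hM hc
        obtain ⟨p, hp, hp'⟩ := hpass' t _ (htop.1.resolve_left hC) hC htop M hM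
        rcases c with _ | p'
        · exact absurd rfl hc
        · exact ⟨p, p', hp, h p' p'.2 M' hM', hp' p' p'.2⟩
    · rcases c with _ | p
      · exact hpass''
      · exact hnext p p.2
  · trivial

end Clinch

theorem mem_outcomes_leaf {A P : Type u} {M M' : List (A × P)} :
    M ∈ (GameTree.leaf M' : SubMech A P).outcomes ↔ M = M' := Iff.rfl

theorem mem_consistent_leaf {A P : Type u} {M M' : List (A × P)} {i : A} {t : Ranking P} :
    M ∈ (GameTree.leaf M' : SubMech A P).consistent i t ↔ M = M' := Iff.rfl

section Stages

variable {A P : Type u} [Finite P] {a b : A} {R U V X : Set P} {M : List (A × P)}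

theorem exists_of_mem_outcomes_oneTr (hR : R.Nonempty) (h : M ∈ (oneTr R a).outcomes) :
    ∃ p ∈ R, M = [(a, p)] := exists_of_mem_outcomes_clinch hR h

theorem obviouslyTruthfulSub_oneTr (R : Set P) (a : A) : ObviouslyTruthfulSub (oneTr R a) :=
  .clinch (fun p _ M hM => by rw [mem_outcomes_leaf.1 hM]; simp) fun _ _ => trivial

theorem exists_of_mem_outcomes_twoTr (hUV : (U ∪ V).Nonempty) (hR : ∀ z, ((U ∪ V) \ {z}).Nonempty)
    (h : M ∈ (twoTr U V a b).outcomes) :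
    ∃ p ∈ U ∪ V, ∃ p' ∈ U ∪ V, p ≠ p' ∧ M = [(a, p), (b, p')] := by
  rcases exists_of_mem_outcomes_clinchOrPass hUV h with ⟨w, hw, h⟩ | h
  · obtain ⟨z, hz, h⟩ := exists_of_mem_outcomes_clinch (hR w) h
    exact ⟨w, Or.inl hw, z, hz.1, Ne.symm hz.2, h⟩
  · obtain ⟨z, hz, h⟩ := exists_of_mem_outcomes_clinch hUV h
    obtain ⟨w, hw, h⟩ := exists_of_mem_outcomes_clinch (hR z) h
    exact ⟨w, hw.1, z, hz, hw.2, h⟩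

theorem obviouslyTruthfulSub_twoTr (hUV : (U ∪ V).Nonempty) (hR : ∀ z, ((U ∪ V) \ {z}).Nonempty) :
    ObviouslyTruthfulSub (twoTr U V a b) := by
  refine .clinchOrPass ?_ ?_ ?_ ?_ ?_
  · intro w _ M hM
    obtain ⟨z, -, hM⟩ := exists_of_mem_outcomes_clinch (hR w) hM
    simp [mem_outcomes_leaf.1 hM]
  · intro w _
    exact .clinch (fun z _ M hM => by simp [mem_outcomes_leaf.1 hM]) fun _ _ => trivial
  · intro M hM
    obtain ⟨z, -, hM⟩ := exists_of_mem_outcomes_clinch hUV hM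
    obtain ⟨w, hw, hM⟩ := exists_of_mem_outcomes_clinch (hR z) hM
    exact ⟨w, hw.1, by simp [mem_outcomes_leaf.1 hM]⟩
  · intro t d _ hdU hd M hM
    obtain ⟨z, -, -, hM⟩ := exists_of_mem_consistent_clinch hUV hM
    obtain ⟨w, -, hw, hM⟩ := exists_of_mem_consistent_clinch (hR z) hM
    refine ⟨w, by simp [mem_consistent_leaf.1 hM], fun p hp => ?_⟩
    -- If `b` took the position `p` that `a` could have clinched, then the favorite `d` of `a` is
    -- still available, and `a` prefers it to `p`.
    by_cases hpz : p = z
    · have hdp : d ≠ p := by rintro rfl; exact hdU hp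
      have h2 := hd.2 p (Or.inl hp) hdp.symm
      rcases (hw rfl).eq_or_rel ⟨hd.1, fun h => hdp (h.trans hpz.symm)⟩ with rfl | h
      · exact Or.inr h2
      · exact Or.inr (t.trans _ _ _ h h2)
    · exact (hw rfl).eq_or_rel ⟨Or.inl hp, hpz⟩
  · refine .clinch (fun z _ M hM => ?_) fun z _ =>
      .clinch (fun w _ M hM => by simp [mem_outcomes_leaf.1 hM]) fun _ _ => trivial
    obtain ⟨w, hw, hM⟩ := exists_of_mem_outcomes_clinch (hR z) hM
    simp [mem_outcomes_leaf.1 hM]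

end Stages

/-! ### Outcomes and obvious truthfulness of 3Lu. -/

section ThreeLu

variable {A P : Type u} [Finite P] {a₁ a₂ a₃ : A} {X : Set P} {u v : P} {M : List (A × P)}
  {t : Ranking P}

open Classical in
/-- The part of 3Lu after the applicant `a₃` has passed. -/
noncomputable def threeLuPassThree (X : Set P) (u v : P) (a₁ a₂ a₃ : A) : SubMech A P :=
  clinch a₂ (X ∪ {v}) fun p =>
    if p = v then
      clinch a₁ (X ∪ {u}) fun w =>
        if w = u then clinch a₃ X fun z => .leaf [(a₁, u), (a₂, v), (a₃, z)]
        else .leaf [(a₁, w), (a₂, v), (a₃, u)]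
    else .leaf [(a₁, v), (a₂, p), (a₃, u)]

/-- The part of 3Lu after the applicant `a₂` has passed. -/
noncomputable def threeLuPassTwo (X : Set P) (u v : P) (a₁ a₂ a₃ : A) : SubMech A P :=
  clinchOrPass a₃ X {u} (fun p => .leaf [(a₁, v), (a₂, u), (a₃, p)]) <|
    threeLuPassThree X u v a₁ a₂ a₃

open Classical in
/-- The part of 3Lu after the applicant `a₁` has passed. -/
noncomputable def threeLuPassOne (X : Set P) (u v : P) (a₁ a₂ a₃ : A) : SubMech A P :=
  clinchOrPass a₂ (X ∪ {v}) {u}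
    (fun p =>
      if p = v then clinch a₁ (X ∪ {u}) fun w => .leaf [(a₁, w), (a₂, v)]
      else .leaf [(a₁, v), (a₂, p)]) <|
    threeLuPassTwo X u v a₁ a₂ a₃

theorem threeLu_eq (X : Set P) (u v : P) (a₁ a₂ a₃ : A) : threeLu X u v a₁ a₂ a₃ =
    clinchOrPass a₁ (X ∪ {u}) {v} (fun p => .leaf [(a₁, p)]) (threeLuPassOne X u v a₁ a₂ a₃) :=
  rfl

theorem mem_outcomes_threeLuPassThree (hX : X.Nonempty)
    (h : M ∈ (threeLuPassThree X u v a₁ a₂ a₃).outcomes) :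
    (∃ p ∈ X, M = [(a₁, v), (a₂, p), (a₃, u)]) ∨ (∃ p ∈ X, M = [(a₁, p), (a₂, v), (a₃, u)]) ∨
      ∃ p ∈ X, M = [(a₁, u), (a₂, v), (a₃, p)] := by
  obtain ⟨p, hp, h⟩ := exists_of_mem_outcomes_clinch hX.inl h
  split_ifs at h with hpv
  · obtain ⟨w, hw, h⟩ := exists_of_mem_outcomes_clinch hX.inl h
    split_ifs at h with hwu
    · obtain ⟨z, hz, h⟩ := exists_of_mem_outcomes_clinch hX h
      exact Or.inr (Or.inr ⟨z, hz, h⟩)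
    · exact Or.inr (Or.inl ⟨w, hw.resolve_right hwu, h⟩)
  · exact Or.inl ⟨p, hp.resolve_right hpv, h⟩

theorem mem_outcomes_threeLuPassTwo (hX : X.Nonempty)
    (h : M ∈ (threeLuPassTwo X u v a₁ a₂ a₃).outcomes) :
    (∃ p ∈ X, M = [(a₁, v), (a₂, u), (a₃, p)]) ∨
      M ∈ (threeLuPassThree X u v a₁ a₂ a₃).outcomes :=
  exists_of_mem_outcomes_clinchOrPass hX.inl h

theorem mem_outcomes_threeLuPassOne (hX : X.Nonempty)
    (h : M ∈ (threeLuPassOne X u v a₁ a₂ a₃).outcomes) :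
    (∃ p ∈ X ∪ {u}, M = [(a₁, p), (a₂, v)]) ∨ (∃ p ∈ X, M = [(a₁, v), (a₂, p)]) ∨
      M ∈ (threeLuPassTwo X u v a₁ a₂ a₃).outcomes := by
  rcases exists_of_mem_outcomes_clinchOrPass hX.inl.inl h with ⟨p, hp, h⟩ | h
  · split_ifs at h with hpv
    · obtain ⟨w, hw, h⟩ := exists_of_mem_outcomes_clinch hX.inl h
      exact Or.inl ⟨w, hw, h⟩
    · exact Or.inr (Or.inl ⟨p, hp.resolve_right hpv, h⟩)
  · exact Or.inr (Or.inr h)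

theorem mem_outcomes_threeLu (hX : X.Nonempty) (h : M ∈ (threeLu X u v a₁ a₂ a₃).outcomes) :
    (∃ p ∈ X ∪ {u}, M = [(a₁, p)]) ∨ M ∈ (threeLuPassOne X u v a₁ a₂ a₃).outcomes :=
  exists_of_mem_outcomes_clinchOrPass hX.inl.inl h

/-- The guarantee that makes passing safe for `a₃`: the result is `u`, for which they passed, or
their favorite in the set from which they could have clinched. The next two lemmas give the
analogous guarantees for `a₂` and `a₁`. -/
theorem mem_consistent_threeLuPassThree (hX : X.Nonempty)
    (h : M ∈ (threeLuPassThree X u v a₁ a₂ a₃).consistent a₃ t) :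
    (a₃, u) ∈ M ∨ ∃ p, t.IsTop X p ∧ (a₃, p) ∈ M := by
  obtain ⟨p, hp, -, h⟩ := exists_of_mem_consistent_clinch hX.inl h
  split_ifs at h with hpv
  · obtain ⟨w, hw, -, h⟩ := exists_of_mem_consistent_clinch hX.inl h
    split_ifs at h with hwu
    · obtain ⟨z, -, hz, h⟩ := exists_of_mem_consistent_clinch hX h
      exact Or.inr ⟨z, hz rfl, by simp [mem_consistent_leaf.1 h]⟩
    · exact Or.inl (by simp [mem_consistent_leaf.1 h])
  · exact Or.inl (by simp [mem_consistent_leaf.1 h])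

theorem mem_consistent_threeLuPassTwo (hX : X.Nonempty)
    (h : M ∈ (threeLuPassTwo X u v a₁ a₂ a₃).consistent a₂ t) :
    (a₂, u) ∈ M ∨ ∃ p, t.IsTop (X ∪ {v}) p ∧ (a₂, p) ∈ M := by
  rcases exists_of_mem_consistent_clinchOrPass hX.inl h with ⟨p, -, h⟩ | h
  · exact Or.inl (by simp [mem_consistent_leaf.1 h])
  obtain ⟨p, -, hp, h⟩ := exists_of_mem_consistent_clinch hX.inl h
  refine Or.inr ⟨p, hp rfl, ?_⟩
  split_ifs at h with hpv
  · obtain ⟨w, -, -, h⟩ := exists_of_mem_consistent_clinch hX.inl h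
    split_ifs at h with hwu
    · obtain ⟨z, -, -, h⟩ := exists_of_mem_consistent_clinch hX h
      simp [mem_consistent_leaf.1 h, hpv]
    · simp [mem_consistent_leaf.1 h, hpv]
  · simp [mem_consistent_leaf.1 h]

theorem mem_consistent_threeLuPassOne (hX : X.Nonempty)
    (h : M ∈ (threeLuPassOne X u v a₁ a₂ a₃).consistent a₁ t) :
    (a₁, v) ∈ M ∨ ∃ p, t.IsTop (X ∪ {u}) p ∧ (a₁, p) ∈ M := by
  rcases exists_of_mem_consistent_clinchOrPass hX.inl.inl h with ⟨p, -, h⟩ | h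
  · split_ifs at h with hpv
    · obtain ⟨w, -, hw, h⟩ := exists_of_mem_consistent_clinch hX.inl h
      exact Or.inr ⟨w, hw rfl, by simp [mem_consistent_leaf.1 h]⟩
    · exact Or.inl (by simp [mem_consistent_leaf.1 h])
  rcases exists_of_mem_consistent_clinchOrPass hX.inl h with ⟨p, -, h⟩ | h
  · exact Or.inl (by simp [mem_consistent_leaf.1 h])
  obtain ⟨p, -, -, h⟩ := exists_of_mem_consistent_clinch hX.inl h
  split_ifs at h with hpv
  · obtain ⟨w, -, hw, h⟩ := exists_of_mem_consistent_clinch hX.inl h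
    refine Or.inr ⟨w, hw rfl, ?_⟩
    split_ifs at h with hwu
    · obtain ⟨z, -, -, h⟩ := exists_of_mem_consistent_clinch hX h
      simp [mem_consistent_leaf.1 h, hwu]
    · simp [mem_consistent_leaf.1 h]
  · exact Or.inl (by simp [mem_consistent_leaf.1 h])

theorem obviouslyTruthfulSub_threeLuPassThree (hX : X.Nonempty) :
    ObviouslyTruthfulSub (threeLuPassThree X u v a₁ a₂ a₃) := by
  refine .clinch (fun p _ M hM => ?_) fun p _ => ?_
  · split_ifs at hM with hpv
    · obtain ⟨w, -, hM⟩ := exists_of_mem_outcomes_clinch hX.inl hM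
      split_ifs at hM with hwu
      · obtain ⟨z, -, hM⟩ := exists_of_mem_outcomes_clinch hX hM
        simp [mem_outcomes_leaf.1 hM, hpv]
      · simp [mem_outcomes_leaf.1 hM, hpv]
    · simp [mem_outcomes_leaf.1 hM]
  · split_ifs with hpv
    · refine .clinch (fun w _ M hM => ?_) fun w _ => ?_
      · split_ifs at hM with hwu
        · obtain ⟨z, -, hM⟩ := exists_of_mem_outcomes_clinch hX hM
          simp [mem_outcomes_leaf.1 hM, hwu]
        · simp [mem_outcomes_leaf.1 hM]
      · split_ifs with hwu
        · exact .clinch (fun z _ M hM => by simp [mem_outcomes_leaf.1 hM]) fun _ _ => trivial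
        · trivial
    · trivial

theorem obviouslyTruthfulSub_threeLuPassTwo (hX : X.Nonempty) :
    ObviouslyTruthfulSub (threeLuPassTwo X u v a₁ a₂ a₃) := by
  refine .clinchOrPass (fun p _ M hM => by simp [mem_outcomes_leaf.1 hM]) (fun _ _ => trivial)
    (fun M hM => ?_) (fun t d hd _ htop M hM => ?_) (obviouslyTruthfulSub_threeLuPassThree hX)
  · rcases mem_outcomes_threeLuPassThree hX hM with ⟨p, hp, rfl⟩ | ⟨p, hp, rfl⟩ | ⟨p, hp, rfl⟩
    · exact ⟨u, Or.inr rfl, by simp⟩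
    · exact ⟨u, Or.inr rfl, by simp⟩
    · exact ⟨p, Or.inl hp, by simp⟩
  · obtain rfl : d = u := hd
    rcases mem_consistent_threeLuPassThree hX hM with h | ⟨p, hp, h⟩
    · exact ⟨d, h, fun p' hp' => htop.eq_or_rel (Or.inl hp')⟩
    · exact ⟨p, h, fun p' hp' => hp.eq_or_rel hp'⟩

theorem obviouslyTruthfulSub_threeLuPassOne (hX : X.Nonempty) :
    ObviouslyTruthfulSub (threeLuPassOne X u v a₁ a₂ a₃) := by
  refine .clinchOrPass (fun p _ M hM => ?_) (fun p _ => ?_)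
    (fun M hM => ?_) (fun t d hd _ htop M hM => ?_) (obviouslyTruthfulSub_threeLuPassTwo hX)
  · split_ifs at hM with hpv
    · obtain ⟨w, -, hM⟩ := exists_of_mem_outcomes_clinch hX.inl hM
      simp [mem_outcomes_leaf.1 hM, hpv]
    · simp [mem_outcomes_leaf.1 hM]
  · split_ifs with hpv
    · exact .clinch (fun z _ M hM => by simp [mem_outcomes_leaf.1 hM]) fun _ _ => trivial
    · trivial
  · rcases mem_outcomes_threeLuPassTwo hX hM with ⟨p, hp, rfl⟩ | hM
    · exact ⟨u, Or.inr rfl, by simp⟩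
    rcases mem_outcomes_threeLuPassThree hX hM with ⟨p, hp, rfl⟩ | ⟨p, hp, rfl⟩ | ⟨p, hp, rfl⟩
    · exact ⟨p, Or.inl (Or.inl hp), by simp⟩
    · exact ⟨v, Or.inl (Or.inr rfl), by simp⟩
    · exact ⟨v, Or.inl (Or.inr rfl), by simp⟩
  · obtain rfl : d = u := hd
    rcases mem_consistent_threeLuPassTwo hX hM with h | ⟨p, hp, h⟩
    · exact ⟨d, h, fun p' hp' => htop.eq_or_rel (Or.inl hp')⟩
    · exact ⟨p, h, fun p' hp' => hp.eq_or_rel hp'⟩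

theorem obviouslyTruthfulSub_threeLu (hX : X.Nonempty) :
    ObviouslyTruthfulSub (threeLu X u v a₁ a₂ a₃) := by
  refine .clinchOrPass (fun p _ M hM => by simp [mem_outcomes_leaf.1 hM]) (fun _ _ => trivial)
    (fun M hM => ?_) (fun t d hd _ htop M hM => ?_) (obviouslyTruthfulSub_threeLuPassOne hX)
  · rcases mem_outcomes_threeLuPassOne hX hM with ⟨p, hp, rfl⟩ | ⟨p, hp, rfl⟩ | hM
    · exact ⟨p, Or.inl hp, by simp⟩
    · exact ⟨v, Or.inr rfl, by simp⟩
    rcases mem_outcomes_threeLuPassTwo hX hM with ⟨p, hp, rfl⟩ | hM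
    · exact ⟨v, Or.inr rfl, by simp⟩
    rcases mem_outcomes_threeLuPassThree hX hM with ⟨p, hp, rfl⟩ | ⟨p, hp, rfl⟩ | ⟨p, hp, rfl⟩
    · exact ⟨v, Or.inr rfl, by simp⟩
    · exact ⟨p, Or.inl (Or.inl hp), by simp⟩
    · exact ⟨u, Or.inl (Or.inr rfl), by simp⟩
  · obtain rfl : d = v := hd
    rcases mem_consistent_threeLuPassOne hX hM with h | ⟨p, hp, h⟩
    · exact ⟨d, h, fun p' hp' => htop.eq_or_rel (Or.inl hp')⟩
    · exact ⟨p, h, fun p' hp' => hp.eq_or_rel hp'⟩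

end ThreeLu

/-! ### Compositions of 2Tr and 3Lu implement deferred acceptance -/

/-- The matches `M` agree with `μ`, and the applicants in `M` envy no one at a free position. -/
def Determined {A P : Type u} (t : A → Ranking P) (μ : A ≃ P) (M : List (A × P)) : Prop :=
  ∀ a p, (a, p) ∈ M → μ a = p ∧ ∀ p' ∈ freePositions M, (t a).rel p p'

/-! ### The applicant-optimal matching on the free applicants and positions. -/

section Submarket

variable {A P : Type u} {q : P → Ranking A} {t : A → Ranking P} {μ : A ≃ P} {M : List (A × P)}

theorem Determined.mem_freePositions_iff (hM : Determined t μ M) (a : A) :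
    μ a ∈ freePositions M ↔ a ∈ freeApplicants M := by
  constructor
  · intro h p hp
    exact h a ((hM a p hp).1 ▸ hp)
  · intro h b hb
    have := μ.injective (hM b _ hb).1
    exact h _ (this ▸ hb)

theorem Determined.rel_of_notMem (hM : Determined t μ M) {a : A} (ha : a ∉ freeApplicants M) {p : P}
    (hp : p ∈ freePositions M) : (t a).rel (μ a) p := by
  simp only [freeApplicants, Set.mem_ofPred_eq, not_forall, not_not] at ha
  obtain ⟨p', hp'⟩ := ha
  obtain ⟨h, h'⟩ := hM a p' hp'
  exact h ▸ h' p hp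

/-- Only positions that stay free after `M'` need to be compared, since the new applicants may envy
those matched in the same stage. -/
theorem Determined.append (hM : Determined t μ M) {M' : List (A × P)}
    (hM' : ∀ a p, (a, p) ∈ M' → μ a = p ∧
      ∀ p' ∈ freePositions M, (∀ b, (b, p') ∉ M') → (t a).rel p p') :
    Determined t μ (M' ++ M) := by
  intro a p hap
  rcases List.mem_append.1 hap with h | h
  · obtain ⟨h1, h2⟩ := hM' a p h
    exact ⟨h1, fun p' hp' => h2 p' (fun b hb => hp' b (List.mem_append_right _ hb))
      fun b hb => hp' b (List.mem_append_left _ hb)⟩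
  · obtain ⟨h1, h2⟩ := hM a p h
    exact ⟨h1, fun p' hp' => h2 p' fun b hb => hp' b (List.mem_append_right _ hb)⟩

theorem Determined.append_one (hM : Determined t μ M) {a : A} {p : P} (ha : μ a = p)
    (h : ∀ x ∈ freePositions M, x ≠ p → (t a).rel p x) : Determined t μ ([(a, p)] ++ M) := by
  refine hM.append fun b p' hb => ?_
  simp only [List.mem_singleton, Prod.mk.injEq] at hb
  obtain ⟨rfl, rfl⟩ := hb
  exact ⟨ha, fun x hx hx' => h x hx fun e => hx' b (by simp [e])⟩

theorem Determined.append_two (hM : Determined t μ M) {a b : A} {p r : P} (ha : μ a = p)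
    (hb : μ b = r) (h : ∀ x ∈ freePositions M, x ≠ p → x ≠ r → (t a).rel p x ∧ (t b).rel r x) :
    Determined t μ ([(a, p), (b, r)] ++ M) := by
  refine hM.append fun c p' hc => ?_
  have h' : ∀ x ∈ freePositions M, (∀ c, (c, x) ∉ [(a, p), (b, r)]) →
      (t a).rel p x ∧ (t b).rel r x := fun x hx hx' =>
    h x hx (fun e => hx' a (by simp [e])) fun e => hx' b (by simp [e])
  simp only [List.mem_cons, Prod.mk.injEq, List.not_mem_nil, or_false] at hc
  rcases hc with ⟨rfl, rfl⟩ | ⟨rfl, rfl⟩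
  · exact ⟨ha, fun x hx hx' => (h' x hx hx').1⟩
  · exact ⟨hb, fun x hx hx' => (h' x hx hx').2⟩

theorem Determined.append_three (hM : Determined t μ M) {a b c : A} {p r s : P} (ha : μ a = p)
    (hb : μ b = r) (hc : μ c = s) (h : ∀ x ∈ freePositions M, x ≠ p → x ≠ r → x ≠ s →
      (t a).rel p x ∧ (t b).rel r x ∧ (t c).rel s x) :
    Determined t μ ([(a, p), (b, r), (c, s)] ++ M) := by
  refine hM.append fun d p' hd => ?_
  have h' : ∀ x ∈ freePositions M, (∀ d, (d, x) ∉ [(a, p), (b, r), (c, s)]) →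
      (t a).rel p x ∧ (t b).rel r x ∧ (t c).rel s x := fun x hx hx' =>
    h x hx (fun e => hx' a (by simp [e])) (fun e => hx' b (by simp [e]))
      fun e => hx' c (by simp [e])
  simp only [List.mem_cons, Prod.mk.injEq, List.not_mem_nil, or_false] at hd
  rcases hd with ⟨rfl, rfl⟩ | ⟨rfl, rfl⟩ | ⟨rfl, rfl⟩
  · exact ⟨ha, fun x hx hx' => (h' x hx hx').1⟩
  · exact ⟨hb, fun x hx hx' => (h' x hx hx').2.1⟩
  · exact ⟨hc, fun x hx hx' => (h' x hx hx').2.2⟩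

/-- A free applicant is matched to their favorite position of a set of free positions that contains
their match, or this position is held by a free applicant with a higher priority. -/
theorem IsStable.eq_or_exists_of_isTop (hμ : IsStable q t μ) (hM : Determined t μ M) {R : Set P}
    (hR : R ⊆ freePositions M) {a : A} {p : P} (hp : (t a).IsTop R p) (ha : μ a ∈ R) :
    μ a = p ∨ ∃ b ∈ freeApplicants M, μ b = p ∧ (q p).rel b a := by
  by_cases h : μ a = p
  · exact Or.inl h
  rcases hμ a p h with h' | h'
  · exact absurd h' ((t a).asymm (hp.2 _ ha h))
  · refine Or.inr ⟨μ.symm p, ?_, μ.apply_symm_apply p, h'⟩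
    rw [← hM.mem_freePositions_iff, μ.apply_symm_apply]
    exact hR hp.1

/-- An applicant-optimal stable matching cannot be improved for free applicants without creating
envy of someone whose match has changed. -/
theorem IsApplicantOptimal.eq_of_improvement (hμ : IsApplicantOptimal q t μ)
    (hM : Determined t μ M) (ν : A ≃ P)
    (hν : ∀ a, ν a = μ a ∨ a ∈ freeApplicants M ∧ (t a).rel (ν a) (μ a))
    (hblock : ∀ a, ν a ≠ μ a → ∀ c ∈ freeApplicants M, (q (ν a)).rel c a →
      (t c).rel (ν c) (ν a)) (a : A) : ν a = μ a := by
  -- Envy of someone whose match is unchanged is excluded by stability of `μ`, as everybody is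
  -- weakly better off. Envy of someone whose match has changed is excluded by `hblock` for free
  -- applicants, and for matched ones because the position in question is free.
  have hstable : IsStable q t ν := by
    intro c p hcp
    obtain ⟨a, rfl⟩ := ν.surjective p
    rw [ν.symm_apply_apply]
    have hca : c ≠ a := by rintro rfl; exact hcp rfl
    by_cases ha : ν a = μ a
    · rw [ha]
      rcases hμ.1 c (μ a) fun h => hca (μ.injective h) with h | h
      · left
        rcases hν c with h' | h'
        · rwa [h']
        · exact (t c).trans _ _ _ h'.2 h
      · rw [μ.symm_apply_apply] at h
        exact Or.inr h
    · by_cases hc : c ∈ freeApplicants M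
      · rcases (q (ν a)).total c a hca with h | h
        · exact Or.inl (hblock a ha c hc h)
        · exact Or.inr h
      · left
        rw [(hν c).resolve_right fun h => hc h.1]
        refine hM.rel_of_notMem hc ?_
        obtain ⟨d, hd⟩ := μ.surjective (ν a)
        rw [← hd, hM.mem_freePositions_iff]
        rcases hν d with h | h
        · obtain rfl := ν.injective (h.trans hd)
          exact absurd hd.symm ha
        · exact h.1
  by_contra hne
  have h1 := ((hν a).resolve_left hne).2
  rcases hμ.2 ν hstable a with h | h
  · exact hne h.symm
  · exact (t a).asymm h h1

/-- Exchanging the two matches would improve both applicants, and the priority conditions exclude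
new envy by third parties. -/
theorem IsApplicantOptimal.not_swap (hμ : IsApplicantOptimal q t μ) (hM : Determined t μ M)
    {a b : A} (ha : a ∈ freeApplicants M) (hb : b ∈ freeApplicants M)
    (hta : (t a).rel (μ b) (μ a)) (htb : (t b).rel (μ a) (μ b))
    (hqa : ∀ c ∈ freeApplicants M, c ≠ a → c ≠ b → (q (μ b)).rel c a → (t c).rel (μ c) (μ b))
    (hqb : ∀ c ∈ freeApplicants M, c ≠ a → c ≠ b → (q (μ a)).rel c b → (t c).rel (μ c) (μ a)) :
    False := by
  classical
  let ν : A ≃ P := (Equiv.swap a b).trans μ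
  have h1 : ν a = μ b := by simp [ν]
  have h2 : ν b = μ a := by simp [ν]
  have h3 : ∀ c, c ≠ a → c ≠ b → ν c = μ c := fun c h h' => by
    simp [ν, Equiv.swap_apply_of_ne_of_ne h h']
  have := hμ.eq_of_improvement hM ν (fun c => ?_) (fun c hc d hd hdc => ?_) a
  · rw [h1] at this
    exact (t a).ne hta this
  · by_cases hca : c = a
    · subst hca; exact Or.inr ⟨ha, h1 ▸ hta⟩
    by_cases hcb : c = b
    · subst hcb; exact Or.inr ⟨hb, h2 ▸ htb⟩
    exact Or.inl (h3 c hca hcb)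
  · by_cases hca : c = a
    · subst hca
      rw [h1] at hdc ⊢
      have hdc' := (q _).ne hdc
      by_cases hdb : d = b
      · subst hdb; rw [h2]; exact htb
      · rw [h3 d hdc' hdb]; exact hqa d hd hdc' hdb hdc
    by_cases hcb : c = b
    · subst hcb
      rw [h2] at hdc ⊢
      have hdc' := (q _).ne hdc
      by_cases hda : d = a
      · subst hda; rw [h1]; exact hta
      · rw [h3 d hda hdc']; exact hqb d hd hda hdc' hdc
    exact absurd (h3 c hca hcb) hc

/-- The same for a trade of three: `a`, `b`, `c` would receive the matches of `b`, `c`, `a`. The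
alternatives in `hqb` and `hqc` allow for a trader who has a higher priority at a position received
by another, but prefers their own new match. -/
theorem IsApplicantOptimal.not_rotation (hμ : IsApplicantOptimal q t μ) (hM : Determined t μ M)
    {a b c : A} (hab : a ≠ b) (hbc : b ≠ c) (hac : a ≠ c) (ha : a ∈ freeApplicants M)
    (hb : b ∈ freeApplicants M) (hc : c ∈ freeApplicants M) (hta : (t a).rel (μ b) (μ a))
    (htb : (t b).rel (μ c) (μ b)) (htc : (t c).rel (μ a) (μ c))
    (hqa : ∀ d ∈ freeApplicants M, (q (μ b)).rel d a → d = b)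
    (hqb : ∀ d ∈ freeApplicants M, (q (μ c)).rel d b →
      d = a ∧ (t a).rel (μ b) (μ c) ∨ d = c)
    (hqc : ∀ d ∈ freeApplicants M, (q (μ a)).rel d c →
      d = a ∨ d = b ∧ (t b).rel (μ c) (μ a)) : False := by
  classical
  let ν : A ≃ P := (Equiv.swap a b * Equiv.swap b c).trans μ
  have h1 : ν a = μ b := by simp [ν, Equiv.swap_apply_of_ne_of_ne hab hac]
  have h2 : ν b = μ c := by simp [ν, Equiv.swap_apply_of_ne_of_ne hac.symm hbc.symm]
  have h3 : ν c = μ a := by simp [ν]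
  have h4 : ∀ d, d ≠ a → d ≠ b → d ≠ c → ν d = μ d := fun d h h' h'' => by
    simp [ν, Equiv.swap_apply_of_ne_of_ne h h', Equiv.swap_apply_of_ne_of_ne h' h'']
  have := hμ.eq_of_improvement hM ν (fun d => ?_) (fun d hd e he hed => ?_) a
  · rw [h1] at this
    exact (t a).ne hta this
  · by_cases hda : d = a
    · subst hda; exact Or.inr ⟨ha, h1 ▸ hta⟩
    by_cases hdb : d = b
    · subst hdb; exact Or.inr ⟨hb, h2 ▸ htb⟩
    by_cases hdc : d = c
    · subst hdc; exact Or.inr ⟨hc, h3 ▸ htc⟩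
    exact Or.inl (h4 d hda hdb hdc)
  · by_cases hda : d = a
    · subst hda
      rw [h1] at hed ⊢
      obtain rfl := hqa e he hed
      rw [h2]; exact htb
    by_cases hdb : d = b
    · subst hdb
      rw [h2] at hed ⊢
      rcases hqb e he hed with ⟨rfl, h⟩ | rfl
      · rw [h1]; exact h
      · rw [h3]; exact htc
    by_cases hdc : d = c
    · subst hdc
      rw [h3] at hed ⊢
      rcases hqc e he hed with rfl | ⟨rfl, h⟩
      · rw [h1]; exact hta
      · rw [h2]; exact h
    exact absurd (h4 d hda hdb hdc) hd

variable [Finite P]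

theorem Determined.oneTr (hμ : IsApplicantOptimal q t μ) (hM : Determined t μ M) {a : A}
    (ha : a ∈ freeApplicants M)
    (htop : ∀ p ∈ freePositions M, ∀ c ∈ freeApplicants M, c ≠ a → (q p).rel a c) :
    Determined t μ ((oneTr (freePositions M) a).play t ++ M) := by
  have hμa := (hM.mem_freePositions_iff a).2 ha
  obtain ⟨p, hp, h⟩ := exists_play_clinch a (fun p => .leaf [(a, p)]) ⟨_, hμa⟩ t
  rw [_root_.oneTr, h]
  refine hM.append_one ?_ hp.2
  refine (hμ.1.eq_or_exists_of_isTop hM subset_rfl hp hμa).resolve_right ?_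
  rintro ⟨b, hb, -, hba⟩
  exact (q p).asymm hba (htop p hp.1 b hb ((q p).ne hba))

theorem Determined.twoTr (hμ : IsApplicantOptimal q t μ) (hM : Determined t μ M) {a b : A}
    (ha : a ∈ freeApplicants M) (hb : b ∈ freeApplicants M) (hab : a ≠ b)
    (htop : ∀ p ∈ freePositions M, ∀ c ∈ freeApplicants M, c ≠ a → c ≠ b →
      (q p).rel a c ∧ (q p).rel b c) {U V : Set P}
    (hU : U = {p | p ∈ freePositions M ∧ (q p).rel a b})
    (hV : V = {p | p ∈ freePositions M ∧ (q p).rel b a}) :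
    Determined t μ ((twoTr U V a b).play t ++ M) := by
  have hUV : U ∪ V = freePositions M := by
    subst hU hV
    ext p
    refine ⟨fun h => h.elim And.left And.left, fun h => ?_⟩
    exact ((q p).total a b hab).imp (fun h' => ⟨h, h'⟩) fun h' => ⟨h, h'⟩
  have hμa := (hM.mem_freePositions_iff a).2 ha
  have hμb := (hM.mem_freePositions_iff b).2 hb
  have hμab : μ a ≠ μ b := fun h => hab (μ.injective h)
  have hne : (U ∪ V).Nonempty := ⟨_, hUV ▸ hμa⟩
  have hne' : ∀ z, ((U ∪ V) \ {z}).Nonempty := by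
    intro z
    rw [hUV]
    by_cases hz : μ a = z
    · exact ⟨μ b, hμb, fun h => hμab (hz.trans (Eq.symm h))⟩
    · exact ⟨μ a, hμa, hz⟩
  have hqa : ∀ p ∈ freePositions M, ∀ c ∈ freeApplicants M, (q p).rel c a → c = b := by
    intro p hp c hc hca
    by_contra hcb
    exact (q p).asymm hca (htop p hp c hc ((q p).ne hca) hcb).1
  have hqb : ∀ p ∈ freePositions M, ∀ c ∈ freeApplicants M, (q p).rel c b → c = a := by
    intro p hp c hc hcb
    by_contra hca
    exact (q p).asymm hcb (htop p hp c hc hca ((q p).ne hcb)).2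
  rw [_root_.twoTr]
  rcases exists_play_clinchOrPass a _ _ hne t with ⟨w, hwU, hw, h⟩ | ⟨d, hdV, hd, h⟩
  · rw [h]
    obtain ⟨z, hz, h⟩ := exists_play_clinch b (fun z => .leaf [(a, w), (b, z)]) (hne' w) t
    rw [h]
    rw [hUV] at hw hz
    rw [hU] at hwU
    have haw : μ a = w := by
      refine (hμ.1.eq_or_exists_of_isTop hM subset_rfl hw hμa).resolve_right ?_
      rintro ⟨c, hc, -, hca⟩
      obtain rfl := hqa w hw.1 c hc hca
      exact (q w).asymm hwU.2 hca
    have hbz : μ b = z := by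
      refine (hμ.1.eq_or_exists_of_isTop hM Set.sdiff_subset hz
        ⟨hμb, fun h => hμab (haw.trans (Eq.symm h))⟩).resolve_right ?_
      rintro ⟨c, hc, hcz, hcb⟩
      obtain rfl := hqb z hz.1.1 c hc hcb
      exact hz.1.2 (hcz.symm.trans haw)
    exact hM.append_two haw hbz fun x hx hxw hxz => ⟨hw.2 x hx hxw, hz.2 x ⟨hx, hxw⟩ hxz⟩
  · rw [h]
    obtain ⟨z, hz, h⟩ := exists_play_clinch b (fun z => clinch a ((U ∪ V) \ {z}) fun w =>
      .leaf [(a, w), (b, z)]) hne t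
    rw [h]
    obtain ⟨w, hw, h⟩ := exists_play_clinch a (fun w => .leaf [(a, w), (b, z)]) (hne' z) t
    rw [h]
    rw [hUV] at hd hz hw
    rw [hV] at hdV
    -- Otherwise `a` holds `z`. Then the favorite `d` of `a`, where only `b` has a higher priority,
    -- is held by `b`, and both would gain from swapping.
    have hbz : μ b = z := by
      refine (hμ.1.eq_or_exists_of_isTop hM subset_rfl hz hμb).resolve_right ?_
      rintro ⟨c, hc, hcz, hcb⟩
      obtain rfl := hqb z hz.1 c hc hcb
      rcases hμ.1.eq_or_exists_of_isTop hM subset_rfl hd hμa with h | ⟨e, he, hed, hec⟩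
      · rw [← hcz, h] at hcb
        exact (q d).asymm hdV.2 hcb
      · obtain rfl := hqa d hd.1 e he hec
        have hdz : d ≠ z := fun h => hμab (hcz.trans (h.symm.trans hed.symm))
        refine hμ.not_swap hM hc he (hed ▸ hcz ▸ hd.2 z hz.1 hdz.symm)
          (hed ▸ hcz ▸ hz.2 d hd.1 hdz) ?_ ?_
        · intro x hx hxc hxe hxr
          exact absurd (hqa _ hμb x hx hxr) hxe
        · intro x hx hxc hxe hxr
          exact absurd (hqb _ hμa x hx hxr) hxc
    have haw : μ a = w := by
      refine (hμ.1.eq_or_exists_of_isTop hM Set.sdiff_subset hw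
        ⟨hμa, fun h => hμab (Eq.trans h hbz.symm)⟩).resolve_right ?_
      rintro ⟨c, hc, hcw, hca⟩
      obtain rfl := hqa w hw.1.1 c hc hca
      exact hw.1.2 (hcw.symm.trans hbz)
    exact hM.append_two haw hbz fun x hx hxw hxz => ⟨hw.2 x ⟨hx, hxz⟩ hxw, hz.2 x hx hxz⟩

end Submarket

/-- The properties of two-adjacent-alternating priorities that 3Lu relies on: those free applicants
that may have a higher priority than `a₁`, `a₂` or `a₃` at a free position. -/
structure ThreeLuPriorities {A P : Type u} (q : P → Ranking A) (F : Set A) (X : Set P) (u v : P)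
    (a₁ a₂ a₃ : A) : Prop where
  ne₁₂ : a₁ ≠ a₂
  ne₁₃ : a₁ ≠ a₃
  ne₂₃ : a₂ ≠ a₃
  mem₁ : a₁ ∈ F
  mem₂ : a₂ ∈ F
  mem₃ : a₃ ∈ F
  u₁ : ∀ c ∈ F, ¬ (q u).rel c a₁
  u₂ : ∀ c ∈ F, (q u).rel c a₂ → c = a₁ ∨ c = a₃
  u₃ : ∀ c ∈ F, (q u).rel c a₃ → c = a₁
  v₁ : ∀ c ∈ F, (q v).rel c a₁ → c = a₂
  v₂ : ∀ c ∈ F, ¬ (q v).rel c a₂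
  x₁ : ∀ x ∈ X, ∀ c ∈ F, ¬ (q x).rel c a₁
  x₂ : ∀ x ∈ X, ∀ c ∈ F, (q x).rel c a₂ → c = a₁
  x₃ : ∀ x ∈ X, ∀ c ∈ F, (q x).rel c a₃ → c = a₁ ∨ c = a₂

/-! ### 3Lu agrees with the applicant-optimal matching. -/

section ThreeLu

variable {A P : Type u} [Finite P] {q : P → Ranking A} {t : A → Ranking P} {μ : A ≃ P}
  {M : List (A × P)} {X : Set P} {u v : P} {a₁ a₂ a₃ : A}

theorem Determined.threeLuPassThree (hμ : IsApplicantOptimal q t μ) (hM : Determined t μ M)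
    (hX : X = freePositions M \ {u, v}) (hXne : X.Nonempty) (hu : u ∈ freePositions M)
    (hv : v ∈ freePositions M) (huv : u ≠ v)
    (hq : ThreeLuPriorities q (freeApplicants M) X u v a₁ a₂ a₃)
    (h₁ : (t a₁).IsTop (freePositions M) v) (h₂ : (t a₂).IsTop (freePositions M) u)
    (h₃ : (t a₃).IsTop (X ∪ {u}) u) :
    Determined t μ ((threeLuPassThree X u v a₁ a₂ a₃).play t ++ M) := by
  have hXF : X ⊆ freePositions M := hX ▸ Set.sdiff_subset
  have huX : u ∉ X := by simp [hX]
  have hvX : v ∉ X := by simp [hX]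
  have hFX : ∀ p ∈ freePositions M, p ≠ u → p ≠ v → p ∈ X := by
    intro p hp h h'
    simp [hX, hp, h, h']
  have hXu : X ∪ {u} ⊆ freePositions M := Set.union_subset hXF (by simpa using hu)
  have hXv : X ∪ {v} ⊆ freePositions M := Set.union_subset hXF (by simpa using hv)
  have hμ₁ := (hM.mem_freePositions_iff a₁).2 hq.mem₁
  have hμ₂ := (hM.mem_freePositions_iff a₂).2 hq.mem₂
  have hμ₃ := (hM.mem_freePositions_iff a₃).2 hq.mem₃
  have hne₁₂ : μ a₁ ≠ μ a₂ := fun h => hq.ne₁₂ (μ.injective h)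
  have hne₁₃ : μ a₁ ≠ μ a₃ := fun h => hq.ne₁₃ (μ.injective h)
  have hne₂₃ : μ a₂ ≠ μ a₃ := fun h => hq.ne₂₃ (μ.injective h)
  -- Since `v` is the favorite of `a₁`, and only `a₂` precedes `a₁` there, nobody else can hold it.
  have hv₁ : μ a₁ = v ∨ μ a₂ = v := by
    refine (hμ.1.eq_or_exists_of_isTop hM subset_rfl h₁ hμ₁).imp_right ?_
    rintro ⟨c, hc, hcv, hca⟩
    exact hq.v₁ c hc hca ▸ hcv
  have hμ₃v : μ a₃ ≠ v := fun h => hv₁.elim (fun h' => hne₁₃ (h'.trans h.symm))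
    fun h' => hne₂₃ (h'.trans h.symm)
  have hμ₃X : μ a₃ ∈ X ∪ {u} := by
    by_cases h : μ a₃ = u
    · exact Or.inr h
    · exact Or.inl (hFX _ hμ₃ h hμ₃v)
  -- At this point `a₃` wants `u` most among `X ∪ {u}` and precedes `a₂` there, so `u` goes to `a₃`
  -- or to `a₁`, the only one ahead of `a₃`.
  have hμ₂u : μ a₂ ≠ u := by
    intro h
    rcases hμ.1.eq_or_exists_of_isTop hM hXu h₃ hμ₃X with h' | ⟨c, hc, hcu, hca⟩
    · exact hne₂₃ (h.trans h'.symm)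
    · obtain rfl := hq.u₃ c hc hca
      exact hne₁₂ (hcu.trans h.symm)
  have hu₂ : μ a₁ = u ∨ μ a₃ = u := by
    rcases hμ.1.eq_or_exists_of_isTop hM subset_rfl h₂ hμ₂ with h' | ⟨c, hc, hcu, hca⟩
    · exact absurd h' hμ₂u
    · rcases hq.u₂ c hc hca with rfl | rfl
      · exact Or.inl hcu
      · exact Or.inr hcu
  have hμ₂X : μ a₂ ∈ X ∪ {v} := by
    by_cases h : μ a₂ = v
    · exact Or.inr h
    · exact Or.inl (hFX _ hμ₂ hμ₂u h)
  unfold _root_.threeLuPassThree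
  obtain ⟨p, hp, h⟩ := exists_play_clinch a₂ (fun p =>
    open Classical in
    if p = v then
      clinch a₁ (X ∪ {u}) fun w =>
        if w = u then clinch a₃ X fun z => .leaf [(a₁, u), (a₂, v), (a₃, z)]
        else .leaf [(a₁, w), (a₂, v), (a₃, u)]
    else .leaf [(a₁, v), (a₂, p), (a₃, u)]) (hXne.inl (t := {v})) t
  rw [h]
  by_cases hpv : p = v
  · rw [if_pos hpv]
    subst hpv
    have hμ₂' : μ a₂ = p := by
      refine (hμ.1.eq_or_exists_of_isTop hM hXv hp hμ₂X).resolve_right ?_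
      rintro ⟨c, hc, -, hca⟩
      exact hq.v₂ c hc hca
    have hμ₁X : μ a₁ ∈ X ∪ {u} := by
      by_cases h : μ a₁ = u
      · exact Or.inr h
      · exact Or.inl (hFX _ hμ₁ h (hμ₂' ▸ hne₁₂))
    obtain ⟨w, hw, h⟩ := exists_play_clinch a₁ (fun w =>
      open Classical in
      if w = u then clinch a₃ X fun z => .leaf [(a₁, u), (a₂, p), (a₃, z)]
        else .leaf [(a₁, w), (a₂, p), (a₃, u)]) (hXne.inl (t := {u})) t
    rw [h]
    have hμ₁' : μ a₁ = w := by
      refine (hμ.1.eq_or_exists_of_isTop hM hXu hw hμ₁X).resolve_right ?_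
      rintro ⟨c, hc, -, hca⟩
      rcases hw.1 with hwX | rfl
      · exact hq.x₁ w hwX c hc hca
      · exact hq.u₁ c hc hca
    by_cases hwu : w = u
    · rw [if_pos hwu]
      subst hwu
      obtain ⟨z, hz, h⟩ := exists_play_clinch a₃ (fun z => .leaf [(a₁, w), (a₂, p), (a₃, z)]) hXne t
      rw [h]
      have hμ₃' : μ a₃ = z := by
        refine (hμ.1.eq_or_exists_of_isTop hM hXF hz
          (hFX _ hμ₃ (hμ₁' ▸ hne₁₃.symm) hμ₃v)).resolve_right ?_
        rintro ⟨c, hc, hcz, hca⟩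
        rcases hq.x₃ z hz.1 c hc hca with rfl | rfl
        · exact huX (hμ₁' ▸ hcz ▸ hz.1)
        · exact hvX (hμ₂' ▸ hcz ▸ hz.1)
      refine hM.append_three hμ₁' hμ₂' hμ₃' fun x hx hxu hxv hxz => ?_
      have hxX := hFX x hx hxu hxv
      exact ⟨hw.2 x (Or.inl hxX) hxu, hp.2 x (Or.inl hxX) hxv, hz.2 x hxX hxz⟩
    · rw [if_neg hwu]
      have hμ₃' : μ a₃ = u := hu₂.resolve_left fun h => hwu (hμ₁'.symm.trans h)
      refine hM.append_three hμ₁' hμ₂' hμ₃' fun x hx hxw hxv hxu => ?_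
      have hxX := hFX x hx hxu hxv
      exact ⟨hw.2 x (Or.inl hxX) hxw, hp.2 x (Or.inl hxX) hxv, h₃.2 x (Or.inl hxX) hxu⟩
  · rw [if_neg hpv]
    have hpX : p ∈ X := hp.1.resolve_right hpv
    have hμ₂' : μ a₂ = p := by
      refine (hμ.1.eq_or_exists_of_isTop hM hXv hp hμ₂X).resolve_right ?_
      rintro ⟨c, hc, hcp, hca⟩
      obtain rfl := hq.x₂ p hpX c hc hca
      have h2 : μ a₂ = v := hv₁.resolve_left fun h => hpv (hcp.symm.trans h)
      -- If `a₁` held `p`, then `a₂` would hold `v`, and each would prefer the match of the other.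
      refine hμ.not_swap hM hc hq.mem₂ (h2 ▸ hcp ▸ h₁.2 p (hXF hpX) hpv)
        (h2 ▸ hcp ▸ hp.2 v (Or.inr rfl) (Ne.symm hpv)) ?_ ?_
      · intro d hd _ hd₂ hdq
        rw [h2] at hdq
        exact absurd (hq.v₁ d hd hdq) hd₂
      · intro d hd hd₁ _ hdq
        rw [hcp] at hdq
        exact absurd (hq.x₂ p hpX d hd hdq) hd₁
    have hμ₁' : μ a₁ = v := hv₁.resolve_right fun h => hpv (hμ₂'.symm.trans h)
    have hμ₃' : μ a₃ = u := hu₂.resolve_left fun h => huv (h.symm.trans hμ₁')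
    refine hM.append_three hμ₁' hμ₂' hμ₃' fun x hx hxv hxp hxu => ?_
    have hxX := hFX x hx hxu hxv
    exact ⟨h₁.2 x hx hxv, hp.2 x (Or.inl hxX) hxp, h₃.2 x (Or.inl hxX) hxu⟩

theorem Determined.threeLuPassTwo (hμ : IsApplicantOptimal q t μ) (hM : Determined t μ M)
    (hX : X = freePositions M \ {u, v}) (hXne : X.Nonempty) (hu : u ∈ freePositions M)
    (hv : v ∈ freePositions M) (huv : u ≠ v)
    (hq : ThreeLuPriorities q (freeApplicants M) X u v a₁ a₂ a₃)
    (h₁ : (t a₁).IsTop (freePositions M) v) (h₂ : (t a₂).IsTop (freePositions M) u) :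
    Determined t μ ((threeLuPassTwo X u v a₁ a₂ a₃).play t ++ M) := by
  have hXF : X ⊆ freePositions M := hX ▸ Set.sdiff_subset
  have huX : u ∉ X := by simp [hX]
  have hvX : v ∉ X := by simp [hX]
  have hFX : ∀ p ∈ freePositions M, p ≠ u → p ≠ v → p ∈ X := by
    intro p hp h h'
    simp [hX, hp, h, h']
  have hXu : X ∪ {u} ⊆ freePositions M := Set.union_subset hXF (by simpa using hu)
  have hμ₁ := (hM.mem_freePositions_iff a₁).2 hq.mem₁
  have hμ₂ := (hM.mem_freePositions_iff a₂).2 hq.mem₂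
  have hμ₃ := (hM.mem_freePositions_iff a₃).2 hq.mem₃
  have hne₁₂ : μ a₁ ≠ μ a₂ := fun h => hq.ne₁₂ (μ.injective h)
  have hne₁₃ : μ a₁ ≠ μ a₃ := fun h => hq.ne₁₃ (μ.injective h)
  have hne₂₃ : μ a₂ ≠ μ a₃ := fun h => hq.ne₂₃ (μ.injective h)
  have hv₁ : μ a₁ = v ∨ μ a₂ = v := by
    refine (hμ.1.eq_or_exists_of_isTop hM subset_rfl h₁ hμ₁).imp_right ?_
    rintro ⟨c, hc, hcv, hca⟩
    exact hq.v₁ c hc hca ▸ hcv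
  have hu₂ : μ a₂ = u ∨ μ a₁ = u ∨ μ a₃ = u := by
    rcases hμ.1.eq_or_exists_of_isTop hM subset_rfl h₂ hμ₂ with h' | ⟨c, hc, hcu, hca⟩
    · exact Or.inl h'
    · rcases hq.u₂ c hc hca with rfl | rfl
      · exact Or.inr (Or.inl hcu)
      · exact Or.inr (Or.inr hcu)
  have hμ₃v : μ a₃ ≠ v := fun h => hv₁.elim (fun h' => hne₁₃ (h'.trans h.symm))
    fun h' => hne₂₃ (h'.trans h.symm)
  have hμ₃X : μ a₃ ∈ X ∪ {u} := by
    by_cases h : μ a₃ = u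
    · exact Or.inr h
    · exact Or.inl (hFX _ hμ₃ h hμ₃v)
  rcases exists_play_clinchOrPass a₃ (fun p => .leaf [(a₁, v), (a₂, u), (a₃, p)])
    (_root_.threeLuPassThree X u v a₁ a₂ a₃) (hXne.inl (t := {u})) t
    with ⟨p, hpX, hp, h⟩ | ⟨d, rfl, hd, h⟩
  swap
  · rw [_root_.threeLuPassTwo, h]
    exact hM.threeLuPassThree hμ hX hXne hu hv huv hq h₁ h₂ hd
  rw [_root_.threeLuPassTwo, h]
  have hpu : p ≠ u := fun h => huX (h ▸ hpX)
  have hpv : p ≠ v := fun h => hvX (h ▸ hpX)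
  have hx₃ : μ a₃ = p ∨ μ a₁ = p ∨ μ a₂ = p := by
    rcases hμ.1.eq_or_exists_of_isTop hM hXu hp hμ₃X with h' | ⟨c, hc, hcu, hca⟩
    · exact Or.inl h'
    · rcases hq.x₃ p hpX c hc hca with rfl | rfl
      · exact Or.inr (Or.inl hcu)
      · exact Or.inr (Or.inr hcu)
  have t1 : (t a₁).rel v u := h₁.2 u hu huv
  have t1' : (t a₁).rel v p := h₁.2 p (hXF hpX) hpv
  have t2 : (t a₂).rel u v := h₂.2 v hv huv.symm
  have t2' : (t a₂).rel u p := h₂.2 p (hXF hpX) hpu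
  have t3 : (t a₃).rel p u := hp.2 u (Or.inr rfl) hpu.symm
  -- The favorites `v`, `u`, `p` can only be distributed among the three applicants themselves. Each
  -- distribution other than the intended one that is compatible with the priorities admits an
  -- improving trade: two are excluded by a swap, the third by a rotation.
  have key : μ a₁ = v ∧ μ a₂ = u ∧ μ a₃ = p := by
    rcases hv₁ with e₁ | e₂
    · rcases hu₂ with e₂ | e | e₃
      · refine ⟨e₁, e₂, hx₃.resolve_right ?_⟩
        rintro (h | h)
        · exact hpv (h.symm.trans e₁)
        · exact hpu (h.symm.trans e₂)
      · exact absurd (e.symm.trans e₁) huv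
      · exfalso
        have e₂ : μ a₂ = p := (hx₃.resolve_left fun h => hpu (h.symm.trans e₃)).resolve_left
          fun h => hpv (h.symm.trans e₁)
        refine hμ.not_swap hM hq.mem₂ hq.mem₃ (by rwa [e₂, e₃]) (by rwa [e₂, e₃]) ?_ ?_
        · intro d hd _ hd₃ hdq
          rw [e₃] at hdq ⊢
          obtain rfl := (hq.u₂ d hd hdq).resolve_right hd₃
          rwa [e₁]
        · intro d hd hd₂ _ hdq
          rw [e₂] at hdq ⊢
          obtain rfl := (hq.x₃ p hpX d hd hdq).resolve_right hd₂
          rwa [e₁]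
    · exfalso
      rcases hu₂ with e | e₁ | e₃
      · exact huv (e.symm.trans e₂)
      · have e₃ : μ a₃ = p := by
          refine hx₃.resolve_right ?_
          rintro (h | h)
          · exact hpu (h.symm.trans e₁)
          · exact hpv (h.symm.trans e₂)
        refine hμ.not_swap hM hq.mem₁ hq.mem₂ (by rwa [e₁, e₂]) (by rwa [e₁, e₂]) ?_ ?_
        · intro d hd _ hd₂ hdq
          rw [e₂] at hdq
          exact absurd (hq.v₁ d hd hdq) hd₂
        · intro d hd hd₁ _ hdq
          rw [e₁] at hdq ⊢
          obtain rfl := (hq.u₂ d hd hdq).resolve_left hd₁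
          rwa [e₃]
      · have e₁ : μ a₁ = p := (hx₃.resolve_left fun h => hpu (h.symm.trans e₃)).resolve_right
          fun h => hpv (h.symm.trans e₂)
        refine hμ.not_rotation hM hq.ne₁₂ hq.ne₂₃ hq.ne₁₃ hq.mem₁ hq.mem₂ hq.mem₃
          (by rwa [e₁, e₂]) (by rwa [e₂, e₃]) (by rwa [e₁, e₃]) ?_ ?_ ?_
        · intro d hd hdq
          exact hq.v₁ d hd (e₂ ▸ hdq)
        · intro d hd hdq
          exact (hq.u₂ d hd (e₃ ▸ hdq)).imp_left fun h => ⟨h, by rwa [e₂, e₃]⟩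
        · intro d hd hdq
          exact (hq.x₃ p hpX d hd (e₁ ▸ hdq)).imp_right fun h => ⟨h, by rwa [e₁, e₃]⟩
  refine hM.append_three key.1 key.2.1 key.2.2 fun x hx hxv hxu hxp => ?_
  exact ⟨h₁.2 x hx hxv, h₂.2 x hx hxu, hp.2 x (Or.inl (hFX x hx hxu hxv)) hxp⟩

theorem Determined.threeLuPassOne (hμ : IsApplicantOptimal q t μ) (hM : Determined t μ M)
    (hX : X = freePositions M \ {u, v}) (hXne : X.Nonempty) (hu : u ∈ freePositions M)
    (hv : v ∈ freePositions M) (huv : u ≠ v)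
    (hq : ThreeLuPriorities q (freeApplicants M) X u v a₁ a₂ a₃)
    (h₁ : (t a₁).IsTop (freePositions M) v) :
    Determined t μ ((threeLuPassOne X u v a₁ a₂ a₃).play t ++ M) := by
  have hXF : X ⊆ freePositions M := hX ▸ Set.sdiff_subset
  have hFX : ∀ p ∈ freePositions M, p ≠ u → p ≠ v → p ∈ X := by
    intro p hp h h'
    simp [hX, hp, h, h']
  have hXu : X ∪ {u} ⊆ freePositions M := Set.union_subset hXF (by simpa using hu)
  have hall : X ∪ {v} ∪ {u} = freePositions M := by
    refine subset_antisymm (Set.union_subset (Set.union_subset hXF (by simpa using hv))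
      (by simpa using hu)) fun p hp => ?_
    by_cases h : p = u
    · exact Or.inr h
    by_cases h' : p = v
    · exact Or.inl (Or.inr h')
    · exact Or.inl (Or.inl (hFX p hp h h'))
  have hμ₁ := (hM.mem_freePositions_iff a₁).2 hq.mem₁
  have hμ₂ := (hM.mem_freePositions_iff a₂).2 hq.mem₂
  have hne₁₂ : μ a₁ ≠ μ a₂ := fun h => hq.ne₁₂ (μ.injective h)
  have hv₁ : μ a₁ = v ∨ μ a₂ = v := by
    refine (hμ.1.eq_or_exists_of_isTop hM subset_rfl h₁ hμ₁).imp_right ?_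
    rintro ⟨c, hc, hcv, hca⟩
    exact hq.v₁ c hc hca ▸ hcv
  rcases exists_play_clinchOrPass a₂ (fun p =>
      open Classical in
      if p = v then clinch a₁ (X ∪ {u}) fun w => .leaf [(a₁, w), (a₂, v)]
      else .leaf [(a₁, v), (a₂, p)])
    (_root_.threeLuPassTwo X u v a₁ a₂ a₃) (hXne.inl.inl (t := {u}) (s := X ∪ {v})) t
    with ⟨p, hpX, hp, h⟩ | ⟨d, rfl, hd, h⟩
  swap
  · rw [_root_.threeLuPassOne, h]
    exact hM.threeLuPassTwo hμ hX hXne hu hv huv hq h₁ (hall ▸ hd)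
  rw [_root_.threeLuPassOne, h]
  rw [hall] at hp
  by_cases hpv : p = v
  · rw [if_pos hpv]
    subst hpv
    have hμ₂' : μ a₂ = p := by
      refine (hμ.1.eq_or_exists_of_isTop hM subset_rfl hp hμ₂).resolve_right ?_
      rintro ⟨c, hc, -, hca⟩
      exact hq.v₂ c hc hca
    have hμ₁X : μ a₁ ∈ X ∪ {u} := by
      by_cases h : μ a₁ = u
      · exact Or.inr h
      · exact Or.inl (hFX _ hμ₁ h (hμ₂' ▸ hne₁₂))
    obtain ⟨w, hw, h⟩ := exists_play_clinch a₁ (fun w => .leaf [(a₁, w), (a₂, p)])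
      (hXne.inl (t := {u})) t
    rw [h]
    have hμ₁' : μ a₁ = w := by
      refine (hμ.1.eq_or_exists_of_isTop hM hXu hw hμ₁X).resolve_right ?_
      rintro ⟨c, hc, -, hca⟩
      rcases hw.1 with hwX | rfl
      · exact hq.x₁ w hwX c hc hca
      · exact hq.u₁ c hc hca
    refine hM.append_two hμ₁' hμ₂' fun x hx hxw hxv => ⟨hw.2 x ?_ hxw, hp.2 x hx hxv⟩
    by_cases h : x = u
    · exact Or.inr h
    · exact Or.inl (hFX _ hx h hxv)
  · rw [if_neg hpv]
    replace hpX : p ∈ X := hpX.resolve_right hpv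
    have hμ₂' : μ a₂ = p := by
      refine (hμ.1.eq_or_exists_of_isTop hM subset_rfl hp hμ₂).resolve_right ?_
      rintro ⟨c, hc, hcp, hca⟩
      obtain rfl := hq.x₂ p hpX c hc hca
      have h2 : μ a₂ = v := hv₁.resolve_left fun h => hpv (hcp.symm.trans h)
      refine hμ.not_swap hM hc hq.mem₂ (h2 ▸ hcp ▸ h₁.2 p (hXF hpX) hpv)
        (h2 ▸ hcp ▸ hp.2 v hv (Ne.symm hpv)) ?_ ?_
      · intro d hd _ hd₂ hdq
        rw [h2] at hdq
        exact absurd (hq.v₁ d hd hdq) hd₂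
      · intro d hd hd₁ _ hdq
        rw [hcp] at hdq
        exact absurd (hq.x₂ p hpX d hd hdq) hd₁
    have hμ₁' : μ a₁ = v := hv₁.resolve_right fun h => hpv (hμ₂'.symm.trans h)
    exact hM.append_two hμ₁' hμ₂' fun x hx hxv hxp => ⟨h₁.2 x hx hxv, hp.2 x hx hxp⟩

theorem Determined.threeLu (hμ : IsApplicantOptimal q t μ) (hM : Determined t μ M)
    (hX : X = freePositions M \ {u, v}) (hXne : X.Nonempty) (hu : u ∈ freePositions M)
    (hv : v ∈ freePositions M) (huv : u ≠ v)
    (hq : ThreeLuPriorities q (freeApplicants M) X u v a₁ a₂ a₃) :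
    Determined t μ ((threeLu X u v a₁ a₂ a₃).play t ++ M) := by
  have hXF : X ⊆ freePositions M := hX ▸ Set.sdiff_subset
  have hall : X ∪ {u} ∪ {v} = freePositions M := by
    refine subset_antisymm (Set.union_subset (Set.union_subset hXF (by simpa using hu))
      (by simpa using hv)) fun p hp => ?_
    by_cases h : p = u
    · exact Or.inl (Or.inr h)
    by_cases h' : p = v
    · exact Or.inr h'
    · exact Or.inl (Or.inl (by simp [hX, hp, h, h']))
  have hμ₁ := (hM.mem_freePositions_iff a₁).2 hq.mem₁
  rcases exists_play_clinchOrPass a₁ (fun p => .leaf [(a₁, p)])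
    (_root_.threeLuPassOne X u v a₁ a₂ a₃) (hXne.inl.inl (t := {v}) (s := X ∪ {u})) t
    with ⟨p, hpX, hp, h⟩ | ⟨d, rfl, hd, h⟩
  swap
  · rw [threeLu_eq, h]
    exact hM.threeLuPassOne hμ hX hXne hu hv huv hq (hall ▸ hd)
  rw [threeLu_eq, h]
  rw [hall] at hp
  refine hM.append_one ?_ hp.2
  refine (hμ.1.eq_or_exists_of_isTop hM subset_rfl hp hμ₁).resolve_right ?_
  rintro ⟨c, hc, -, hca⟩
  rcases hpX with hpX | rfl
  · exact hq.x₁ p hpX c hc hca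
  · exact hq.u₁ c hc hca

end ThreeLu

/-- Two-adjacent-alternating priorities have the form that 3Lu relies on. -/
theorem AlternatingWith.threeLuPriorities {A P : Type u} {q : P → Ranking A} {F : Set A}
    {R X : Set P} {k : ℕ} {l : Fin k → A} {u v : P} (halt : AlternatingWith q R l u v)
    (hk : 3 ≤ k) (hl : Function.Injective l) (hlF : ∀ i, l i ∈ F)
    (htop : ∀ p ∈ R, ∀ c ∈ F, c ∉ Set.range l → ∀ i, (q p).rel (l i) c) (hX : X = R \ {u, v}) :
    ThreeLuPriorities q F X u v (l ⟨0, by omega⟩) (l ⟨1, by omega⟩) (l ⟨2, by omega⟩) := by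
  obtain ⟨hu, hv, -, hqu, hqv, hqx⟩ := halt
  have hlab : ∀ p ∈ R, ∀ c ∈ F, ∀ i, (q p).rel c (l i) → ∃ j, c = l j := by
    intro p hp c hc i hci
    by_contra! hno
    exact (q p).asymm hci (htop p hp c hc (fun ⟨j, hj⟩ => hno j hj.symm) i)
  have hXR : ∀ x ∈ X, x ∈ R ∧ x ≠ u ∧ x ≠ v := fun x hx => by
    rw [hX] at hx
    simpa using hx
  have heq : ∀ (j : Fin k) n (hn : n < k), (j : ℕ) = n → l j = l ⟨n, hn⟩ := fun j n hn h =>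
    congrArg l (Fin.ext h)
  refine ⟨?_, ?_, ?_, hlF _, hlF _, hlF _, ?_, ?_, ?_, ?_, ?_, ?_, ?_, ?_⟩
  · exact fun h => absurd (hl h) (by simp)
  · exact fun h => absurd (hl h) (by simp)
  · exact fun h => absurd (hl h) (by simp)
  · intro c hc h
    obtain ⟨j, rfl⟩ := hlab u hu c hc _ h
    have := (hqu _ _).1 h
    simp only [FlipLt] at this
    rcases this with h' | h'
    · omega
    · exact absurd h'.1 (by decide)
  · intro c hc h
    obtain ⟨j, rfl⟩ := hlab u hu c hc _ h
    have := (hqu _ _).1 h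
    simp only [FlipLt] at this
    rcases this with h' | h'
    · exact Or.inl (heq j 0 _ (by omega))
    · exact Or.inr (heq j 2 _ (by omega))
  · intro c hc h
    obtain ⟨j, rfl⟩ := hlab u hu c hc _ h
    have := (hqu _ _).1 h
    simp only [FlipLt] at this
    refine heq j 0 _ ?_
    rcases this with ⟨h1, h2⟩ | ⟨h1, h2⟩
    · by_contra hj
      have hj : (j : ℕ) = 1 := by omega
      rw [hj] at h2
      exact h2 ⟨odd_one, rfl⟩
    · exact absurd h1 (by decide)
  · intro c hc h
    obtain ⟨j, rfl⟩ := hlab v hv c hc _ h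
    have := (hqv _ _).1 h
    simp only [FlipLt] at this
    exact heq j 1 _ (by omega)
  · intro c hc h
    obtain ⟨j, rfl⟩ := hlab v hv c hc _ h
    have := (hqv _ _).1 h
    simp only [FlipLt] at this
    rcases this with ⟨h1, h2⟩ | ⟨h1, h2⟩
    · have hj : (j : ℕ) = 0 := by omega
      rw [hj] at h2
      exact h2 ⟨Even.zero, rfl⟩
    · exact absurd h1 (by decide)
  · intro x hx c hc h
    obtain ⟨hxR, hxu, hxv⟩ := hXR x hx
    obtain ⟨j, rfl⟩ := hlab x hxR c hc _ h
    have := (hqx x hxR hxu hxv _ _).1 h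
    rw [Fin.lt_def] at this
    simp at this
  · intro x hx c hc h
    obtain ⟨hxR, hxu, hxv⟩ := hXR x hx
    obtain ⟨j, rfl⟩ := hlab x hxR c hc _ h
    have := (hqx x hxR hxu hxv _ _).1 h
    rw [Fin.lt_def] at this
    exact heq j 0 _ (by simp only at this; omega)
  · intro x hx c hc h
    obtain ⟨hxR, hxu, hxv⟩ := hXR x hx
    obtain ⟨j, rfl⟩ := hlab x hxR c hc _ h
    have := (hqx x hxR hxu hxv _ _).1 h
    rw [Fin.lt_def] at this
    simp only at this
    by_cases hj : (j : ℕ) = 0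
    · exact Or.inl (heq j 0 _ hj)
    · exact Or.inr (heq j 1 _ (by omega))

/-- `Determined` is the invariant: each stage, played truthfully, extends a determined list to a
determined list. -/
theorem IsComposed.play_eq {A P : Type u} [Finite P] {q : P → Ranking A} {M : List (A × P)}
    {G : GameTree A (matchingEnv A P).Ty (matchingEnv A P).Outcome} (hG : IsComposed q M G)
    {t : A → Ranking P} {μ : A ≃ P} (hμ : IsApplicantOptimal q t μ) (hM : Determined t μ M) :
    G.play t = μ := by
  induction hG with
  | done M ν h =>
    exact Equiv.ext fun a => (hM a (ν a) ((h a _).2 rfl)).1.symm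
  | one M a ha htop cont _ ih =>
    refine (GameTree.play_bind _ _ _).trans ?_
    exact ih _ (GameTree.play_mem_outcomes _ t) (hM.oneTr hμ ha htop)
  | two M a b ha hb hab htop U V hU hV cont _ ih =>
    refine (GameTree.play_bind _ _ _).trans ?_
    exact ih _ (GameTree.play_mem_outcomes _ t) (hM.twoTr hμ ha hb hab htop hU hV)
  | three M k hk l hl hfree htop X u v halt hX hXne cont _ ih =>
    refine (GameTree.play_bind _ _ _).trans ?_
    exact ih _ (GameTree.play_mem_outcomes _ t) (hM.threeLu hμ hX hXne halt.1 halt.2.1 halt.2.2.1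
      (halt.threeLuPriorities hk hl hfree htop hX))

theorem IsComposed.apply_eq {A P : Type u} [Finite P] {q : P → Ranking A} {M : List (A × P)}
    {G : GameTree A (matchingEnv A P).Ty (matchingEnv A P).Outcome} (hG : IsComposed q M G)
    {μ : A ≃ P} (hμ : μ ∈ G.outcomes) {a : A} {p : P} (hap : (a, p) ∈ M) : μ a = p := by
  induction hG with
  | done M ν h =>
    obtain rfl : μ = ν := hμ
    exact (h a p).1 hap
  | one M a ha htop cont _ ih =>
    obtain ⟨M', hM', h⟩ := (GameTree.mem_outcomes_bind _ _ _).1 hμ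
    exact ih M' hM' h (List.mem_append_right _ hap)
  | two M a b ha hb hab htop U V hU hV cont _ ih =>
    obtain ⟨M', hM', h⟩ := (GameTree.mem_outcomes_bind _ _ _).1 hμ
    exact ih M' hM' h (List.mem_append_right _ hap)
  | three M k hk l hl hfree htop X u v halt hX hXne cont _ ih =>
    obtain ⟨M', hM', h⟩ := (GameTree.mem_outcomes_bind _ _ _).1 hμ
    exact ih M' hM' h (List.mem_append_right _ hap)

/-! ### Existence of compositions -/

/-- No applicant and no position occurs in two different pairs of `M`. -/
def IsPartialMatching {A P : Type u} (M : List (A × P)) : Prop :=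
  ∀ x ∈ M, ∀ y ∈ M, x.1 = y.1 ↔ x.2 = y.2

namespace IsPartialMatching

variable {A P : Type u} {M M' : List (A × P)}

theorem nil : IsPartialMatching ([] : List (A × P)) := fun _ h => by simp at h

theorem append (hM : IsPartialMatching M) (hM' : IsPartialMatching M')
    (h : ∀ x ∈ M', x.1 ∈ freeApplicants M ∧ x.2 ∈ freePositions M) :
    IsPartialMatching (M' ++ M) := by
  have hne : ∀ x ∈ M', ∀ y ∈ M, x.1 ≠ y.1 ∧ x.2 ≠ y.2 := fun x hx y hy =>
    ⟨fun e => (h x hx).1 y.2 (by rw [e]; exact hy), fun e => (h x hx).2 y.1 (by rw [e]; exact hy)⟩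
  intro x hx y hy
  rcases List.mem_append.1 hx with hx | hx <;> rcases List.mem_append.1 hy with hy | hy
  · exact hM' x hx y hy
  · exact iff_of_false (hne x hx y hy).1 (hne x hx y hy).2
  · exact iff_of_false (hne y hy x hx).1.symm (hne y hy x hx).2.symm
  · exact hM x hx y hy

theorem cons (hM : IsPartialMatching M) {a : A} {p : P} (h : ∀ x ∈ M, a ≠ x.1 ∧ p ≠ x.2) :
    IsPartialMatching ((a, p) :: M) := by
  intro x hx y hy
  rcases List.mem_cons.1 hx with rfl | hx <;> rcases List.mem_cons.1 hy with rfl | hy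
  · simp
  · exact iff_of_false (h y hy).1 (h y hy).2
  · exact iff_of_false (h x hx).1.symm (h x hx).2.symm
  · exact hM x hx y hy

theorem one (a : A) (p : P) : IsPartialMatching [(a, p)] := nil.cons (by simp)

theorem two {a b : A} {p r : P} (hab : a ≠ b) (hpr : p ≠ r) :
    IsPartialMatching [(a, p), (b, r)] := (one b r).cons (by simp [hab, hpr])

theorem three {a b c : A} {p r s : P} (hab : a ≠ b) (hac : a ≠ c) (hbc : b ≠ c) (hpr : p ≠ r)
    (hps : p ≠ s) (hrs : r ≠ s) : IsPartialMatching [(a, p), (b, r), (c, s)] :=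
  (two hbc hrs).cons (by simp [hab, hac, hpr, hps])

theorem ncard_freePositions [Fintype A] [Fintype P] (hcard : Fintype.card A = Fintype.card P)
    (hM : IsPartialMatching M) : (freePositions M).ncard = (freeApplicants M).ncard := by
  have h1 : freeApplicants M = (Prod.fst '' {x | x ∈ M})ᶜ := by
    ext a
    simp [freeApplicants]
  have h2 : freePositions M = (Prod.snd '' {x | x ∈ M})ᶜ := by
    ext p
    simp [freePositions]
  have h3 : (Prod.fst '' {x | x ∈ M}).ncard = {x | x ∈ M}.ncard :=
    Set.InjOn.ncard_image fun x hx y hy h => Prod.ext h ((hM x hx y hy).1 h)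
  have h4 : (Prod.snd '' {x | x ∈ M}).ncard = {x | x ∈ M}.ncard :=
    Set.InjOn.ncard_image fun x hx y hy h => Prod.ext ((hM x hx y hy).2 h) h
  have h5 := Set.ncard_add_ncard_compl (Prod.fst '' {x | x ∈ M})
  have h6 := Set.ncard_add_ncard_compl (Prod.snd '' {x | x ∈ M})
  rw [Nat.card_eq_fintype_card] at h5 h6
  rw [h1, h2]
  omega

end IsPartialMatching

/-- Some stage of a composition can be run after the matches `M`. -/
def HasStage {A P : Type u} [Finite P] (q : P → Ranking A) (M : List (A × P)) : Prop :=
  ∃ G : SubMech A P, ObviouslyTruthfulSub G ∧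
    (∀ M' ∈ G.outcomes, M' ≠ [] ∧ IsPartialMatching M' ∧
      ∀ x ∈ M', x.1 ∈ freeApplicants M ∧ x.2 ∈ freePositions M) ∧
    ∀ cont : List (A × P) → GameTree A (matchingEnv A P).Ty (matchingEnv A P).Outcome,
      (∀ M' ∈ G.outcomes, IsComposed q (M' ++ M) (cont M')) → IsComposed q M (G.bind cont)

/-- Induction on the number of free applicants, which every stage decreases. Lists that are not
outcomes of the stage get an arbitrary continuation. -/
theorem exists_isComposed {A P : Type u} [Fintype A] [Fintype P] {q : P → Ranking A}
    {M : List (A × P)} (hcard : Fintype.card A = Fintype.card P)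
    (hstage : ∀ M : List (A × P), IsPartialMatching M → (freeApplicants M).Nonempty →
      HasStage q M) (hM : IsPartialMatching M) :
    ∃ G : GameTree A (matchingEnv A P).Ty (matchingEnv A P).Outcome,
      IsComposed q M G ∧ ObviouslyTruthful (matchingEnv A P) G := by
  induction hn : (freeApplicants M).ncard using Nat.strong_induction_on generalizing M with
  | _ n ih =>
    subst hn
    rcases (freeApplicants M).eq_empty_or_nonempty with h0 | h0
    · have hex : ∀ a, ∃ p, (a, p) ∈ M := by
        intro a
        have : a ∉ freeApplicants M := by simp [h0]
        simpa [freeApplicants] using this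
      choose f hf using hex
      have hinj : Function.Injective f := fun a b h => (hM _ (hf a) _ (hf b)).2 h
      refine ⟨.leaf (Equiv.ofBijective f ((Fintype.bijective_iff_injective_and_card f).2
        ⟨hinj, hcard⟩)), .done M _ fun a p => ⟨fun h => ?_, fun h => ?_⟩, trivial⟩
      · exact (hM _ (hf a) _ h).1 rfl
      · exact (show f a = p from h) ▸ hf a
    · obtain ⟨G, hG, hout, hcomp⟩ := hstage M hM h0
      have hex : ∀ M', ∃ C : GameTree A (matchingEnv A P).Ty (matchingEnv A P).Outcome,
          M' ∈ G.outcomes → IsComposed q (M' ++ M) C ∧ ObviouslyTruthful (matchingEnv A P) C := by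
        intro M'
        by_cases hM' : M' ∈ G.outcomes
        · obtain ⟨hne, hPM, hfree⟩ := hout M' hM'
          obtain ⟨x, hx⟩ := List.exists_mem_of_ne_nil M' hne
          have hlt : freeApplicants (M' ++ M) ⊂ freeApplicants M :=
            ⟨fun a ha p hp => ha p (List.mem_append_right _ hp), fun h =>
              h (hfree x hx).1 x.2 (List.mem_append_left _ hx)⟩
          obtain ⟨C, hC⟩ := ih _ (Set.ncard_lt_ncard hlt) (hM.append hPM hfree) rfl
          exact ⟨C, fun _ => hC⟩
        · exact ⟨.leaf (Fintype.equivOfCardEq hcard), fun h => absurd h hM'⟩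
      choose cont hcont using hex
      refine ⟨_, hcomp cont fun M' hM' => (hcont M' hM').1, hG.bind fun M' hM' => ?_⟩
      exact ⟨(hcont M' hM').2, fun μ hμ a p hap =>
        (hcont M' hM').1.apply_eq hμ (List.mem_append_left _ hap)⟩

/-! ### Conditions under which each stage is available. -/

section Stages

variable {A P : Type u} [Finite P] {q : P → Ranking A} {M : List (A × P)}

theorem hasStage_one (hne : (freePositions M).Nonempty) {a : A} (ha : a ∈ freeApplicants M)
    (htop : ∀ p ∈ freePositions M, ∀ c ∈ freeApplicants M, c ≠ a → (q p).rel a c) :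
    HasStage q M := by
  refine ⟨oneTr (freePositions M) a, obviouslyTruthfulSub_oneTr _ _, fun M' hM' => ?_,
    fun cont hcont => .one M a ha htop cont hcont⟩
  obtain ⟨p, hp, rfl⟩ := exists_of_mem_outcomes_oneTr hne hM'
  exact ⟨by simp, .one a p, by simp [ha, hp]⟩

theorem hasStage_two (h2 : 2 ≤ (freePositions M).ncard) {a b : A} (ha : a ∈ freeApplicants M)
    (hb : b ∈ freeApplicants M) (hab : a ≠ b)
    (htop : ∀ p ∈ freePositions M, ∀ c ∈ freeApplicants M, c ≠ a → c ≠ b →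
      (q p).rel a c ∧ (q p).rel b c) : HasStage q M := by
  let U := {p | p ∈ freePositions M ∧ (q p).rel a b}
  let V := {p | p ∈ freePositions M ∧ (q p).rel b a}
  have hUV : U ∪ V = freePositions M := by
    ext p
    refine ⟨fun h => h.elim And.left And.left, fun h => ?_⟩
    exact ((q p).total a b hab).imp (fun h' => ⟨h, h'⟩) fun h' => ⟨h, h'⟩
  have hne : (U ∪ V).Nonempty := by
    rw [hUV]
    exact Set.nonempty_of_ncard_ne_zero (s := freePositions M) (by omega)
  have hne' : ∀ z, ((U ∪ V) \ {z}).Nonempty := by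
    intro z
    rw [hUV]
    obtain ⟨y, hy, hyz⟩ := Set.exists_ne_of_one_lt_ncard (s := freePositions M) (by omega) z
    exact ⟨y, hy, hyz⟩
  refine ⟨twoTr U V a b, obviouslyTruthfulSub_twoTr hne hne', fun M' hM' => ?_,
    fun cont hcont => .two M a b ha hb hab htop U V rfl rfl cont hcont⟩
  obtain ⟨p, hp, r, hr, hpr, rfl⟩ := exists_of_mem_outcomes_twoTr hne hne' hM'
  rw [hUV] at hp hr
  exact ⟨by simp, .two hab hpr, by simp [ha, hb, hp, hr]⟩

theorem hasStage_three (h3 : 3 ≤ (freePositions M).ncard) {k : ℕ} (hk : 3 ≤ k) {l : Fin k → A}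
    (hl : Function.Injective l) (hfree : ∀ i, l i ∈ freeApplicants M)
    (htop : ∀ p ∈ freePositions M, ∀ c ∈ freeApplicants M, c ∉ Set.range l →
      ∀ i, (q p).rel (l i) c) {u v : P} (halt : AlternatingWith q (freePositions M) l u v) :
    HasStage q M := by
  set X := freePositions M \ {u, v} with hX
  have hXne : X.Nonempty := by
    have h1 : ({u, v} : Set P).ncard ≤ 2 := (Set.ncard_insert_le u {v}).trans (by simp)
    have := Set.ncard_le_ncard_sdiff_add_ncard (freePositions M) {u, v}
    exact Set.nonempty_of_ncard_ne_zero (s := freePositions M \ {u, v}) (by omega)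
  have hq := halt.threeLuPriorities hk hl hfree htop hX
  obtain ⟨hu, hv, huv, -⟩ := id halt
  have hXp : ∀ p ∈ X, p ∈ freePositions M ∧ p ≠ u ∧ p ≠ v := fun p hp => by
    rw [hX] at hp
    simpa using hp
  refine ⟨threeLu X u v (l ⟨0, by omega⟩) (l ⟨1, by omega⟩) (l ⟨2, by omega⟩),
    obviouslyTruthfulSub_threeLu hXne, fun M' hM' => ?_, fun cont hcont =>
      .three M k hk l hl hfree htop X u v halt hX hXne cont hcont⟩
  rcases mem_outcomes_threeLu hXne hM' with ⟨p, hp, rfl⟩ | hM'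
  · have : p ∈ freePositions M := hp.elim (fun h => (hXp p h).1) fun h => h ▸ hu
    exact ⟨by simp, .one _ _, by simp [hfree, this]⟩
  rcases mem_outcomes_threeLuPassOne hXne hM' with ⟨p, hp, rfl⟩ | ⟨p, hp, rfl⟩ | hM'
  · have h1 : p ∈ freePositions M := hp.elim (fun h => (hXp p h).1) fun h => h ▸ hu
    have h2 : p ≠ v := hp.elim (fun h => (hXp p h).2.2) fun h => h ▸ huv
    exact ⟨by simp, .two hq.ne₁₂ h2, by simp [hfree, h1, hv]⟩
  · obtain ⟨h1, h2, h3⟩ := hXp p hp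
    exact ⟨by simp, .two hq.ne₁₂ h3.symm, by simp [hfree, h1, hv]⟩
  rcases mem_outcomes_threeLuPassTwo hXne hM' with ⟨p, hp, rfl⟩ | hM'
  · obtain ⟨h1, h2, h3⟩ := hXp p hp
    exact ⟨by simp, .three hq.ne₁₂ hq.ne₁₃ hq.ne₂₃ huv.symm h3.symm h2.symm,
      by simp [hfree, h1, hu, hv]⟩
  rcases mem_outcomes_threeLuPassThree hXne hM' with ⟨p, hp, rfl⟩ | ⟨p, hp, rfl⟩ | ⟨p, hp, rfl⟩
  · obtain ⟨h1, h2, h3⟩ := hXp p hp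
    exact ⟨by simp, .three hq.ne₁₂ hq.ne₁₃ hq.ne₂₃ h3.symm huv.symm h2,
      by simp [hfree, h1, hu, hv]⟩
  · obtain ⟨h1, h2, h3⟩ := hXp p hp
    exact ⟨by simp, .three hq.ne₁₂ hq.ne₁₃ hq.ne₂₃ h3 h2 huv.symm, by simp [hfree, h1, hu, hv]⟩
  · obtain ⟨h1, h2, h3⟩ := hXp p hp
    exact ⟨by simp, .three hq.ne₁₂ hq.ne₁₃ hq.ne₂₃ huv h2.symm h3.symm, by simp [hfree, h1, hu, hv]⟩

end Stages

theorem flipLt_add {s s' : ℕ → Prop} {n : ℕ} (hs : ∀ i, s (n + i) ↔ s' i) (i j : ℕ) :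
    FlipLt s (n + i) (n + j) ↔ FlipLt s' i j := by
  unfold FlipLt
  rw [hs, hs]
  simp only [add_lt_add_iff_left, add_assoc, add_right_inj]

/-- An interval of labels is again alternating, with the roles of `u` and `v` exchanged if the
number `n` of dropped labels is odd. -/
theorem AlternatingWith.shift {A P : Type u} {q : P → Ranking A} {R R' : Set P} {k k' n : ℕ}
    {l : Fin k → A}
    {u v : P}
    (h : AlternatingWith q R l u v) (hR : R' ⊆ R) (hu : u ∈ R') (hv : v ∈ R')
    (hk : n + k' ≤ k) :
    ∃ u' v', AlternatingWith q R' (fun i : Fin k' => l ⟨n + i, by omega⟩) u' v' := by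
  obtain ⟨-, -, huv, hqu, hqv, hqx⟩ := h
  have hx : ∀ x ∈ R', x ≠ u → x ≠ v → ∀ i j : Fin k',
      (q x).rel (l ⟨n + i, by omega⟩) (l ⟨n + j, by omega⟩) ↔ i < j := fun x hx hxu hxv i j => by
    rw [hqx x (hR hx) hxu hxv]
    simp only [Fin.lt_def, add_lt_add_iff_left]
  rcases Nat.even_or_odd n with hn | hn
  · refine ⟨u, v, hu, hv, huv, fun i j => ?_, fun i j => ?_, hx⟩
    · rw [hqu]
      exact flipLt_add (fun i => by simp [← Nat.not_even_iff_odd, Nat.even_add, hn]) i j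
    · rw [hqv]
      exact flipLt_add (fun i => by simp [Nat.even_add, hn]) i j
  · have hn' := Nat.not_even_iff_odd.2 hn
    refine ⟨v, u, hv, hu, huv.symm, fun i j => ?_, fun i j => ?_, fun x h h' h'' => hx x h h'' h'⟩
    · rw [hqv]
      exact flipLt_add (fun i => by simp [Nat.even_add, hn']) i j
    · rw [hqu]
      exact flipLt_add (fun i => by simp [← Nat.not_even_iff_odd, Nat.even_add, hn']) i j

/-- If the applicants `l` are listed as in two-adjacent-alternating priorities, then a position that
ranks `l j` above `l i` for `i < j` is `u` or `v`, and `j = i + 1`. -/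
theorem AlternatingWith.rel_or {A P : Type u} {q : P → Ranking A} {R : Set P} {k : ℕ}
    {l : Fin k → A} {u v : P} (h : AlternatingWith q R l u v) {p : P} (hp : p ∈ R) {i j : Fin k}
    (hij : i < j) : (q p).rel (l i) (l j) ∨
      (j : ℕ) = i + 1 ∧ (p = u ∧ Odd (i : ℕ) ∨ p = v ∧ Even (i : ℕ)) := by
  obtain ⟨-, -, -, hqu, hqv, hqx⟩ := h
  by_cases hu : p = u
  · rw [hu, hqu, (flipLt_iff_of_lt hij).1]
    tauto
  by_cases hv : p = v
  · rw [hv, hqv, (flipLt_iff_of_lt hij).1]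
    tauto
  exact Or.inl ((hqx p hp hu hv i j).2 hij)

/-- Only the first block with a free applicant matters. In a block of at most two applicants, the
free ones play the one- or two-applicant stage. In an alternating block let `n` be the first free
label. If `n, n + 1, n + 2` and both `u, v` are free, then 3Lu applies to the maximal run of free
labels from `n` on; otherwise at most one of the swaps at `n` and at `n + 1` is still effective, and
one or two applicants are separated from the rest. -/
theorem LimitedCyclic.hasStage {A P : Type u} [Fintype A] [Fintype P]
    (hcard : Fintype.card A = Fintype.card P) {q : P → Ranking A} (hq : LimitedCyclic q)
    {M : List (A × P)} (hM : IsPartialMatching M) (hne : (freeApplicants M).Nonempty) :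
    HasStage q M := by
  classical
  obtain ⟨L, s, -, hs, hblock⟩ := hq
  have hncard := hM.ncard_freePositions hcard
  have hneP : (freePositions M).Nonempty := by
    have := (Set.ncard_pos (s := freeApplicants M)).2 hne
    exact Set.nonempty_of_ncard_ne_zero (s := freePositions M) (by omega)
  obtain ⟨a, ha, hmin⟩ := Set.exists_min_image (freeApplicants M) s (Set.toFinite _) hne
  have htop : ∀ b, s b = s a → ∀ c ∈ freeApplicants M, s c ≠ s a → ∀ p, (q p).rel b c :=
    fun b hb c hc hca p => hs b c (hb ▸ lt_of_le_of_ne (hmin c hc) (Ne.symm hca)) p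
  by_cases h3 : 3 ≤ {b | s b = s a}.ncard
  swap
  · by_cases hb : ∃ b ∈ freeApplicants M, s b = s a ∧ b ≠ a
    · obtain ⟨b, hb, hsb, hba⟩ := hb
      have h2 : 2 ≤ (freePositions M).ncard := by
        rw [hncard, ← Set.ncard_pair hba]
        exact Set.ncard_le_ncard (Set.insert_subset hb (by simpa using ha))
      refine hasStage_two h2 ha hb hba.symm fun p _ c hc hca hcb => ?_
      have hsc : s c ≠ s a := by
        intro hsc
        apply h3
        have : ({c, b, a} : Finset A).card = 3 := by
          rw [Finset.card_insert_of_notMem (by simp [hca, hcb]), Finset.card_pair hba]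
        rw [← this, ← Set.ncard_coe_finset]
        refine Set.ncard_le_ncard fun x hx => ?_
        simp only [Finset.coe_insert, Finset.coe_singleton, Set.mem_insert_iff,
          Set.mem_singleton_iff] at hx
        rcases hx with rfl | rfl | rfl
        · exact hsc
        · exact hsb
        · rfl
      exact ⟨htop a rfl c hc hsc p, htop b hsb c hc hsc p⟩
    · push Not at hb
      refine hasStage_one hneP ha fun p _ c hc hca => htop a rfl c hc (fun hsc => ?_) p
      exact hca (hb c hc hsc)
  · obtain ⟨-, k, hk, l, hl, hlS, u, v, halt⟩ := hblock (s a) h3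
    have hsl : ∀ i, s (l i) = s a := fun i => by
      have : l i ∈ {b | s b = s a} := hlS ▸ Set.mem_range_self i
      exact this
    have hlab : ∀ c, s c = s a → ∃ i, l i = c := fun c hc => by
      have : c ∈ Set.range l := hlS ▸ hc
      exact this
    -- the first free label
    obtain ⟨n, ⟨hnk, hn⟩, hnmin⟩ : ∃ n, (∃ h : n < k, l ⟨n, h⟩ ∈ freeApplicants M) ∧
        ∀ j : Fin k, l j ∈ freeApplicants M → n ≤ j := by
      have hex : ∃ n, ∃ h : n < k, l ⟨n, h⟩ ∈ freeApplicants M := by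
        obtain ⟨i, rfl⟩ := hlab a rfl
        exact ⟨i, i.2, ha⟩
      exact ⟨Nat.find hex, Nat.find_spec hex, fun j hj => Nat.find_min' hex ⟨j.2, hj⟩⟩
    have hcases : ∀ c ∈ freeApplicants M, s c ≠ s a ∨ ∃ j : Fin k, l j = c ∧ n ≤ j := by
      intro c hc
      by_cases hsc : s c = s a
      · obtain ⟨j, rfl⟩ := hlab c hsc
        exact Or.inr ⟨j, rfl, hnmin j hc⟩
      · exact Or.inl hsc
    by_cases hthree : (∃ h : n + 2 < k, l ⟨n + 1, by omega⟩ ∈ freeApplicants M ∧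
        l ⟨n + 2, h⟩ ∈ freeApplicants M) ∧ u ∈ freePositions M ∧ v ∈ freePositions M
    · obtain ⟨⟨h2k, hn1, hn2⟩, hu, hv⟩ := hthree
      -- the length of the run of free labels that starts with the first one
      obtain ⟨r, hrk, hrfree, hrstop⟩ : ∃ r, ∃ h : n + r ≤ k,
          (∀ i : Fin r, l ⟨n + i, by omega⟩ ∈ freeApplicants M) ∧
          ∀ h : n + r < k, l ⟨n + r, h⟩ ∉ freeApplicants M := by
        have hex : ∃ r, ∀ h : n + r < k, l ⟨n + r, h⟩ ∉ freeApplicants M :=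
          ⟨k, fun h => by omega⟩
        have hfree : ∀ i, i < Nat.find hex → ∃ h : n + i < k, l ⟨n + i, h⟩ ∈ freeApplicants M := by
          intro i hi
          have := Nat.find_min hex hi
          push Not at this
          exact this
        refine ⟨Nat.find hex, ?_, fun i => (hfree i i.2).2, Nat.find_spec hex⟩
        by_contra hlt
        obtain ⟨h, -⟩ := hfree (Nat.find hex - 1) (by omega)
        omega
      have hr3 : 3 ≤ r := by
        by_contra hr
        have : r = 0 ∨ r = 1 ∨ r = 2 := by omega
        rcases this with rfl | rfl | rfl
        · exact hrstop hnk hn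
        · exact hrstop (by omega) hn1
        · exact hrstop h2k hn2
      obtain ⟨u', v', halt'⟩ := halt.shift (Set.subset_univ _) hu hv hrk
      have hinj : Function.Injective fun i : Fin r => l ⟨n + i, by omega⟩ := by
        intro i j hij
        have := Fin.val_eq_of_eq (hl hij)
        exact Fin.ext (by simpa using this)
      have hP3 : 3 ≤ (freePositions M).ncard := by
        have h1 : (Set.range fun i : Fin r => l ⟨n + i, by omega⟩).ncard = r := by
          rw [← Set.image_univ, Set.InjOn.ncard_image hinj.injOn, Set.ncard_univ, Nat.card_fin]
        rw [hncard]
        refine hr3.trans (h1 ▸ Set.ncard_le_ncard ?_)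
        rintro _ ⟨i, rfl⟩
        exact hrfree i
      refine hasStage_three hP3 hr3 hinj hrfree (fun p _ c hc hcl i => ?_) halt'
      rcases hcases c hc with hsc | ⟨j, rfl, hj⟩
      · exact htop _ (hsl _) c hc hsc p
      -- The label `n + r` that ends the run is not free. So later free applicants are at distance
      -- at least two from the run, and no swap reaches across.
      · have hjr : n + r < j := by
          by_contra hlt
          rcases (not_lt.1 hlt).lt_or_eq with h | h
          · exact hcl ⟨⟨j - n, by omega⟩, congrArg l (Fin.ext (by simp only; omega))⟩
          · refine hrstop (h ▸ j.2) ?_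
            have : (⟨n + r, h ▸ j.2⟩ : Fin k) = j := Fin.ext h.symm
            rwa [this]
        have hi := i.2
        refine (halt.rel_or (Set.mem_univ p) (i := ⟨n + i, by omega⟩)
          (by rw [Fin.lt_def]; simp only; omega)).resolve_right fun h => ?_
        have := h.1
        simp only at this
        omega
    · by_cases htwo : ∃ h : n + 1 < k, l ⟨n + 1, h⟩ ∈ freeApplicants M ∧
          ∃ p ∈ freePositions M, (q p).rel (l ⟨n + 1, h⟩) (l ⟨n, hnk⟩)
      · obtain ⟨h1k, hn1, p₀, hp₀, hq₀⟩ := htwo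
        have hne' : l ⟨n, hnk⟩ ≠ l ⟨n + 1, h1k⟩ := fun h => by
          have := Fin.val_eq_of_eq (hl h)
          simp only at this
          omega
        have h2 : 2 ≤ (freePositions M).ncard := by
          rw [hncard, ← Set.ncard_pair hne']
          exact Set.ncard_le_ncard (Set.insert_subset hn (by simpa using hn1))
        refine hasStage_two h2 hn hn1 hne' fun p hp c hc hca hcb => ?_
        rcases hcases c hc with hsc | ⟨j, rfl, hj⟩
        · exact ⟨htop _ (hsl _) c hc hsc p, htop _ (hsl _) c hc hsc p⟩
        have hjn : n + 1 < j := by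
          have h1 : (j : ℕ) ≠ n := fun h => hca (congrArg l (Fin.ext h))
          have h2 : (j : ℕ) ≠ n + 1 := fun h => hcb (congrArg l (Fin.ext h))
          omega
        refine ⟨(halt.rel_or (Set.mem_univ p) (i := ⟨n, hnk⟩)
          (by rw [Fin.lt_def]; simp only; omega)).resolve_right fun h => ?_,
          (halt.rel_or (Set.mem_univ p) (i := ⟨n + 1, h1k⟩)
          (by rw [Fin.lt_def]; simp only; omega)).resolve_right fun h => ?_⟩
        · have := h.1
          simp only at this
          omega
        · obtain ⟨hj2, hpuv⟩ := h
          simp only at hj2 hpuv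
          have hj2' : (⟨n + 2, by omega⟩ : Fin k) = j := Fin.ext (by simp only; omega)
          -- A free position `p` that swaps the labels `n + 1, n + 2` and the free position `p₀`
          -- that swaps `n, n + 1` are, by parity, `u` and `v` in some order. So all conditions for
          -- 3Lu would hold.
          have h0 := (halt.rel_or (Set.mem_univ p₀) (i := ⟨n, hnk⟩) (j := ⟨n + 1, h1k⟩)
            (by simp [Fin.lt_def])).resolve_left ((q p₀).asymm hq₀)
          have h0 := h0.2
          simp only at h0
          refine hthree ⟨⟨by omega, hn1, hj2' ▸ hc⟩, ?_⟩
          rw [Nat.odd_add_one, Nat.even_add_one, Nat.not_odd_iff_even, Nat.not_even_iff_odd] at hpuv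
          rcases hpuv with ⟨rfl, he⟩ | ⟨rfl, ho⟩ <;> rcases h0 with ⟨rfl, ho'⟩ | ⟨rfl, he'⟩
          · exact absurd he (Nat.not_even_iff_odd.2 ho')
          · exact ⟨hp, hp₀⟩
          · exact ⟨hp₀, hp⟩
          · exact absurd he' (Nat.not_even_iff_odd.2 ho)
      -- Only the applicant with label `n + 1` could precede `l n` at a free position, and this is
      -- the case already excluded.
      · refine hasStage_one hneP hn fun p hp c hc hca => ?_
        rcases hcases c hc with hsc | ⟨j, rfl, hj⟩
        · exact htop _ (hsl _) c hc hsc p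
        have hjn : n < j := lt_of_le_of_ne hj fun h => hca (congrArg l (Fin.ext h.symm))
        by_contra hno
        obtain ⟨hj1, -⟩ := (halt.rel_or (Set.mem_univ p) (i := ⟨n, hnk⟩)
          (j := j) (by rw [Fin.lt_def]; exact hjn)).resolve_left hno
        simp only at hj1
        have hj1' : (⟨n + 1, by omega⟩ : Fin k) = j := Fin.ext hj1.symm
        refine htwo ⟨by omega, hj1' ▸ hc, p, hp, ?_⟩
        rw [hj1']
        exact ((q p).not_rel (Ne.symm hca)).1 hno

theorem mainTheorem1 {A P : Type u} [Fintype A] [Fintype P]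
    (hcard : Fintype.card A = Fintype.card P) (q : P → Ranking A) :
    List.TFAE
      [OSPImplementable (matchingEnv A P) (DA hcard q),
       LimitedCyclic q,
       ∃ G : GameTree A (matchingEnv A P).Ty (matchingEnv A P).Outcome,
         IsComposed q [] G ∧ IsOSP (matchingEnv A P) G ∧ Implements G (DA hcard q),
       (∀ t ∈ forbiddenThree, ¬ HasRestriction q t) ∧ ¬ HasRestriction q forbiddenFour] := by
  tfae_have 3 → 1 := fun ⟨G, _, hG, himp⟩ => ⟨G, hG, himp⟩
  tfae_have 1 → 4 := fun h => ⟨h.not_hasRestriction_three, h.not_hasRestriction_four⟩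
  tfae_have 4 → 2 := fun h => LimitedCyclic.of_not_hasRestriction hcard h.1 h.2
  tfae_have 2 → 3 := fun h => by
    obtain ⟨G, hG, hG'⟩ := exists_isComposed hcard (fun _ hM hne => h.hasStage hcard hM hne) .nil
    refine ⟨G, hG, hG'.isOSPFrom _, fun t => ?_⟩
    exact hG.play_eq (DA_isApplicantOptimal hcard q t) fun a p hap => by simp at hap
  tfae_finish
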